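/- Let $d\ge 1$, $\alpha\in(0,1)$, $T>0$, let $G\subset\mathbb{R}^d$ be a bounded open set (for instance a bounded Lipschitz domain), $G_0\subset G$ a Lebesgue measurable set with $|G_0|>0$, and let $\xi$ be a real random variable on a probability space $(\Omega,\mathcal F,\mathbb P)$. Write $L^2(G)=L^2(G;\mathbb C)$, with inner product $\langle f,g\rangle=\int_G f\overline g\,dx$, and let $\Delta$ be the Dirichlet Laplacian of $G$, with domain $D(\Delta)=\{v\in H^1_0(G):\Delta v\in L^2(G)\}$, where $H^1_0(G)$ is the closure of $C_c^\infty(G)$ in $H^1(G)$. Put $$(I^{\beta}_{0,t}g)(t)=\frac1{\Gamma(\beta)}\int_0^t(t-s)^{\beta-1}g(s)\,ds,\qquad (I^{\beta}_{t,T}g)(t)=\frac1{\Gamma(\beta)}\int_t^T(s-t)^{\beta-1}g(s)\,ds,$$ $\partial^\alpha_{0,t}g=\frac{d}{dt}I^{1-\alpha}_{0,t}(g-g(0))$ (Caputo derivative, in the sense that $I^{1-\alpha}_{0,t}(g-g(0))$ is absolutely continuous on $[0,T]$; it equals $I^{1-\alpha}_{0,t}g'$ for absolutely continuous $g$) and $D^\alpha_{t,T}g=-\frac{d}{dt}I^{1-\alpha}_{t,T}g$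 (right Riemann–Liouville derivative). For $r\in\mathbb R$, $y_0\in L^2(G)$ and $u\in L^\infty((0,T)\times G_0)$ let $y=y(\cdot,\cdot;r;y_0;u)\in C([0,T];L^2(G))$ be the weak solution of the forward system $$\partial^\alpha_{0,t}y-r\,\mathrm i\Delta y=\mathbf 1_{G_0}u\ \text{ in }(0,T)\times G,\qquad y=0\ \text{ on }(0,T)\times\partial G,\qquad y(0)=y_0,$$ that is, $y(0)=y_0$ and $\partial^\alpha_{0,t}\langle y,\varphi\rangle=r\,\mathrm i\langle y,\Delta\varphi\rangle+\int_{G_0}u\,\overline{\varphi}\,dx$ a.e. on $(0,T)$ for all $\varphi\in D(\Delta)$. For $z_T\in L^2(G)$ let $z=z(\cdot,\cdot;r;z_T)\in C([0,T);L^2(G))\cap L^1(0,T;L^2(G))$ be the weak solution of the adjoint system $$D^\alpha_{t,T}z+r\,\mathrm i\Delta z=0\ \text{ in }(0,T)\times G,\qquad z=0\ \text{ on }(0,T)\times\partial G,\qquad I^{1-\alpha}_{t,T}z|_{t=T}=z_T,$$ that is, $I^{1-\alpha}_{t,T}z(t)\to z_T$ in $L^2(G)$ as $t\to T^-$ and $D^\alpha_{t,T}\langle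 z,\varphi\rangle=-r\,\mathrm i\langle z,\Delta\varphi\rangle$ on $(0,T)$ for all $\varphi\in D(\Delta)$. Expectations $\mathbb E$ below are Bochner integrals in $L^2(G)$ over $\omega$, of the solutions with $r=\xi(\omega)$; their existence is part of each property. For a constant $C>0$: * the forward system is *null averaged controllable with cost $C$* if for every $y_0\in L^2(G)$ there is $u\in L^\infty((0,T)\times G_0)$ with $\|u\|_{L^\infty((0,T)\times G_0)}\le C\|y_0\|_{L^2(G)}$ and $\mathbb E(y(T,\cdot;\xi;y_0;u))=0$; * it is *exactly averaged controllable with cost $C$* if for all $y_0,y_1\in L^2(G)$ there is $u\in L^\infty((0,T)\times G_0)$ with $\|u\|_{L^\infty((0,T)\times G_0)}\le C(\|y_0\|_{L^2(G)}+\|y_1\|_{L^2(G)})$ and $\mathbb E(y(T,\cdot;\xi;y_0;u))=y_1$; * the adjoint system is *null averaged observable with cost $C$* if for every $z_T\in L^2(G)$ $$\|\mathbb E(I^{1-\alpha}_{t,T}z(0,\cdot;\xi;z_T))\|_{L^2(G)}\le C\int_0^T\!\!\int_{G_0}|\mathbb E(z(t,x;\xi;z_T))|\,dx\,dt;$$ *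 it is *exactly averaged observable with cost $C$* if for every $z_T\in L^2(G)$ $$\|z_T\|_{L^2(G)}\le C\int_0^T\!\!\int_{G_0}|\mathbb E(z(t,x;\xi;z_T))|\,dx\,dt.$$ Each property is said to hold if it holds with some cost $C>0$, and its optimal cost is the infimum of the admissible $C>0$ ($+\infty$ if there are none). Then the forward system is null (resp. exactly) averaged controllable if and only if the adjoint system is null (resp. exactly) averaged observable, and the optimal costs agree: $\mathscr C_{null}=\mathscr C_{ob}$ (resp. $\mathscr C_{ex}=\mathscr C_{exob}$). -/

import Mathlib

open MeasureTheory Set Filter Topology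
open scoped ENNReal ComplexConjugate

noncomputable section

namespace FracSchrodinger

/-! ### Fractional calculus on `(0,T)` -/

section Fractional

variable {H : Type*} [NormedAddCommGroup H] [NormedSpace ℝ H]

/-- Left Riemann–Liouville integral
`(I^β_{0,t} g)(t) = 1/Γ(β) ∫_0^t (t-s)^{β-1} g(s) ds`. -/
def leftFracInt (β : ℝ) (g : ℝ → H) (t : ℝ) : H :=
  ∫ s in (0 : ℝ)..t, ((t - s) ^ (β - 1) / Real.Gamma β) • g s

/-- Right Riemann–Liouville integral
`(I^β_{t,T} g)(t) = 1/Γ(β) ∫_t^T (s-t)^{β-1} g(s) ds`. -/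
def rightFracInt (β T : ℝ) (g : ℝ → H) (t : ℝ) : H :=
  ∫ s in t..T, ((s - t) ^ (β - 1) / Real.Gamma β) • g s

/-- `h` is the left Caputo derivative `∂^α_{0,t} g` on `(0,T)` of a function `g` that is continuous
on `[0,T]`, in the usual generalized sense `∂^α_{0,t} g = d/dt I^{1-α}_{0,t} (g - g(0))`: the
function `I^{1-α}_{0,t} (g - g(0))` is absolutely continuous on `[0,T]` (it vanishes at `0`), with
a.e. derivative `h ∈ L¹(0,T)`. For absolutely continuous `g` this is
`h = I^{1-α}_{0,t} g'`, because `I^{1-α} I^1 g' = I^1 I^{1-α} g'`. -/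
def HasCaputoDeriv (α T : ℝ) (g h : ℝ → ℂ) : Prop :=
  IntervalIntegrable h volume 0 T ∧
    ∀ t ∈ Icc (0 : ℝ) T,
      leftFracInt (1 - α) (fun s => g s - g 0) t = ∫ s in (0 : ℝ)..t, h s

/-- `h` is the right Riemann–Liouville derivative
`D^α_{t,T} g = - d/dt I^{1-α}_{t,T} g` on `(0,T)`. -/
def HasRightRLDeriv (α T : ℝ) (g h : ℝ → ℂ) : Prop :=
  ∀ t ∈ Ioo (0 : ℝ) T, HasDerivAt (rightFracInt (1 - α) T g) (-h t) t

end Fractional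

/-! ### The Dirichlet Laplacian -/

/-- `L²(G) = L²(G;ℂ)`. Mathlib's `inner ℂ φ v` is `∫_G v conj(φ)`. -/
abbrev L2 {d : ℕ} (G : TopologicalSpace.Opens (EuclideanSpace ℝ (Fin d))) : Type :=
  Lp ℂ 2 (volume.restrict (G : Set (EuclideanSpace ℝ (Fin d))))

/-- The partial derivative `∂_i φ`. -/
def partialDeriv {d : ℕ} (i : Fin d) (φ : EuclideanSpace ℝ (Fin d) → ℂ)
    (x : EuclideanSpace ℝ (Fin d)) : ℂ :=
  fderiv ℝ φ x (EuclideanSpace.single i 1)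

/-- `v ∈ H¹₀(G)` with weak gradient `g ∈ L²(G)^d`: `(v, g)` is the limit, in `L²(G) × L²(G)^d`, of
`(φ_k, ∇φ_k)` for a sequence of test functions `φ_k ∈ C_c^∞(G)`. -/
def HasGradH10 {d : ℕ} (G : TopologicalSpace.Opens (EuclideanSpace ℝ (Fin d)))
    (v : L2 G) (g : Fin d → L2 G) : Prop :=
  ∃ φ : ℕ → TestFunction G ℂ ⊤,
    Tendsto (fun k => eLpNorm (fun x => φ k x - v x) 2
      (volume.restrict (G : Set (EuclideanSpace ℝ (Fin d))))) atTop (𝓝 0) ∧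
    ∀ i, Tendsto (fun k => eLpNorm (fun x => partialDeriv i (φ k) x - g i x) 2
      (volume.restrict (G : Set (EuclideanSpace ℝ (Fin d))))) atTop (𝓝 0)

/-- `v` belongs to the domain `{v ∈ H¹₀(G) : Δv ∈ L²(G)}` of the Dirichlet Laplacian of `G`, and
`f = Δv`, in the weak sense `∫_G ∇v · ∇ψ = -∫_G f ψ` for all test functions `ψ`. -/
def IsDirichletLaplacian {d : ℕ} (G : TopologicalSpace.Opens (EuclideanSpace ℝ (Fin d)))
    (v f : L2 G) : Prop :=
  ∃ g : Fin d → L2 G, HasGradH10 G v g ∧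
    ∀ ψ : TestFunction G ℂ ⊤,
      ∑ i, ∫ x in (G : Set (EuclideanSpace ℝ (Fin d))), g i x * partialDeriv i ψ x =
        -∫ x in (G : Set (EuclideanSpace ℝ (Fin d))), f x * ψ x

/-! ### The forward and the adjoint system -/

/-- The space `L^∞((0,T) × G₀)` of controls. -/
abbrev Control {d : ℕ} (T : ℝ) (G₀ : Set (EuclideanSpace ℝ (Fin d))) : Type :=
  Lp ℂ ∞ (((volume : Measure ℝ).restrict (Ioo 0 T)).prod
    ((volume : Measure (EuclideanSpace ℝ (Fin d))).restrict G₀))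

/-- `y ∈ C([0,T]; L²(G))` is the weak solution of
`∂^α_{0,t} y - ξ i Δ y = 1_{G₀} u` on `(0,T) × G`, `y = 0` on `(0,T) × ∂G`, `y(0) = y₀`.
The equation and the boundary condition are tested against the domain of the Dirichlet Laplacian:
`∂^α_{0,t} ⟨y,φ⟩ = ξ i ⟨y,Δφ⟩ + ∫_{G₀} u conj(φ)`. -/
structure IsForwardSolution {d : ℕ} (α T : ℝ)
    (G : TopologicalSpace.Opens (EuclideanSpace ℝ (Fin d)))
    (G₀ : Set (EuclideanSpace ℝ (Fin d))) (ξ : ℝ) (y₀ : L2 G) (u : Control T G₀)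
    (y : ℝ → L2 G) : Prop where
  continuousOn : ContinuousOn y (Icc 0 T)
  initial : y 0 = y₀
  equation : ∀ φ f : L2 G, IsDirichletLaplacian G φ f →
    HasCaputoDeriv α T (fun t => inner ℂ φ (y t))
      (fun t => (ξ : ℂ) * Complex.I * inner ℂ f (y t) + ∫ x in G₀, u (t, x) * conj (φ x))

/-- `z ∈ C([0,T); L²(G)) ∩ L¹(0,T; L²(G))` is the weak solution of
`D^α_{t,T} z + ξ i Δ z = 0` on `(0,T) × G`, `z = 0` on `(0,T) × ∂G`, `I^{1-α}_{t,T} z |_{t=T} = z_T`.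
The terminal condition is a limit in `L²(G)` as `t → T⁻`; the equation and the boundary condition
are tested against the domain of the Dirichlet Laplacian:
`D^α_{t,T} ⟨z,φ⟩ = - ξ i ⟨z,Δφ⟩`. -/
structure IsAdjointSolution {d : ℕ} (α T : ℝ)
    (G : TopologicalSpace.Opens (EuclideanSpace ℝ (Fin d)))
    (ξ : ℝ) (zT : L2 G) (z : ℝ → L2 G) : Prop where
  continuousOn : ContinuousOn z (Ico 0 T)
  integrable : IntervalIntegrable z volume 0 T
  terminal : Tendsto (rightFracInt (1 - α) T z) (𝓝[<] T) (𝓝 zT)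
  equation : ∀ φ f : L2 G, IsDirichletLaplacian G φ f →
    HasRightRLDeriv α T (fun t => inner ℂ φ (z t))
      (fun t => -((ξ : ℂ) * Complex.I * inner ℂ f (z t)))

/-! ### Averaged controllability and observability -/

section Averaged

variable {d : ℕ} {Ω : Type*} [MeasurableSpace Ω]

/-- `𝔼(y(T,·;ξ;y₀;u)) = m`, where `y(·,·;ξ(ω);y₀;u)` solves the forward system with diffusivity
`ξ(ω)` for almost every `ω`; the expectation exists as a Bochner integral in `L²(G)`. -/
def IsAveragedFinalState (α T : ℝ) (G : TopologicalSpace.Opens (EuclideanSpace ℝ (Fin d)))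
    (G₀ : Set (EuclideanSpace ℝ (Fin d))) (P : Measure Ω) (ξ : Ω → ℝ)
    (y₀ : L2 G) (u : Control T G₀) (m : L2 G) : Prop :=
  ∃ y : Ω → ℝ → L2 G,
    (∀ᵐ ω ∂P, IsForwardSolution α T G G₀ (ξ ω) y₀ u (y ω)) ∧
    Integrable (fun ω => y ω T) P ∧ ∫ ω, y ω T ∂P = m

/-- `Z(t) = 𝔼(z(t,·;ξ;z_T))` for `0 ≤ t < T` and `W = 𝔼(I^{1-α}_{t,T} z(0,·;ξ;z_T))`, where
`z(·,·;ξ(ω);z_T)` solves the adjoint system with diffusivity `ξ(ω)` for almost every `ω`; the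
expectations exist as Bochner integrals in `L²(G)`. -/
def IsAveragedAdjoint (α T : ℝ) (G : TopologicalSpace.Opens (EuclideanSpace ℝ (Fin d)))
    (P : Measure Ω) (ξ : Ω → ℝ) (zT : L2 G) (Z : ℝ → L2 G) (W : L2 G) : Prop :=
  ∃ z : Ω → ℝ → L2 G,
    (∀ᵐ ω ∂P, IsAdjointSolution α T G (ξ ω) zT (z ω)) ∧
    (∀ t ∈ Ico 0 T, Integrable (fun ω => z ω t) P ∧ ∫ ω, z ω t ∂P = Z t) ∧
    Integrable (fun ω => rightFracInt (1 - α) T (z ω) 0) P ∧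
    ∫ ω, rightFracInt (1 - α) T (z ω) 0 ∂P = W

/-- `∫_0^T ∫_{G₀} |Z(t,x)| dx dt`, with values in `[0,∞]`. -/
def L1Norm (T : ℝ) {G : TopologicalSpace.Opens (EuclideanSpace ℝ (Fin d))}
    (G₀ : Set (EuclideanSpace ℝ (Fin d))) (Z : ℝ → L2 G) : ℝ≥0∞ :=
  ∫⁻ t in Ioo 0 T, ∫⁻ x in G₀, ‖Z t x‖ₑ

/-- The forward system is null averaged controllable with control cost `C`. -/
def NullControllableWithCost (α T : ℝ) (G : TopologicalSpace.Opens (EuclideanSpace ℝ (Fin d)))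
    (G₀ : Set (EuclideanSpace ℝ (Fin d))) (P : Measure Ω) (ξ : Ω → ℝ) (C : ℝ) : Prop :=
  ∀ y₀ : L2 G, ∃ u : Control T G₀,
    ‖u‖ ≤ C * ‖y₀‖ ∧ IsAveragedFinalState α T G G₀ P ξ y₀ u 0

/-- The forward system is exactly averaged controllable with control cost `C`. -/
def ExactControllableWithCost (α T : ℝ) (G : TopologicalSpace.Opens (EuclideanSpace ℝ (Fin d)))
    (G₀ : Set (EuclideanSpace ℝ (Fin d))) (P : Measure Ω) (ξ : Ω → ℝ) (C : ℝ) : Prop :=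
  ∀ y₀ y₁ : L2 G, ∃ u : Control T G₀,
    ‖u‖ ≤ C * (‖y₀‖ + ‖y₁‖) ∧ IsAveragedFinalState α T G G₀ P ξ y₀ u y₁

/-- The adjoint system is null averaged observable with observability cost `C`. -/
def NullObservableWithCost (α T : ℝ) (G : TopologicalSpace.Opens (EuclideanSpace ℝ (Fin d)))
    (G₀ : Set (EuclideanSpace ℝ (Fin d))) (P : Measure Ω) (ξ : Ω → ℝ) (C : ℝ) : Prop :=
  ∀ zT : L2 G, ∃ (Z : ℝ → L2 G) (W : L2 G), IsAveragedAdjoint α T G P ξ zT Z W ∧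
    ‖W‖ₑ ≤ ENNReal.ofReal C * L1Norm T G₀ Z

/-- The adjoint system is exactly averaged observable with observability cost `C`. -/
def ExactObservableWithCost (α T : ℝ) (G : TopologicalSpace.Opens (EuclideanSpace ℝ (Fin d)))
    (G₀ : Set (EuclideanSpace ℝ (Fin d))) (P : Measure Ω) (ξ : Ω → ℝ) (C : ℝ) : Prop :=
  ∀ zT : L2 G, ∃ (Z : ℝ → L2 G) (W : L2 G), IsAveragedAdjoint α T G P ξ zT Z W ∧
    ‖zT‖ₑ ≤ ENNReal.ofReal C * L1Norm T G₀ Z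

end Averaged

/-- The optimal cost: the infimum, in `[0,∞]`, of the positive constants that are admissible
(`∞` if there is none). -/
def optimalCost (admissible : ℝ → Prop) : ℝ≥0∞ :=
  ⨅ (C : ℝ) (_ : 0 < C ∧ admissible C), ENNReal.ofReal C

end FracSchrodinger

end

open FracSchrodinger

noncomputable section

namespace FracSchrodinger

/-! ### Riemann–Liouville kernels -/

/-! The theorem is a duality between the reachable averages and the averaged adjoint states. With A
= -Δ, both systems have explicit solutions: y(t) = E_{α,1}(-irt^αA)y₀ + ∫₀ᵗ
(t-s)^{α-1}E_{α,α}(-ir(t-s)^αA)1_{G₀}u(s) ds and z(t) = (T-t)^{α-1}E_{α,α}(ir(T-t)^αA)z_T. Replacing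
r by -r takes the adjoint of these operators, so Fubini over ω gives ⟨𝔼y(T), z_T⟩ = ⟨y₀,
𝔼I^{1-α}z(0)⟩ + ∫∫ u conj(𝔼z) (`inner_integral_forwardSol`).

Let L z_T be 𝔼z on (0,T) × G₀, a linear map from L²(G) to L¹. A control steers the average to m
exactly when its pairing with every L z_T is prescribed (`isAveragedFinalState_iff_duality`). By
Hahn–Banach and (L¹)* = L^∞, a control of norm at most K exists as soon as the prescribed functional
is bounded by K‖L z_T‖ (`exists_control_of_le`), and this bound follows from observability.
Conversely, inserting suitable data into the duality identity gives observability. Both directions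
keep the constant C, so the properties agree for each C > 0 and the optimal costs coincide.

The analytic input is |E_{α,ϱ}(ix)| ≤ 1/Γ(ϱ) for ϱ ≥ α and real x. It follows from a maximum
principle for fractional derivatives. The case ϱ = 1 has constant exactly 1, so ‖𝔼I^{1-α}z(0)‖ ≤
‖z_T‖, and no constant is lost in the exact problem.

The properties speak of arbitrary weak solutions, so existence and uniqueness are also needed. The
unbounded A appears only through S = (1+A)⁻¹, which is positive and injective with dense range.
Bounded functions of A come from the continuous functional calculus of S, and identities are checked
after applying S. -/

/-- The Riemann–Liouville kernel `t^{β-1}/Γ(β)`. -/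
def rlKernel (β t : ℝ) : ℝ := t ^ (β - 1) / Real.Gamma β

theorem rlKernel_pos {β t : ℝ} (hβ : 0 < β) (ht : 0 < t) : 0 < rlKernel β t :=
  div_pos (Real.rpow_pos_of_pos ht _) (Real.Gamma_pos_of_pos hβ)

theorem rlKernel_nonneg {β t : ℝ} (hβ : 0 < β) (ht : 0 ≤ t) : 0 ≤ rlKernel β t :=
  div_nonneg (Real.rpow_nonneg ht _) (Real.Gamma_pos_of_pos hβ).le

theorem rlKernel_one (t : ℝ) : rlKernel 1 t = 1 := by simp [rlKernel]

theorem measurable_rlKernel (β : ℝ) : Measurable (rlKernel β) :=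
  (measurable_id.pow_const _).div_const _

theorem continuousAt_rlKernel (β : ℝ) {t : ℝ} (ht : t ≠ 0) : ContinuousAt (rlKernel β) t :=
  (Real.continuousAt_rpow_const _ _ (Or.inl ht)).div_const _

theorem intervalIntegrable_rlKernel {β : ℝ} (hβ : 0 < β) (a b : ℝ) :
    IntervalIntegrable (rlKernel β) volume a b :=
  (intervalIntegral.intervalIntegrable_rpow' (by linarith)).div_const _

theorem integral_rlKernel {β t : ℝ} (hβ : 0 < β) :
    ∫ s in (0 : ℝ)..t, rlKernel β s = rlKernel (β + 1) t := by
  simp only [rlKernel]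
  rw [intervalIntegral.integral_div, integral_rpow (Or.inl (by linarith)), Real.Gamma_add_one hβ.ne']
  simp only [sub_add_cancel, add_sub_cancel_right, Real.zero_rpow hβ.ne', sub_zero]
  field_simp

theorem intervalIntegrable_rlKernel_sub {β : ℝ} (hβ : 0 < β) (t a b : ℝ) :
    IntervalIntegrable (fun s => rlKernel β (t - s)) volume a b := by
  simpa using (intervalIntegrable_rlKernel hβ (t - a) (t - b)).comp_sub_left t

/-- The Beta integral; this is the semigroup law I^a I^b = I^{a+b} at the level of kernels. -/
theorem integral_rlKernel_sub_mul {a b t : ℝ} (ha : 0 < a) (hb : 0 < b) (ht : 0 < t) :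
    ∫ s in (0 : ℝ)..t, rlKernel b (t - s) * rlKernel a s = rlKernel (a + b) t := by
  have h1 := Complex.betaIntegral_scaled (a : ℂ) (b : ℂ) ht
  rw [Complex.betaIntegral_eq_Gamma_mul_div _ _ (by simpa) (by simpa), ← Complex.ofReal_add,
    Complex.Gamma_ofReal, Complex.Gamma_ofReal, Complex.Gamma_ofReal] at h1
  have h2 : ∫ s in (0 : ℝ)..t, ((s ^ (a - 1) * (t - s) ^ (b - 1) : ℝ) : ℂ) =
      ∫ x in (0 : ℝ)..t, (x : ℂ) ^ ((a : ℂ) - 1) * ((t : ℂ) - x) ^ ((b : ℂ) - 1) := by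
    refine intervalIntegral.integral_congr_ae (Eventually.of_forall fun x hx => ?_)
    rw [uIoc_of_le ht.le] at hx
    rw [Complex.ofReal_mul, Complex.ofReal_cpow hx.1.le, Complex.ofReal_cpow (sub_nonneg.2 hx.2)]
    push_cast
    rfl
  rw [intervalIntegral.integral_ofReal, h1] at h2
  have h3 : ((∫ s in (0 : ℝ)..t, s ^ (a - 1) * (t - s) ^ (b - 1) : ℝ) : ℂ) =
      ((t ^ (a + b - 1) * (Real.Gamma a * Real.Gamma b / Real.Gamma (a + b)) : ℝ) : ℂ) := by
    rw [h2]
    push_cast [Complex.ofReal_cpow ht.le]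
    ring
  have h4 := Complex.ofReal_injective h3
  have hga := (Real.Gamma_pos_of_pos ha).ne'
  have hgb := (Real.Gamma_pos_of_pos hb).ne'
  have h5 : ∀ s, rlKernel b (t - s) * rlKernel a s =
      (Real.Gamma a * Real.Gamma b)⁻¹ * (s ^ (a - 1) * (t - s) ^ (b - 1)) := by
    intro s
    simp only [rlKernel]
    field_simp
  simp only [h5]
  rw [intervalIntegral.integral_const_mul, h4, rlKernel]
  field_simp

/-- A non-integrable function would have integral 0 by convention, whereas the computed value is
positive. -/
theorem intervalIntegrable_rlKernel_sub_mul {a b t : ℝ} (ha : 0 < a) (hb : 0 < b) (ht : 0 < t) :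
    IntervalIntegrable (fun s => rlKernel b (t - s) * rlKernel a s) volume 0 t := by
  by_contra h
  have h1 := integral_rlKernel_sub_mul ha hb ht
  rw [intervalIntegral.integral_undef h] at h1
  exact (rlKernel_pos (add_pos ha hb) ht).ne h1

/-! ### The Mittag-Leffler function -/

/-- The two-parameter Mittag-Leffler function `E_{α,β}(z) = ∑ z^n / Γ(αn+β)`. -/
def mittagLeffler (α β : ℝ) (z : ℂ) : ℂ :=
  ∑' n : ℕ, z ^ n / (Real.Gamma (α * n + β) : ℂ)

/-- Log-convexity of Γ between x + α and x + α + 1, with weights α and 1 - α that average to x + 1.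
The resulting decay x^{-α} of Γ(x)/Γ(x+α) drives the ratio test for the Mittag-Leffler series. -/
theorem Gamma_le_mul_Gamma_add {α x : ℝ} (hα : α ∈ Ioo (0 : ℝ) 1) (hx : 1 ≤ x) :
    Real.Gamma x ≤ 2 * x ^ (-α) * Real.Gamma (x + α) := by
  have hx0 : 0 < x := by linarith
  have h := Real.Gamma_mul_add_mul_le_rpow_Gamma_mul_rpow_Gamma (s := x + α) (t := x + α + 1)
    (a := α) (b := 1 - α) (by linarith [hα.1]) (by linarith [hα.1]) hα.1 (by linarith [hα.2])
    (by ring)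
  rw [show α * (x + α) + (1 - α) * (x + α + 1) = x + 1 by ring, Real.Gamma_add_one hx0.ne',
    Real.Gamma_add_one (by linarith [hα.1] : x + α ≠ 0)] at h
  have hg := Real.Gamma_pos_of_pos (show 0 < x + α by linarith [hα.1])
  rw [Real.mul_rpow (by linarith [hα.1]) hg.le, mul_comm ((x + α) ^ (1 - α)), ← mul_assoc,
    ← Real.rpow_add hg] at h
  rw [show α + (1 - α) = 1 by ring, Real.rpow_one] at h
  have h2 : (x + α) ^ (1 - α) ≤ 2 * x ^ (1 - α) := by
    calc (x + α) ^ (1 - α) ≤ (2 * x) ^ (1 - α) :=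
          Real.rpow_le_rpow (by linarith [hα.1]) (by linarith [hα.2]) (by linarith [hα.2])
      _ = 2 ^ (1 - α) * x ^ (1 - α) := Real.mul_rpow (by norm_num) hx0.le
      _ ≤ 2 ^ (1 : ℝ) * x ^ (1 - α) := by
          gcongr
          · norm_num
          · linarith [hα.1]
      _ = 2 * x ^ (1 - α) := by norm_num
  have h3 : x ^ (1 - α) = x * x ^ (-α) := by
    rw [sub_eq_add_neg, Real.rpow_add hx0, Real.rpow_one]
  have h4 : x * Real.Gamma x ≤ x * (2 * x ^ (-α) * Real.Gamma (x + α)) := by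
    calc x * Real.Gamma x ≤ Real.Gamma (x + α) * (x + α) ^ (1 - α) := h
      _ ≤ Real.Gamma (x + α) * (2 * x ^ (1 - α)) := by gcongr
      _ = _ := by rw [h3]; ring
  exact le_of_mul_le_mul_left h4 hx0

section MittagLeffler

variable {α β : ℝ}

theorem index_pos (hα : α ∈ Ioo (0 : ℝ) 1) (hβ : 0 < β) (n : ℕ) : 0 < α * n + β :=
  add_pos_of_nonneg_of_pos (mul_nonneg hα.1.le n.cast_nonneg) hβ

theorem summable_pow_div_Gamma (hα : α ∈ Ioo (0 : ℝ) 1) (hβ : 0 < β) (R : ℝ) :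
    Summable fun n : ℕ => R ^ n / Real.Gamma (α * n + β) := by
  have hlim : Tendsto (fun n : ℕ => |R| * (2 * (α * n + β) ^ (-α))) atTop (𝓝 (|R| * (2 * 0))) := by
    refine ((tendsto_rpow_neg_atTop hα.1).comp ?_).const_mul 2 |>.const_mul |R|
    exact tendsto_atTop_add_const_right _ _ (tendsto_natCast_atTop_atTop.const_mul_atTop hα.1)
  have hlarge : ∀ᶠ n : ℕ in atTop, 1 ≤ α * n + β :=
    (tendsto_atTop_add_const_right _ β
      (tendsto_natCast_atTop_atTop.const_mul_atTop hα.1)).eventually_ge_atTop 1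
  refine summable_of_ratio_norm_eventually_le (r := 1 / 2) (by norm_num) ?_
  filter_upwards [hlim.eventually_le_const (show |R| * (2 * 0) < 1 / 2 by norm_num), hlarge]
    with n hn hn1
  have h1 := Gamma_le_mul_Gamma_add hα hn1
  have hg := Real.Gamma_pos_of_pos (index_pos hα hβ n)
  have hg' := Real.Gamma_pos_of_pos (index_pos hα hβ (n + 1))
  have he : α * n + β + α = α * ((n + 1 : ℕ) : ℝ) + β := by push_cast; ring
  rw [he] at h1
  rw [norm_div, norm_div, Real.norm_of_nonneg hg.le, Real.norm_of_nonneg hg'.le, norm_pow, norm_pow,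
    Real.norm_eq_abs, pow_succ, ← mul_div_assoc, div_le_div_iff₀ hg' hg]
  calc |R| ^ n * |R| * Real.Gamma (α * n + β)
      ≤ |R| ^ n * |R| * (2 * (α * n + β) ^ (-α) * Real.Gamma (α * ((n + 1 : ℕ) : ℝ) + β)) := by
        gcongr
    _ = (|R| * (2 * (α * n + β) ^ (-α))) *
          (|R| ^ n * Real.Gamma (α * ((n + 1 : ℕ) : ℝ) + β)) := by ring
    _ ≤ 1 / 2 * (|R| ^ n * Real.Gamma (α * ((n + 1 : ℕ) : ℝ) + β)) := by gcongr
    _ = _ := by ring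

theorem norm_mittagLeffler_term (hα : α ∈ Ioo (0 : ℝ) 1) (hβ : 0 < β) (z : ℂ) (n : ℕ) :
    ‖z ^ n / (Real.Gamma (α * n + β) : ℂ)‖ = ‖z‖ ^ n / Real.Gamma (α * n + β) := by
  rw [norm_div, norm_pow, Complex.norm_real,
    Real.norm_of_nonneg (Real.Gamma_pos_of_pos (index_pos hα hβ n)).le]

theorem summable_mittagLeffler (hα : α ∈ Ioo (0 : ℝ) 1) (hβ : 0 < β) (z : ℂ) :
    Summable fun n : ℕ => z ^ n / (Real.Gamma (α * n + β) : ℂ) := by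
  refine Summable.of_norm ?_
  simp only [norm_mittagLeffler_term hα hβ]
  exact summable_pow_div_Gamma hα hβ _

theorem differentiable_mittagLeffler (hα : α ∈ Ioo (0 : ℝ) 1) (hβ : 0 < β) :
    Differentiable ℂ (mittagLeffler α β) := by
  intro z
  have h : DifferentiableOn ℂ (mittagLeffler α β) (Metric.ball 0 (‖z‖ + 1)) := by
    refine Complex.differentiableOn_tsum_of_summable_norm
      (summable_pow_div_Gamma hα hβ (‖z‖ + 1)) (fun n => by fun_prop) Metric.isOpen_ball ?_
    intro n w hw
    rw [norm_mittagLeffler_term hα hβ]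
    have := Real.Gamma_pos_of_pos (index_pos hα hβ n)
    have hw' : ‖w‖ ≤ ‖z‖ + 1 := (mem_ball_zero_iff.1 hw).le
    gcongr
  exact h.differentiableAt (Metric.isOpen_ball.mem_nhds (by simp))

theorem continuous_mittagLeffler (hα : α ∈ Ioo (0 : ℝ) 1) (hβ : 0 < β) :
    Continuous (mittagLeffler α β) :=
  (differentiable_mittagLeffler hα hβ).continuous

theorem mittagLeffler_zero (α β : ℝ) : mittagLeffler α β 0 = ((Real.Gamma β : ℝ) : ℂ)⁻¹ := by
  rw [mittagLeffler, tsum_eq_single 0]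
  · simp
  · intro n hn
    simp [hn]

theorem mittagLeffler_conj (α β : ℝ) (z : ℂ) :
    mittagLeffler α β (conj z) = conj (mittagLeffler α β z) := by
  simp only [mittagLeffler, Complex.conj_tsum, map_div₀, map_pow, Complex.conj_ofReal]

/-- Splitting off the term n = 0. At z = ct^α this is the integrated form of D^α w = cw, and it is
the source of every evolution equation below. -/
theorem mittagLeffler_eq_add (hα : α ∈ Ioo (0 : ℝ) 1) (hβ : 0 < β) (z : ℂ) :
    mittagLeffler α β z = ((Real.Gamma β : ℝ) : ℂ)⁻¹ + z * mittagLeffler α (β + α) z := by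
  rw [mittagLeffler, (summable_mittagLeffler hα hβ z).tsum_eq_zero_add, mittagLeffler,
    ← tsum_mul_left]
  congr 1
  · simp
  · refine tsum_congr fun n => ?_
    rw [show α * ((n + 1 : ℕ) : ℝ) + β = α * n + (β + α) by push_cast; ring]
    ring

/-- Fractional integration of order b raises the second index by b: the n-th term of
s^{β-1}E_{α,β}(cs^α) is a multiple of the kernel of order αn + β, and the semigroup law applies term
by term. -/
theorem integral_rlKernel_mul_mittagLeffler {b : ℝ} (hα : α ∈ Ioo (0 : ℝ) 1) (hβ : 0 < β)
    (hb : 0 < b) (c : ℂ) {t : ℝ} (ht : 0 < t) :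
    ∫ s in (0 : ℝ)..t, ((rlKernel b (t - s) * s ^ (β - 1) : ℝ) : ℂ) *
        mittagLeffler α β (c * ((s ^ α : ℝ) : ℂ)) =
      ((t ^ (β + b - 1) : ℝ) : ℂ) * mittagLeffler α (β + b) (c * ((t ^ α : ℝ) : ℂ)) := by
  set F : ℕ → ℝ → ℂ := fun n s =>
    c ^ n * ((rlKernel b (t - s) * rlKernel (α * n + β) s : ℝ) : ℂ) with hF
  have hpow : ∀ (n : ℕ) (s γ : ℝ), 0 < s →
      s ^ (γ - 1) * (s ^ α) ^ n = s ^ (α * n + γ - 1) := by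
    intro n s γ hs
    rw [← Real.rpow_natCast, ← Real.rpow_mul hs.le, ← Real.rpow_add hs]
    ring_nf
  have hFint : ∀ n, IntervalIntegrable (F n) volume 0 t := fun n =>
    have h := intervalIntegrable_rlKernel_sub_mul (index_pos hα hβ n) hb ht
    IntervalIntegrable.const_mul ⟨h.1.ofReal, h.2.ofReal⟩ _
  have hval : ∀ n, ∫ s in (0 : ℝ)..t, F n s = c ^ n * ((rlKernel (α * n + β + b) t : ℝ) : ℂ) := by
    intro n
    simp only [hF]
    rw [intervalIntegral.integral_const_mul, intervalIntegral.integral_ofReal,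
      integral_rlKernel_sub_mul (index_pos hα hβ n) hb ht]
  have hnorm : ∀ n, ∫ s in Ioc 0 t, ‖F n s‖ = ‖c‖ ^ n * rlKernel (α * n + β + b) t := by
    intro n
    rw [← integral_rlKernel_sub_mul (index_pos hα hβ n) hb ht,
      ← intervalIntegral.integral_const_mul, intervalIntegral.integral_of_le ht.le]
    refine setIntegral_congr_fun measurableSet_Ioc fun s hs => ?_
    simp only [hF]
    rw [norm_mul, norm_pow, Complex.norm_real, Real.norm_of_nonneg]
    exact mul_nonneg (rlKernel_nonneg hb (sub_nonneg.2 hs.2))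
      (rlKernel_nonneg (index_pos hα hβ n) hs.1.le)
  have hker : ∀ n : ℕ, rlKernel (α * n + β + b) t =
      t ^ (β + b - 1) * ((t ^ α) ^ n / Real.Gamma (α * n + (β + b))) := by
    intro n
    rw [rlKernel, ← mul_div_assoc, hpow n t (β + b) ht, add_assoc]
  -- The norms integrate to the same series with ‖c‖ in place of c, which converges; this justifies
  -- exchanging sum and integral.
  have hsum := hasSum_integral_of_summable_integral_norm (μ := volume.restrict (Ioc 0 t)) (F := F)
    (fun n => (intervalIntegrable_iff_integrableOn_Ioc_of_le ht.le).1 (hFint n)) (by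
      simp only [hnorm, hker]
      refine (Summable.mul_left (t ^ (β + b - 1)) (summable_pow_div_Gamma hα (add_pos hβ hb)
        (‖c‖ * t ^ α))).congr fun n => ?_
      rw [mul_pow]
      ring)
  rw [intervalIntegral.integral_of_le ht.le]
  have hl : ∫ s in Ioc 0 t, ∑' n, F n s = ∫ s in Ioc 0 t,
      ((rlKernel b (t - s) * s ^ (β - 1) : ℝ) : ℂ) *
        mittagLeffler α β (c * ((s ^ α : ℝ) : ℂ)) := by
    refine setIntegral_congr_fun measurableSet_Ioc fun s hs => ?_
    simp only [hF]
    rw [mittagLeffler, ← tsum_mul_left]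
    refine tsum_congr fun n => ?_
    rw [rlKernel, rlKernel, ← hpow n s β hs.1]
    push_cast
    ring
  rw [← hl, ← hsum.tsum_eq]
  rw [mittagLeffler, ← tsum_mul_left]
  refine tsum_congr fun n => ?_
  rw [← intervalIntegral.integral_of_le ht.le, hval, hker]
  push_cast
  ring

end MittagLeffler

end FracSchrodinger
end

noncomputable section

namespace FracSchrodinger

/-! ### Bounds for the Mittag-Leffler function on the imaginary axis -/

/-- Mean value inequality: on (0,t] the slope of the kernel is at most its slope at t. This
quantifies how a fractional integral forgets its past. -/
theorem rlKernel_sub_le {α h x t : ℝ} (hα : α ∈ Ioo (0 : ℝ) 1) (hx : 0 < x) (hh : 0 ≤ h)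
    (hxt : x + h ≤ t) :
    rlKernel (1 - α) (x + h) - rlKernel (1 - α) x ≤
      -(α * t ^ (-α - 1) / Real.Gamma (1 - α)) * h := by
  have hg : 0 < Real.Gamma (1 - α) := Real.Gamma_pos_of_pos (by linarith [hα.2])
  have key : (x + h) ^ (-α) - x ^ (-α) ≤ -(α * t ^ (-α - 1)) * (x + h - x) := by
    refine Convex.image_sub_le_mul_sub_of_deriv_le (D := Ioc 0 t) (convex_Ioc 0 t)
      (f := fun y => y ^ (-α)) ?_ ?_ ?_ x ⟨hx, by linarith⟩ (x + h) ⟨by linarith, hxt⟩ (by linarith)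
    · exact fun y hy => (Real.continuousAt_rpow_const _ _ (Or.inl hy.1.ne')).continuousWithinAt
    · rw [interior_Ioc]
      exact fun y hy => (Real.differentiableAt_rpow_const_of_ne _ hy.1.ne').differentiableWithinAt
    · rw [interior_Ioc]
      intro y hy
      rw [(Real.hasDerivAt_rpow_const (Or.inl hy.1.ne')).deriv]
      have : t ^ (-α - 1) ≤ y ^ (-α - 1) :=
        Real.rpow_le_rpow_of_nonpos hy.1 hy.2.le (by linarith [hα.1])
      nlinarith [hα.1]
  have e : (1 - α) - 1 = -α := by ring
  simp only [rlKernel, e]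
  rw [← sub_div, div_le_iff₀ hg]
  calc _ ≤ _ := key
    _ = _ := by field_simp; ring

section

variable {α : ℝ}

/-- The maximum principle for the equation `D^α w = iμ w`. -/
theorem Gamma_mul_norm_mittagLeffler_le_one (hα : α ∈ Ioo (0 : ℝ) 1) (μ : ℝ) :
    Real.Gamma α * ‖mittagLeffler α α (Complex.I * μ)‖ ≤ 1 := by
  set E : ℝ → ℂ := fun s => mittagLeffler α α (Complex.I * μ * ((s ^ α : ℝ) : ℂ)) with hE
  have hα1 : 0 < 1 - α := by linarith [hα.2]
  have hΓ : 0 < Real.Gamma α := Real.Gamma_pos_of_pos hα.1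
  have hEc : Continuous E := (continuous_mittagLeffler hα hα.1).comp (continuous_const.mul
    (Complex.continuous_ofReal.comp (Real.continuous_rpow_const hα.1.le)))
  -- If the bound fails, Γ(α)‖E‖ attains a maximum m > 1 on [0,1]. As it equals 1 at 0, the maximum
  -- point T is positive, and the derivative of a fractional integral is computed there in two
  -- incompatible ways.
  by_contra hcon
  push Not at hcon
  obtain ⟨T, hT, hmax⟩ := isCompact_Icc.exists_isMaxOn (nonempty_Icc.2 (zero_le_one' ℝ))
    (continuous_const.mul hEc.norm : Continuous fun s => Real.Gamma α * ‖E s‖).continuousOn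
  set m := Real.Gamma α * ‖E T‖ with hm
  have hm1 : 1 < m := by
    have h1 : Real.Gamma α * ‖E 1‖ ≤ m := hmax (right_mem_Icc.2 (zero_le_one' ℝ))
    have h2 : E 1 = mittagLeffler α α (Complex.I * μ) := by
      simp only [hE, Real.one_rpow, Complex.ofReal_one, mul_one]
    rw [h2] at h1
    linarith
  have hE0 : E 0 = ((Real.Gamma α : ℝ) : ℂ)⁻¹ := by
    simp only [hE, Real.zero_rpow hα.1.ne', Complex.ofReal_zero, mul_zero, mittagLeffler_zero]
  have hT0 : 0 < T := by
    refine lt_of_le_of_ne hT.1 fun h => ?_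
    rw [hm, ← h, hE0, norm_inv, Complex.norm_real, Real.norm_of_nonneg hΓ.le,
      mul_inv_cancel₀ hΓ.ne'] at hm1
    exact lt_irrefl _ hm1
  -- Rotating the phase makes E(T) real and positive, so that the real function g below is
  -- nonnegative on [0,T], zero at T and positive at 0.
  obtain ⟨u, hu1, hu⟩ : ∃ u : ℂ, ‖u‖ = 1 ∧ u * E T = ‖E T‖ := by
    have hne : E T ≠ 0 := by
      intro h
      rw [hm, h, norm_zero, mul_zero] at hm1
      linarith
    have hne' : (‖E T‖ : ℂ) ≠ 0 := by simpa using hne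
    refine ⟨(‖E T‖ : ℂ) / E T, ?_, div_mul_cancel₀ _ hne⟩
    rw [norm_div, Complex.norm_real, norm_norm, div_self (norm_ne_zero_iff.2 hne)]
  set g : ℝ → ℝ := fun s => m - Real.Gamma α * (u * E s).re with hg
  have hgc : Continuous g :=
    continuous_const.sub (continuous_const.mul (Complex.continuous_re.comp (continuous_const.mul hEc)))
  have hg0 : ∀ s ∈ Icc (0 : ℝ) T, 0 ≤ g s := by
    intro s hs
    have h1 : Real.Gamma α * ‖E s‖ ≤ m := hmax ⟨hs.1, hs.2.trans hT.2⟩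
    have h2 : (u * E s).re ≤ ‖E s‖ := by
      simpa [hu1] using Complex.re_le_norm (u * E s)
    simp only [hg]
    nlinarith
  have hgT : g T = 0 := by
    simp only [hg, hu, Complex.ofReal_re, ← hm, sub_self]
  have hgpos : 0 < g 0 := by
    have h2 : (u * E 0).re ≤ ‖E 0‖ := by
      simpa [hu1] using Complex.re_le_norm (u * E 0)
    rw [hE0, norm_inv, Complex.norm_real, Real.norm_of_nonneg hΓ.le, ← hE0] at h2
    have := mul_le_mul_of_nonneg_left h2 hΓ.le
    rw [mul_inv_cancel₀ hΓ.ne'] at this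
    simp only [hg]
    linarith
  set f : ℝ → ℝ := fun s => rlKernel α s * g s with hf
  have hf0 : ∀ s ∈ Icc (0 : ℝ) T, 0 ≤ f s := fun s hs =>
    mul_nonneg (rlKernel_nonneg hα.1 hs.1) (hg0 s hs)
  have hfint : ∀ a b, IntervalIntegrable f volume a b := fun a b =>
    (intervalIntegrable_rlKernel hα.1 a b).mul_continuousOn hgc.continuousOn
  set J : ℝ → ℝ := fun t => ∫ s in (0 : ℝ)..t, rlKernel (1 - α) (t - s) * f s with hJ
  have hJint : ∀ t, 0 < t → IntervalIntegrable (fun s => rlKernel (1 - α) (t - s) * f s)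
      volume 0 t := by
    intro t ht
    simp only [hf, ← mul_assoc]
    exact (intervalIntegrable_rlKernel_sub_mul hα.1 hα1 ht).mul_continuousOn hgc.continuousOn
  -- the derivative of `J` vanishes at the maximum point
  set w : ℝ → ℂ := fun s => ((s ^ (α - 1) : ℝ) : ℂ) * E s with hw
  have hwint : ∀ a b, IntervalIntegrable w volume a b := by
    intro a b
    have h := intervalIntegral.intervalIntegrable_rpow' (a := a) (b := b)
      (show -1 < α - 1 by linarith [hα.1])
    exact IntervalIntegrable.mul_continuousOn ⟨h.1.ofReal, h.2.ofReal⟩ hEc.continuousOn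
  -- I^{1-α}w = 1 + iμ∫w by raising the index from α to 1 and then splitting off the first term; the
  -- constant m survives because the kernels of orders α and 1 - α convolve to 1.
  have hJeq : ∀ t, 0 < t → J t = m - (u * (1 + Complex.I * μ * ∫ s in (0 : ℝ)..t, w s)).re := by
    intro t ht
    have hA := integral_rlKernel_mul_mittagLeffler hα hα.1 hα1 (Complex.I * μ) ht
    have hB := integral_rlKernel_mul_mittagLeffler hα hα.1 one_pos (Complex.I * μ) ht
    simp only [rlKernel_one, one_mul] at hB
    have hC := mittagLeffler_eq_add hα one_pos (Complex.I * μ * ((t ^ α : ℝ) : ℂ))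
    rw [show α + (1 - α) = 1 by ring, sub_self, Real.rpow_zero, Complex.ofReal_one, one_mul, hC,
      add_comm 1 α] at hA
    rw [show α + 1 - 1 = α by ring] at hB
    have hD : ∫ s in (0 : ℝ)..t, ((rlKernel (1 - α) (t - s) * s ^ (α - 1) : ℝ) : ℂ) * E s =
        1 + Complex.I * μ * ∫ s in (0 : ℝ)..t, w s := by
      rw [hA, hB]
      simp
      ring
    have hint : IntervalIntegrable (fun s => ((rlKernel (1 - α) (t - s) * s ^ (α - 1) : ℝ) : ℂ) *
        E s) volume 0 t := by
      have h := (intervalIntegrable_rlKernel_sub_mul hα.1 hα1 ht).const_mul (Real.Gamma α)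
      have h' : IntervalIntegrable (fun s => ((rlKernel (1 - α) (t - s) * s ^ (α - 1) : ℝ) : ℂ))
          volume 0 t := by
        have e : (fun s => ((rlKernel (1 - α) (t - s) * s ^ (α - 1) : ℝ) : ℂ)) =
            fun s => ((Real.Gamma α * (rlKernel (1 - α) (t - s) * rlKernel α s) : ℝ) : ℂ) := by
          funext s
          congr 1
          simp only [rlKernel]
          field_simp
        rw [e]
        exact ⟨h.1.ofReal, h.2.ofReal⟩
      exact h'.mul_continuousOn hEc.continuousOn
    rw [← hD, ← intervalIntegral.integral_const_mul]
    have hre : (∫ s in (0 : ℝ)..t, u * (((rlKernel (1 - α) (t - s) * s ^ (α - 1) : ℝ) : ℂ) *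
        E s)).re = ∫ s in (0 : ℝ)..t, (u * (((rlKernel (1 - α) (t - s) * s ^ (α - 1) : ℝ) : ℂ) *
        E s)).re := by
      have := Complex.reCLM.intervalIntegral_comp_comm (hint.const_mul u)
      simpa using this.symm
    rw [hre]
    have h1 : m = ∫ s in (0 : ℝ)..t, m * (rlKernel (1 - α) (t - s) * rlKernel α s) := by
      rw [intervalIntegral.integral_const_mul, integral_rlKernel_sub_mul hα.1 hα1 ht,
        show α + (1 - α) = 1 by ring, rlKernel_one, mul_one]
    conv_rhs => rw [h1]
    rw [← intervalIntegral.integral_sub]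
    · refine intervalIntegral.integral_congr fun s _ => ?_
      have e : (u * (((rlKernel (1 - α) (t - s) * s ^ (α - 1) : ℝ) : ℂ) * E s)).re =
          rlKernel (1 - α) (t - s) * s ^ (α - 1) * (u * E s).re := by
        rw [mul_left_comm, Complex.re_ofReal_mul]
      simp only [hf, hg, e]
      simp only [rlKernel]
      field_simp
    · exact (intervalIntegrable_rlKernel_sub_mul hα.1 hα1 ht).const_mul m
    · have := hint.const_mul u
      exact ⟨this.1.re, this.2.re⟩
  have hwcont : ContinuousAt w T := ((Complex.continuous_ofReal.continuousAt).comp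
    (Real.continuousAt_rpow_const _ _ (Or.inl hT0.ne'))).mul hEc.continuousAt
  have hJder : HasDerivAt J 0 T := by
    have h1 : HasDerivAt (fun t => ∫ s in (0 : ℝ)..t, w s) (w T) T :=
      intervalIntegral.integral_hasDerivAt_right (hwint 0 T)
        (((by fun_prop : Measurable fun s : ℝ => ((s ^ (α - 1) : ℝ) : ℂ)).mul
          hEc.measurable).stronglyMeasurable.stronglyMeasurableAtFilter) hwcont
    have h2 : HasDerivAt (fun t => m - (u * (1 + Complex.I * μ * ∫ s in (0 : ℝ)..t, w s)).re)
        (-(u * (Complex.I * μ * w T)).re) T := by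
      have h3 := ((h1.const_mul (Complex.I * μ)).const_add 1).const_mul u
      have h4 := (Complex.reCLM.hasFDerivAt.comp_hasDerivAt T h3).const_sub m
      simpa using h4
    -- After the rotation this number is i times a real number; here it matters that the argument
    -- lies on the imaginary axis.
    have h5 : (u * (Complex.I * μ * w T)).re = 0 := by
      simp only [hw]
      rw [show u * (Complex.I * μ * (((T ^ (α - 1) : ℝ) : ℂ) * E T)) =
        ((μ * T ^ (α - 1) : ℝ) : ℂ) * (Complex.I * (u * E T)) by push_cast; ring, hu,
        Complex.re_ofReal_mul]
      simp
    rw [h5, neg_zero] at h2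
    refine h2.congr_of_eventuallyEq ?_
    filter_upwards [lt_mem_nhds hT0] with t ht using hJeq t ht
  -- `f` vanishes to first order at the maximum point
  have hfdiff : DifferentiableAt ℝ f T := by
    have h1 : DifferentiableAt ℝ (fun s : ℝ => s ^ α) T :=
      Real.differentiableAt_rpow_const_of_ne _ hT0.ne'
    have h2 : DifferentiableAt ℝ E T := by
      have h3 : DifferentiableAt ℝ (mittagLeffler α α)
          (Complex.I * μ * ((T ^ α : ℝ) : ℂ)) :=
        (differentiable_mittagLeffler hα hα.1 _).restrictScalars ℝ
      exact h3.comp T ((Complex.ofRealCLM.differentiableAt.comp T h1).const_mul _)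
    have h4 : DifferentiableAt ℝ g T :=
      ((Complex.reCLM.differentiableAt.comp T (h2.const_mul u)).const_mul _).const_sub _
    exact ((Real.differentiableAt_rpow_const_of_ne _ hT0.ne').div_const _).mul h4
  obtain ⟨C, hC⟩ := hfdiff.isBigO_sub.bound
  have hfT : f T = 0 := by simp only [hf, hgT, mul_zero]
  obtain ⟨η, hη, hηC⟩ := Metric.eventually_nhds_iff.1 hC
  obtain ⟨a, ha0, haT, hga⟩ : ∃ a, 0 < a ∧ a < T ∧ ∀ s ∈ Icc 0 a, 0 < g s := by
    obtain ⟨ε, hε, h⟩ := Metric.eventually_nhds_iff.1 (hgc.continuousAt.eventually (lt_mem_nhds hgpos))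
    refine ⟨min (ε / 2) (T / 2), by positivity, (min_le_right _ _).trans_lt (by linarith),
      fun s hs => h ?_⟩
    rw [dist_zero_right, Real.norm_of_nonneg hs.1]
    exact (hs.2.trans (min_le_left _ _)).trans_lt (by linarith)
  -- The positive mass of f near 0, bounded away from T; the decay rate c of the kernel acts on it
  -- below.
  set δ := ∫ s in (0 : ℝ)..a, f s with hδ
  have hδ0 : 0 < δ := by
    refine intervalIntegral.intervalIntegral_pos_of_pos_on (hfint 0 a) (fun s hs => ?_) ha0
    exact mul_pos (rlKernel_pos hα.1 hs.1) (hga s ⟨hs.1.le, hs.2.le⟩)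
  set c := α * T ^ (-α - 1) / Real.Gamma (1 - α) with hc
  have hc0 : 0 < c := div_pos (mul_pos hα.1 (Real.rpow_pos_of_pos hT0 _))
    (Real.Gamma_pos_of_pos hα1)
  -- Split the integral at T - h. The past loses at least cδh by `rlKernel_sub_le`; the recent part
  -- is at most Ch times the integral of the kernel over (0,h), since f ≤ Ch there. Dividing by h
  -- forces J'(T) ≤ -cδ < 0, against J'(T) = 0.
  have key : ∀ h ∈ Ioo (0 : ℝ) (min η (T - a)),
      J T - J (T - h) ≤ h * (-(c * δ) + C * rlKernel (2 - α) h) := by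
    intro h hh
    have hhη : h < η := hh.2.trans_le (min_le_left _ _)
    have hha : a < T - h := by linarith [hh.2.trans_le (min_le_right η (T - a))]
    have hT1 : 0 < T - h := ha0.trans hha
    have hsub1 : IntervalIntegrable (fun s => rlKernel (1 - α) (T - s) * f s) volume 0 (T - h) :=
      (hJint T hT0).mono_set (by
        rw [uIcc_of_le hT1.le, uIcc_of_le hT0.le]
        exact Icc_subset_Icc_right (by linarith [hh.1]))
    have hsub2 : IntervalIntegrable (fun s => rlKernel (1 - α) (T - s) * f s) volume (T - h) T :=
      (hJint T hT0).mono_set (by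
        rw [uIcc_of_le (by linarith [hh.1]), uIcc_of_le hT0.le]
        exact Icc_subset_Icc_left hT1.le)
    have h1 : J T - J (T - h) =
        (∫ s in (0 : ℝ)..(T - h), (rlKernel (1 - α) (T - s) * f s -
          rlKernel (1 - α) (T - h - s) * f s)) +
          ∫ s in (T - h)..T, rlKernel (1 - α) (T - s) * f s := by
      simp only [hJ]
      rw [← intervalIntegral.integral_add_adjacent_intervals hsub1 hsub2,
        intervalIntegral.integral_sub hsub1 (hJint _ hT1)]
      ring
    have h2 : (∫ s in (0 : ℝ)..(T - h), (rlKernel (1 - α) (T - s) * f s -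
          rlKernel (1 - α) (T - h - s) * f s)) ≤ -(c * h) * δ := by
      calc _ ≤ ∫ s in (0 : ℝ)..(T - h), -(c * h) * f s := by
            refine intervalIntegral.integral_mono_on_of_le_Ioo hT1.le (hsub1.sub (hJint _ hT1))
              ((hfint _ _).const_mul _) fun s hs => ?_
            have := rlKernel_sub_le hα (x := T - h - s) (h := h) (t := T)
              (by linarith [hs.2]) hh.1.le (by linarith [hs.1])
            rw [show T - h - s + h = T - s by ring, ← hc] at this
            have hfs := hf0 s ⟨hs.1.le, by linarith [hs.2, hh.1]⟩
            nlinarith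
        _ = -(c * h) * ∫ s in (0 : ℝ)..(T - h), f s := intervalIntegral.integral_const_mul _ _
        _ ≤ -(c * h) * δ := by
            have : δ ≤ ∫ s in (0 : ℝ)..(T - h), f s := by
              rw [← intervalIntegral.integral_add_adjacent_intervals (hfint 0 a)
                (hfint a (T - h))]
              have := intervalIntegral.integral_nonneg (μ := volume) (f := f) hha.le
                (fun s hs => hf0 s ⟨ha0.le.trans hs.1, by linarith [hs.2, hh.1]⟩)
              linarith
            have hch : 0 < c * h := mul_pos hc0 hh.1
            nlinarith
    have h3 : ∫ s in (T - h)..T, rlKernel (1 - α) (T - s) * f s ≤ C * h * rlKernel (2 - α) h := by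
      calc _ ≤ ∫ s in (T - h)..T, C * h * rlKernel (1 - α) (T - s) := by
            refine intervalIntegral.integral_mono_on_of_le_Ioo (by linarith [hh.1]) hsub2
              ((intervalIntegrable_rlKernel_sub hα1 _ _ _).const_mul _) fun s hs => ?_
            have hd : dist s T < η := by
              rw [Real.dist_eq, abs_sub_comm, abs_of_pos (by linarith [hs.2])]
              linarith [hs.1]
            have hb := hηC hd
            rw [hfT, sub_zero, Real.norm_eq_abs, Real.norm_eq_abs, abs_sub_comm,
              abs_of_pos (show 0 < T - s by linarith [hs.2])] at hb
            have hk := rlKernel_pos hα1 (show 0 < T - s by linarith [hs.2])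
            have hCs : f s ≤ C * h := by
              have h6 := (le_abs_self _).trans hb
              have h7 : 0 ≤ C * (T - s) := (abs_nonneg _).trans hb
              have h8 : 0 ≤ C := nonneg_of_mul_nonneg_left h7 (by linarith [hs.2])
              nlinarith [hs.1]
            nlinarith
        _ = _ := by
            rw [intervalIntegral.integral_const_mul, intervalIntegral.integral_comp_sub_left
              (fun x => rlKernel (1 - α) x), sub_self, sub_sub_cancel, integral_rlKernel hα1]
            ring_nf
    rw [h1]
    linarith
  have hlim1 : Tendsto (fun h : ℝ => h⁻¹ * (J T - J (T - h))) (𝓝[>] 0) (𝓝 0) := by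
    have h1 : HasDerivAt (fun h => J (T - h)) 0 0 := by
      have := HasDerivAt.comp_const_sub (f := J) (f' := 0) T 0 (by simpa using hJder)
      simpa using this
    have h2 := h1.tendsto_slope_zero_right
    simp only [zero_add, sub_zero, smul_eq_mul] at h2
    have h3 := h2.neg
    rw [neg_zero] at h3
    refine h3.congr fun h => by ring
  have hlim2 : Tendsto (fun h : ℝ => -(c * δ) + C * rlKernel (2 - α) h) (𝓝[>] 0)
      (𝓝 (-(c * δ) + C * 0)) := by
    have h1 : Tendsto (rlKernel (2 - α)) (𝓝[>] 0) (𝓝 0) := by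
      have h2 : Continuous (rlKernel (2 - α)) :=
        (Real.continuous_rpow_const (by linarith)).div_const _
      have := h2.tendsto 0
      simp only [rlKernel, Real.zero_rpow (show 2 - α - 1 ≠ 0 by linarith), zero_div] at this
      exact this.mono_left nhdsWithin_le_nhds
    exact (h1.const_mul C).const_add _
  have hle := le_of_tendsto_of_tendsto hlim1 hlim2 (by
    filter_upwards [Ioo_mem_nhdsGT (show (0 : ℝ) < min η (T - a) from lt_min hη (by linarith))]
      with h hh
    have := key h hh
    rw [inv_mul_le_iff₀ hh.1]
    exact this)
  have : 0 < c * δ := mul_pos hc0 hδ0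
  linarith

/-- The case ϱ = α is the maximum principle. For ϱ > α the function is a fractional integral of
order ϱ - α, and its positive kernel carries the bound along with the same computation as for
E_{α,α}(0). -/
theorem norm_mittagLeffler_I_mul_le {ϱ : ℝ} (hα : α ∈ Ioo (0 : ℝ) 1) (hϱ : α ≤ ϱ) (x : ℝ) :
    ‖mittagLeffler α ϱ (Complex.I * x)‖ ≤ (Real.Gamma ϱ)⁻¹ := by
  have hΓ : 0 < Real.Gamma α := Real.Gamma_pos_of_pos hα.1
  have hb : ∀ y : ℝ, ‖mittagLeffler α α (Complex.I * y)‖ ≤ (Real.Gamma α)⁻¹ := fun y => by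
    rw [← one_div, le_div_iff₀ hΓ, mul_comm]
    exact Gamma_mul_norm_mittagLeffler_le_one hα y
  rcases hϱ.eq_or_lt with rfl | hlt
  · exact hb x
  have h := integral_rlKernel_mul_mittagLeffler hα hα.1 (sub_pos.2 hlt) (Complex.I * x) one_pos
  simp only [Real.one_rpow, Complex.ofReal_one, one_mul, mul_one, add_sub_cancel] at h
  rw [← h]
  have hi := integral_rlKernel_sub_mul hα.1 (sub_pos.2 hlt) one_pos
  rw [add_sub_cancel, rlKernel, Real.one_rpow, one_div] at hi
  rw [← hi]
  refine intervalIntegral.norm_integral_le_of_norm_le zero_le_one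
    (Eventually.of_forall fun s hs => ?_)
    (intervalIntegrable_rlKernel_sub_mul hα.1 (sub_pos.2 hlt) one_pos)
  have hk := rlKernel_nonneg (sub_pos.2 hlt) (sub_nonneg.2 hs.2)
  rw [norm_mul, Complex.norm_real, norm_mul, Real.norm_of_nonneg hk,
    Real.norm_of_nonneg (Real.rpow_nonneg hs.1.le _), mul_assoc]
  refine mul_le_mul_of_nonneg_left ?_ hk
  rw [rlKernel, div_eq_mul_inv]
  refine mul_le_mul_of_nonneg_left ?_ (Real.rpow_nonneg hs.1.le _)
  have := hb (x * s ^ α)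
  rwa [Complex.ofReal_mul, ← mul_assoc] at this

end

end FracSchrodinger
end

noncomputable section

namespace FracSchrodinger

/-! ### A functional calculus for the inverse of a positive injective operator -/

section Calculus

open scoped BoundedContinuousFunction

set_option linter.unusedSectionVars false

variable (H : Type*) [NormedAddCommGroup H] [InnerProductSpace ℂ H] [CompleteSpace H]

/-- A positive bounded operator `S` with dense range, thought of as `(1 + A)⁻¹`. -/
structure PositiveResolvent where
  /-- the operator `S = (1 + A)⁻¹` -/
  op : H →L[ℂ] H
  isPositive : op.IsPositive
  denseRange : DenseRange op

variable {H}

namespace PositiveResolvent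

variable (R : PositiveResolvent H) (β γ : ℝ →ᵇ ℂ)

theorem inner_op_left (u v : H) : inner ℂ (R.op u) v = inner ℂ u (R.op v) :=
  R.isPositive.isSymmetric u v

/-- The kernel of a symmetric operator is orthogonal to its range, here dense. -/
theorem op_injective : Function.Injective R.op := by
  rw [injective_iff_map_eq_zero]
  intro v hv
  have h : ∀ u, inner ℂ u v = 0 := fun u => by
    refine R.denseRange.induction_on u ?_ ?_
    · exact isClosed_eq (by fun_prop) continuous_const
    · intro w
      rw [R.inner_op_left, hv, inner_zero_right]
  exact inner_self_eq_zero.1 (h v)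

theorem isStarNormal : IsStarNormal R.op :=
  R.isPositive.isSelfAdjoint.isStarNormal

theorem re_nonneg (z : spectrum ℂ R.op) : 0 ≤ z.1.re := by
  have h1 : z.1 = (z.1.re : ℂ) := R.isPositive.isSelfAdjoint.mem_spectrum_eq_re z.2
  have h2 : z.1.re ∈ spectrum ℝ R.op := by
    rw [← spectrum.algebraMap_mem_iff ℂ]
    rw [Complex.coe_algebraMap, ← h1]
    exact z.2
  exact spectrum_nonneg_of_nonneg ((ContinuousLinearMap.nonneg_iff_isPositive _).2 R.isPositive) h2

theorem coe_re (z : spectrum ℂ R.op) : (z.1.re : ℂ) = z.1 :=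
  (R.isPositive.isSelfAdjoint.mem_spectrum_eq_re z.2).symm

/-- The symbol `z ↦ z β(x (1/z - 1))`, as a continuous function on the spectrum of `S` that depends
continuously on `x`. -/
def symbol : C(ℝ, C(spectrum ℂ R.op, ℂ)) :=
  ContinuousMap.curry ⟨fun p => (p.2.1.re : ℂ) * β (p.1 * (1 / p.2.1.re - 1)), by
    have hre : Continuous fun p : ℝ × spectrum ℂ R.op => p.2.1.re := by fun_prop
    rw [continuous_iff_continuousAt]
    intro p
    -- At z = 0 the argument 1/z - 1 blows up, but β is bounded and the factor z forces the limit 0,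
    -- which is also the value given by the junk convention.
    by_cases hp : p.2.1.re = 0
    · have h0 : Tendsto (fun q : ℝ × spectrum ℂ R.op => |q.2.1.re| * ‖β‖) (𝓝 p) (𝓝 0) := by
        have h1 : Continuous fun q : ℝ × spectrum ℂ R.op => |q.2.1.re| * ‖β‖ :=
          hre.abs.mul continuous_const
        have h2 := h1.tendsto p
        rwa [hp, abs_zero, zero_mul] at h2
      have h1 := squeeze_zero_norm (f := fun q : ℝ × spectrum ℂ R.op =>
        (q.2.1.re : ℂ) * β (q.1 * (1 / q.2.1.re - 1))) (fun q => by
          rw [norm_mul, Complex.norm_real, Real.norm_eq_abs]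
          exact mul_le_mul_of_nonneg_left (β.norm_coe_le_norm _) (abs_nonneg _)) h0
      simpa [ContinuousAt, hp] using h1
    · refine (Complex.continuous_ofReal.comp hre).continuousAt.mul
        (β.continuous.continuousAt.comp ?_)
      exact continuousAt_fst.mul ((continuousAt_const.div hre.continuousAt hp).sub
        continuousAt_const)⟩

theorem symbol_apply (x : ℝ) (z : spectrum ℂ R.op) :
    R.symbol β x z = (z.1.re : ℂ) * β (x * (1 / z.1.re - 1)) := rfl

/-- The continuous functional calculus of `S`. -/
def cfcS : C(spectrum ℂ R.op, ℂ) →⋆ₐ[ℂ] (H →L[ℂ] H) := cfcHom (R := ℂ) R.isStarNormal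

theorem cfcS_id : R.cfcS ((ContinuousMap.id ℂ).restrict (spectrum ℂ R.op)) = R.op :=
  cfcHom_id (R := ℂ) R.isStarNormal

theorem norm_cfcS (h : C(spectrum ℂ R.op, ℂ)) : ‖R.cfcS h‖ = ‖h‖ :=
  norm_cfcHom (𝕜 := ℂ) R.op h R.isStarNormal

theorem cfcS_mul_apply (f g : C(spectrum ℂ R.op, ℂ)) (v : H) :
    R.cfcS (f * g) v = R.cfcS f (R.cfcS g v) := by
  rw [map_mul]
  rfl

theorem op_cfcS (f : C(spectrum ℂ R.op, ℂ)) (v : H) :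
    R.op (R.cfcS f v) = R.cfcS f (R.op v) := by
  have h : ∀ w, R.op w = R.cfcS ((ContinuousMap.id ℂ).restrict (spectrum ℂ R.op)) w := fun w => by
    rw [cfcS_id]
  rw [h, h, ← cfcS_mul_apply, ← cfcS_mul_apply, mul_comm]

/-- Formally β(xA)Sv has norm at most ‖β‖‖Sv‖. Dividing the symbol by z + ε instead of z keeps it
continuous with supremum at most ‖β‖; then ε tends to 0. This estimate allows β(xA) to be extended
from the range of S. -/
theorem norm_cfcS_symbol_le (x : ℝ) (v : H) :
    ‖R.cfcS (R.symbol β x) v‖ ≤ ‖β‖ * ‖R.op v‖ := by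
  have key : ∀ ε : ℝ, 0 < ε → ‖R.cfcS (R.symbol β x) v‖ ≤ ‖β‖ * (‖R.op v‖ + ε * ‖v‖) := by
    intro ε hε
    have hne : ∀ z : spectrum ℂ R.op, (z.1.re : ℂ) + ε ≠ 0 := fun z => by
      have := R.re_nonneg z
      exact_mod_cast (by positivity : z.1.re + ε ≠ 0)
    set q : C(spectrum ℂ R.op, ℂ) := ⟨fun z => R.symbol β x z / ((z.1.re : ℂ) + ε), by
      exact (R.symbol β x).continuous.div (by fun_prop) hne⟩ with hq
    set s : C(spectrum ℂ R.op, ℂ) :=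
      (ContinuousMap.id ℂ).restrict (spectrum ℂ R.op) + algebraMap ℂ _ (ε : ℂ) with hs
    have hmul : R.symbol β x = q * s := by
      ext z
      have hid : s z = (z.1.re : ℂ) + ε := by
        simp [hs, R.coe_re]
      rw [ContinuousMap.mul_apply, hid]
      exact (div_mul_cancel₀ _ (hne z)).symm
    have hsv : R.cfcS s v = R.op v + (ε : ℂ) • v := by
      rw [hs, map_add, R.cfcS_id, AlgHomClass.commutes]
      rfl
    have hqn : ‖q‖ ≤ ‖β‖ := by
      refine (ContinuousMap.norm_le _ (norm_nonneg β)).2 fun z => ?_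
      have h0 := R.re_nonneg z
      change ‖R.symbol β x z / ((z.1.re : ℂ) + ε)‖ ≤ _
      rw [symbol_apply, norm_div, norm_mul, ← Complex.ofReal_add, Complex.norm_real,
        Complex.norm_real, Real.norm_of_nonneg h0, Real.norm_of_nonneg (by positivity),
        div_le_iff₀ (by positivity)]
      have := β.norm_coe_le_norm (x * (1 / z.1.re - 1))
      nlinarith [norm_nonneg β, norm_nonneg (β (x * (1 / z.1.re - 1)))]
    rw [hmul, cfcS_mul_apply, hsv]
    calc _ ≤ ‖R.cfcS q‖ * ‖R.op v + (ε : ℂ) • v‖ := (R.cfcS q).le_opNorm _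
      _ ≤ ‖β‖ * (‖R.op v‖ + ε * ‖v‖) := by
        rw [norm_cfcS]
        gcongr
        refine (norm_add_le _ _).trans_eq ?_
        rw [norm_smul, Complex.norm_real, Real.norm_of_nonneg hε.le]
  have hlim : Tendsto (fun ε : ℝ => ‖β‖ * (‖R.op v‖ + ε * ‖v‖)) (𝓝[>] 0)
      (𝓝 (‖β‖ * (‖R.op v‖ + 0 * ‖v‖))) :=
    ((by fun_prop : Continuous fun ε : ℝ => ‖β‖ * (‖R.op v‖ + ε * ‖v‖)).tendsto 0).mono_left
      nhdsWithin_le_nhds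
  have := ge_of_tendsto hlim (by filter_upwards [self_mem_nhdsWithin] with ε hε using key ε hε)
  simpa using this

/-- The operator `β(x A)`, where `S = (1 + A)⁻¹`. -/
def fnOp (x : ℝ) : H →L[ℂ] H :=
  LinearMap.extendOfNorm (R.cfcS (R.symbol β x) : H →ₗ[ℂ] H) (R.op : H →ₗ[ℂ] H)

theorem fnOp_op (x : ℝ) (v : H) : R.fnOp β x (R.op v) = R.cfcS (R.symbol β x) v :=
  LinearMap.extendOfNorm_eq (f := (R.cfcS (R.symbol β x) : H →ₗ[ℂ] H))
    (e := (R.op : H →ₗ[ℂ] H)) R.denseRange ⟨‖β‖, R.norm_cfcS_symbol_le β x⟩ v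

theorem norm_fnOp_le (x : ℝ) (v : H) : ‖R.fnOp β x v‖ ≤ ‖β‖ * ‖v‖ :=
  LinearMap.norm_extendOfNorm_apply_le (f := (R.cfcS (R.symbol β x) : H →ₗ[ℂ] H))
    (e := (R.op : H →ₗ[ℂ] H)) R.denseRange ‖β‖ (R.norm_cfcS_symbol_le β x) v

/-- Valid for all vectors, not only in the range of S. Together with `op_injective` it reduces
identities between functions of A to identities between symbols. -/
theorem op_fnOp (x : ℝ) (v : H) : R.op (R.fnOp β x v) = R.cfcS (R.symbol β x) v := by
  refine R.denseRange.induction_on v ?_ ?_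
  · exact isClosed_eq (by fun_prop) (by fun_prop)
  · intro w
    rw [fnOp_op, op_cfcS]

theorem fnOp_comm_op (x : ℝ) (v : H) : R.op (R.fnOp β x v) = R.fnOp β x (R.op v) := by
  rw [op_fnOp, fnOp_op]

/-- The functional calculus is a star homomorphism, and conjugating the symbol of β at x yields that
of γ at y; density removes the two factors S. -/
theorem inner_fnOp_left (x y : ℝ) (h : ∀ l, γ (y * l) = conj (β (x * l))) (u v : H) :
    inner ℂ (R.fnOp β x u) v = inner ℂ u (R.fnOp γ y v) := by
  have hstar : star (R.symbol β x) = R.symbol γ y := by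
    ext z
    rw [ContinuousMap.star_apply, symbol_apply, symbol_apply, h]
    simp
  refine R.denseRange.induction_on u ?_ fun a => ?_
  · exact isClosed_eq (by fun_prop) (by fun_prop)
  refine R.denseRange.induction_on v ?_ fun b => ?_
  · exact isClosed_eq (by fun_prop) (by fun_prop)
  rw [fnOp_op, fnOp_op, R.inner_op_left, op_cfcS, ← hstar, map_star,
    ContinuousLinearMap.star_eq_adjoint, ContinuousLinearMap.adjoint_inner_right]

theorem fnOp_zero (v : H) : R.fnOp β 0 v = β 0 • v := by
  apply R.op_injective
  rw [op_fnOp, map_smul]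
  have : R.symbol β 0 = β 0 • (ContinuousMap.id ℂ).restrict (spectrum ℂ R.op) := by
    ext z
    rw [symbol_apply, zero_mul, R.coe_re, mul_comm]
    rfl
  rw [this, map_smul, cfcS_id]
  rfl

/-- Continuity is strong, not in operator norm. On the range of S it follows from continuity of the
symbol in supremum norm; the uniform bound ‖β‖ extends it to the closure. -/
theorem continuous_fnOp (v : H) : Continuous fun x => R.fnOp β x v := by
  refine R.denseRange.induction_on (p := fun v => Continuous fun x => R.fnOp β x v) v ?_ ?_
  · refine isClosed_of_closure_subset fun v hv => ?_
    refine continuous_of_uniform_approx_of_continuous fun u hu => ?_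
    obtain ⟨ε, hε, hεu⟩ := Metric.mem_uniformity_dist.1 hu
    obtain ⟨w, hw, hvw⟩ := Metric.mem_closure_iff.1 hv (ε / (‖β‖ + 1)) (by positivity)
    refine ⟨_, hw, fun x => hεu ?_⟩
    rw [dist_eq_norm, ← map_sub]
    calc _ ≤ ‖β‖ * ‖v - w‖ := R.norm_fnOp_le β x _
      _ ≤ (‖β‖ + 1) * ‖v - w‖ := by gcongr; linarith
      _ < (‖β‖ + 1) * (ε / (‖β‖ + 1)) := by
        rw [← dist_eq_norm]
        gcongr
      _ = ε := by field_simp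
  · intro w
    simp only [fnOp_op]
    have h1 : Continuous fun h => R.cfcS h :=
      cfcHom_continuous (R := ℂ) R.isStarNormal
    exact (h1.comp (R.symbol β).continuous).clm_apply continuous_const

theorem continuous_fnOp_prod : Continuous fun p : ℝ × H => R.fnOp β p.1 p.2 := by
  refine continuous_prod_of_continuous_lipschitzWith' _ ‖β‖₊ (fun x => ?_) fun v => ?_
  · refine LipschitzWith.of_dist_le_mul fun a b => ?_
    rw [dist_eq_norm, dist_eq_norm, ← map_sub]
    exact R.norm_fnOp_le β x _
  · exact R.continuous_fnOp β v

theorem norm_symbol_le (x : ℝ) : ‖R.symbol β x‖ ≤ ‖R.op‖ * ‖β‖ := by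
  refine (ContinuousMap.norm_le _ (by positivity)).2 fun z => ?_
  rw [symbol_apply, norm_mul, R.coe_re]
  have h1 : ‖z.1‖ ≤ ‖R.op‖ := by
    cases subsingleton_or_nontrivial H
    · exact absurd z.2 (by simp)
    · exact spectrum.norm_le_norm_of_mem z.2
  exact mul_le_mul h1 (β.norm_coe_le_norm _) (norm_nonneg _) (norm_nonneg _)

/-- A scalar integral identity, valid for every real l, transfers to operators. After applying S it
is a Bochner integral of symbols in C(spectrum), where it can be checked by evaluating at points. -/
theorem integral_smul_fnOp {X : Type*} [MeasurableSpace X] {P : Measure X} {m : X → ℂ}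
    (hm : Integrable m P) {x : X → ℝ} (hx : AEMeasurable x P) (y : ℝ) (c : ℂ)
    (h : ∀ l, ∫ ω, m ω * β (x ω * l) ∂P = c * γ (y * l)) (v : H) :
    Integrable (fun ω => m ω • R.fnOp β (x ω) v) P ∧
      ∫ ω, m ω • R.fnOp β (x ω) v ∂P = c • R.fnOp γ y v := by
  have hint : Integrable (fun ω => m ω • R.fnOp β (x ω) v) P := by
    refine (hm.norm.mul_const (‖β‖ * ‖v‖)).mono' (hm.1.smul
      ((R.continuous_fnOp β v).comp_aestronglyMeasurable hx.aestronglyMeasurable)) ?_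
    refine Eventually.of_forall fun ω => ?_
    rw [norm_smul]
    gcongr
    exact R.norm_fnOp_le β _ _
  have hsint : Integrable (fun ω => m ω • R.symbol β (x ω)) P := by
    refine (hm.norm.mul_const (‖R.op‖ * ‖β‖)).mono' (hm.1.smul
      ((R.symbol β).continuous.comp_aestronglyMeasurable hx.aestronglyMeasurable)) ?_
    refine Eventually.of_forall fun ω => ?_
    rw [norm_smul]
    gcongr
    exact R.norm_symbol_le β _
  have hsymb : ∫ ω, m ω • R.symbol β (x ω) ∂P = c • R.symbol γ y := by
    ext z
    have h1 := (ContinuousMap.evalCLM ℂ z).integral_comp_comm hsint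
    change ∫ ω, m ω * R.symbol β (x ω) z ∂P = (∫ ω, m ω • R.symbol β (x ω) ∂P) z at h1
    rw [← h1]
    simp only [symbol_apply, ContinuousMap.smul_apply, smul_eq_mul]
    rw [mul_left_comm, ← h, ← integral_const_mul]
    congr 1
    funext ω
    ring
  refine ⟨hint, R.op_injective ?_⟩
  rw [← ContinuousLinearMap.integral_comp_comm R.op hint, map_smul, op_fnOp]
  simp only [map_smul, op_fnOp]
  set L : C(spectrum ℂ R.op, ℂ) →L[ℂ] H :=
    (ContinuousLinearMap.apply ℂ H v).comp
      ⟨(R.cfcS.toAlgHom.toLinearMap), cfcHom_continuous (R := ℂ) R.isStarNormal⟩ with hL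
  have h2 := L.integral_comp_comm hsint
  have h3 : ∀ f, L f = R.cfcS f v := fun f => rfl
  rw [← h3, ← map_smul, ← hsymb, ← h2]
  congr 1
  funext ω
  rw [map_smul, h3]

/-- With s in the role of S, the factor s(1/s - 1) = 1 - s replaces S·A by 1 - S, so a recursion
involving A becomes one between bounded operators. Only s > 0 needs checking, since all symbols
vanish at 0. -/
theorem op_fnOp_eq_of_symbol_eq (x y : ℝ) (a b c : ℂ)
    (h : ∀ s : ℝ, 0 < s → s * (a * β (x * (1 / s - 1))) =
      s * b + c * (s - 1) * γ (y * (1 / s - 1))) (v : H) :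
    a • R.op (R.fnOp β x v) = b • R.op v + c • (R.op (R.fnOp γ y v) - R.fnOp γ y v) := by
  apply R.op_injective
  set i := (ContinuousMap.id ℂ).restrict (spectrum ℂ R.op) with hi
  have hsym : a • (i * R.symbol β x) = b • (i * i) + c • (i * R.symbol γ y - R.symbol γ y) := by
    ext z
    have hz : i z = (z.1.re : ℂ) := (R.coe_re z).symm
    simp only [ContinuousMap.smul_apply, ContinuousMap.add_apply, ContinuousMap.sub_apply,
      ContinuousMap.mul_apply, smul_eq_mul, hz, symbol_apply]
    rcases (R.re_nonneg z).eq_or_lt with h0 | h0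
    · simp [← h0]
    · have := h _ h0
      linear_combination (z.1.re : ℂ) * this
  have h2 := congrArg (fun f => R.cfcS f v) hsym
  simp only [map_smul, map_add, map_sub] at h2
  simp only [map_smul, map_add, map_sub, op_fnOp]
  change a • R.cfcS (i * R.symbol β x) v = b • R.cfcS (i * i) v +
    c • (R.cfcS (i * R.symbol γ y) v - R.cfcS (R.symbol γ y) v) at h2
  simpa only [cfcS_mul_apply, hi, R.cfcS_id] using h2

end PositiveResolvent

end Calculus

end FracSchrodinger
end

noncomputable section

namespace FracSchrodinger

/-! ### Solution operators -/

section SolutionOperators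

open scoped BoundedContinuousFunction

set_option linter.unusedSectionVars false

variable {α ϱ : ℝ}

open Classical in
/-- The bounded continuous function `x ↦ E_{α,ϱ}(ix)`. -/
def mlSymbol (α ϱ : ℝ) : ℝ →ᵇ ℂ :=
  if h : α ∈ Ioo (0 : ℝ) 1 ∧ α ≤ ϱ then
    BoundedContinuousFunction.ofNormedAddCommGroup (fun x : ℝ => mittagLeffler α ϱ (Complex.I * x))
      ((continuous_mittagLeffler h.1 (h.1.1.trans_le h.2)).comp
        (continuous_const.mul Complex.continuous_ofReal)) _
      (norm_mittagLeffler_I_mul_le h.1 h.2)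
  else 0

theorem mlSymbol_apply (hα : α ∈ Ioo (0 : ℝ) 1) (hϱ : α ≤ ϱ) (x : ℝ) :
    mlSymbol α ϱ x = mittagLeffler α ϱ (Complex.I * x) := by
  rw [mlSymbol, dif_pos ⟨hα, hϱ⟩]
  rfl

theorem norm_mlSymbol_le (hα : α ∈ Ioo (0 : ℝ) 1) (hϱ : α ≤ ϱ) :
    ‖mlSymbol α ϱ‖ ≤ (Real.Gamma ϱ)⁻¹ := by
  refine (BoundedContinuousFunction.norm_le
    (inv_nonneg.2 (Real.Gamma_pos_of_pos (hα.1.trans_le hϱ)).le)).2 fun x => ?_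
  rw [mlSymbol_apply hα hϱ]
  exact norm_mittagLeffler_I_mul_le hα hϱ x

variable {H : Type*} [NormedAddCommGroup H] [InnerProductSpace ℂ H] [CompleteSpace H]

namespace PositiveResolvent

variable (R : PositiveResolvent H)

/-- The operator `t^{ϱ-1} E_{α,ϱ}(-i r t^α A)`, where `S = (1 + A)⁻¹`. -/
def solOp (α ϱ r t : ℝ) : H →L[ℂ] H :=
  ((t ^ (ϱ - 1) : ℝ) : ℂ) • R.fnOp (mlSymbol α ϱ) (-(r * t ^ α))

theorem solOp_apply (α ϱ r t : ℝ) (v : H) :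
    R.solOp α ϱ r t v = ((t ^ (ϱ - 1) : ℝ) : ℂ) • R.fnOp (mlSymbol α ϱ) (-(r * t ^ α)) v := rfl

/-- The operators are dominated by the scalar kernel, so every convolution below is controlled as
for the Riemann–Liouville integral. -/
theorem norm_solOp_le (hα : α ∈ Ioo (0 : ℝ) 1) (hϱ : α ≤ ϱ) (r : ℝ) {t : ℝ} (ht : 0 ≤ t) (v : H) :
    ‖R.solOp α ϱ r t v‖ ≤ rlKernel ϱ t * ‖v‖ := by
  rw [solOp_apply, norm_smul, Complex.norm_real, Real.norm_of_nonneg (Real.rpow_nonneg ht _),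
    rlKernel, div_eq_mul_inv, mul_assoc]
  refine mul_le_mul_of_nonneg_left ((R.norm_fnOp_le _ _ v).trans ?_) (Real.rpow_nonneg ht _)
  exact mul_le_mul_of_nonneg_right (norm_mlSymbol_le hα hϱ) (norm_nonneg v)

theorem aestronglyMeasurable_solOp {X : Type*} [MeasurableSpace X] {P : Measure X} {r τ : X → ℝ}
    (hr : AEMeasurable r P) (hτ : AEMeasurable τ P) {f : X → H} (hf : AEStronglyMeasurable f P)
    (α ϱ : ℝ) : AEStronglyMeasurable (fun ω => R.solOp α ϱ (r ω) (τ ω) (f ω)) P := by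
  simp only [solOp_apply]
  refine AEStronglyMeasurable.smul ?_ ?_
  · exact (Complex.measurable_ofReal.comp_aemeasurable (hτ.pow_const _)).aestronglyMeasurable
  · have h1 : AEMeasurable (fun ω => -(r ω * τ ω ^ α)) P := (hr.mul (hτ.pow_const _)).neg
    have h2 : AEStronglyMeasurable (fun ω => (-(r ω * τ ω ^ α), f ω)) P :=
      h1.aestronglyMeasurable.prodMk hf
    have h3 := (R.continuous_fnOp_prod (mlSymbol α ϱ)).comp_aestronglyMeasurable h2
    exact h3

theorem continuousAt_solOp (hα : α ∈ Ioo (0 : ℝ) 1) (ϱ r : ℝ) {t : ℝ} (ht : 0 < t) (v : H) :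
    ContinuousAt (fun t => R.solOp α ϱ r t v) t := by
  simp only [solOp_apply]
  refine ContinuousAt.smul ?_ ?_
  · exact Complex.continuous_ofReal.continuousAt.comp
      (Real.continuousAt_rpow_const _ _ (Or.inl ht.ne'))
  · exact ((R.continuous_fnOp _ v).comp (continuous_const.mul
      (Real.continuous_rpow_const hα.1.le)).neg).continuousAt

theorem continuous_solOp (hα : α ∈ Ioo (0 : ℝ) 1) (hϱ : 1 ≤ ϱ) (r : ℝ) (v : H) :
    Continuous fun t => R.solOp α ϱ r t v := by
  simp only [solOp_apply]
  refine Continuous.smul ?_ ?_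
  · exact Complex.continuous_ofReal.comp (Real.continuous_rpow_const (sub_nonneg.2 hϱ))
  · exact (R.continuous_fnOp _ v).comp (continuous_const.mul
      (Real.continuous_rpow_const hα.1.le)).neg

theorem solOp_one_zero (hα : α ∈ Ioo (0 : ℝ) 1) (r : ℝ) (v : H) : R.solOp α 1 r 0 v = v := by
  rw [solOp_apply, Real.zero_rpow hα.1.ne', mul_zero, neg_zero, fnOp_zero,
    mlSymbol_apply hα hα.2.le]
  simp [mittagLeffler_zero]

/-- E_{α,ϱ} has real coefficients, so conjugation at an imaginary argument flips its sign; hence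
adjoints reverse r. -/
theorem inner_solOp_left (hα : α ∈ Ioo (0 : ℝ) 1) (hϱ : α ≤ ϱ) (r t : ℝ) (u v : H) :
    inner ℂ (R.solOp α ϱ r t u) v = inner ℂ u (R.solOp α ϱ (-r) t v) := by
  rw [solOp_apply, solOp_apply, inner_smul_left, inner_smul_right, Complex.conj_ofReal]
  congr 1
  refine R.inner_fnOp_left _ _ _ _ (fun l => ?_) u v
  rw [mlSymbol_apply hα hϱ, mlSymbol_apply hα hϱ, ← mittagLeffler_conj]
  congr 1
  simp

theorem op_solOp_comm (α ϱ r t : ℝ) (v : H) :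
    R.op (R.solOp α ϱ r t v) = R.solOp α ϱ r t (R.op v) := by
  rw [solOp_apply, solOp_apply, map_smul, fnOp_comm_op]

/-- The recursion of `mittagLeffler_eq_add` at -irt^αA multiplied by S, using SA = 1 - S. It
replaces the differential equation throughout. -/
theorem op_solOp (hα : α ∈ Ioo (0 : ℝ) 1) (hϱ : α ≤ ϱ) (r : ℝ) {t : ℝ} (ht : 0 < t) (v : H) :
    R.op (R.solOp α ϱ r t v) = rlKernel ϱ t • R.op v +
      ((r : ℂ) * Complex.I) •
        (R.op (R.solOp α (ϱ + α) r t v) - R.solOp α (ϱ + α) r t v) := by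
  have hϱ' : α ≤ ϱ + α := by linarith [hα.1]
  have h := R.op_fnOp_eq_of_symbol_eq (mlSymbol α ϱ) (mlSymbol α (ϱ + α)) (-(r * t ^ α))
    (-(r * t ^ α)) ((t ^ (ϱ - 1) : ℝ) : ℂ) ((rlKernel ϱ t : ℝ) : ℂ)
    ((r : ℂ) * Complex.I * ((t ^ (ϱ + α - 1) : ℝ) : ℂ)) (fun s hs => ?_) v
  · rw [solOp_apply, map_smul, h, solOp_apply, map_smul, ← smul_sub, smul_smul]
    rfl
  · rw [mlSymbol_apply hα hϱ, mlSymbol_apply hα hϱ', mittagLeffler_eq_add hα (hα.1.trans_le hϱ)]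
    rw [show ϱ + α - 1 = (ϱ - 1) + α by ring, Real.rpow_add ht, rlKernel]
    have hs' : (s : ℂ) ≠ 0 := by exact_mod_cast hs.ne'
    push_cast
    field_simp
    ring

/-- The index-raising formula for scalars, transferred by `integral_smul_fnOp`. -/
theorem integral_rlKernel_smul_solOp {b : ℝ} (hα : α ∈ Ioo (0 : ℝ) 1) (hϱ : α ≤ ϱ) (hb : 0 < b)
    (r : ℝ) {t : ℝ} (ht : 0 < t) (v : H) :
    IntervalIntegrable (fun s => rlKernel b (t - s) • R.solOp α ϱ r s v) volume 0 t ∧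
      ∫ s in (0 : ℝ)..t, rlKernel b (t - s) • R.solOp α ϱ r s v = R.solOp α (ϱ + b) r t v := by
  have hϱ0 : 0 < ϱ := hα.1.trans_le hϱ
  have hm : Integrable (fun s => ((rlKernel b (t - s) * s ^ (ϱ - 1) : ℝ) : ℂ))
      (volume.restrict (Ioc 0 t)) := by
    have h := ((intervalIntegrable_iff_integrableOn_Ioc_of_le ht.le).1
      (intervalIntegrable_rlKernel_sub_mul hϱ0 hb ht)).const_mul (Real.Gamma ϱ)
    refine (Integrable.ofReal h).congr (Eventually.of_forall fun s => ?_)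
    have := (Real.Gamma_pos_of_pos hϱ0).ne'
    change ((Real.Gamma ϱ * (rlKernel b (t - s) * rlKernel ϱ s) : ℝ) : ℂ) = _
    congr 1
    simp only [rlKernel]
    field_simp
  have h := R.integral_smul_fnOp (mlSymbol α ϱ) (mlSymbol α (ϱ + b)) hm
    (x := fun s => -(r * s ^ α)) (by fun_prop) (-(r * t ^ α)) ((t ^ (ϱ + b - 1) : ℝ) : ℂ)
    (fun l => by
      have h1 := integral_rlKernel_mul_mittagLeffler hα hϱ0 hb (-(Complex.I * r * l)) ht
      rw [intervalIntegral.integral_of_le ht.le] at h1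
      rw [mlSymbol_apply hα (by linarith)]
      have e : ∀ y : ℝ, Complex.I * ((-(r * y) * l : ℝ) : ℂ) = -(Complex.I * r * l) * (y : ℂ) :=
        fun y => by push_cast; ring
      simp only [mlSymbol_apply hα hϱ, e]
      exact h1) v
  have he : ∀ s, ((rlKernel b (t - s) * s ^ (ϱ - 1) : ℝ) : ℂ) •
      R.fnOp (mlSymbol α ϱ) (-(r * s ^ α)) v = rlKernel b (t - s) • R.solOp α ϱ r s v := by
    intro s
    rw [solOp_apply, Complex.ofReal_mul, mul_smul]
    exact Complex.coe_smul _ _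
  simp only [he] at h
  rw [intervalIntegrable_iff_integrableOn_Ioc_of_le ht.le, intervalIntegral.integral_of_le ht.le]
  exact h

end PositiveResolvent

end SolutionOperators

end FracSchrodinger
end

noncomputable section

namespace FracSchrodinger

/-! ### Fubini's theorem on a triangle -/

section Triangle

theorem intervalIntegrable_rlKernel_mul_shift {a b r t : ℝ} (ha : 0 < a) (hb : 0 < b)
    (hrt : r < t) :
    IntervalIntegrable (fun s => rlKernel b (t - s) * rlKernel a (s - r)) volume r t := by
  have h := (intervalIntegrable_rlKernel_sub_mul ha hb (sub_pos.2 hrt)).comp_sub_right r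
  simpa using h

theorem integral_rlKernel_mul_shift {a b r t : ℝ} (ha : 0 < a) (hb : 0 < b) (hrt : r < t) :
    ∫ s in r..t, rlKernel b (t - s) * rlKernel a (s - r) = rlKernel (a + b) (t - r) := by
  have h := intervalIntegral.integral_comp_sub_right (a := r) (b := t)
    (fun s => rlKernel b (t - r - s) * rlKernel a s) r
  simp only [sub_self] at h
  rw [← integral_rlKernel_sub_mul ha hb (sub_pos.2 hrt), ← h]
  refine intervalIntegral.integral_congr fun s _ => ?_
  rw [show t - r - (s - r) = t - s by ring]

theorem rlKernel_mono {β : ℝ} (hβ : 1 ≤ β) {s t : ℝ} (hs : 0 ≤ s) (hst : s ≤ t) :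
    rlKernel β s ≤ rlKernel β t :=
  div_le_div_of_nonneg_right (Real.rpow_le_rpow hs hst (by linarith))
    (Real.Gamma_pos_of_pos (by linarith)).le

theorem rlKernel_anti {β : ℝ} (hβ0 : 0 < β) (hβ : β ≤ 1) {s t : ℝ} (hs : 0 < s) (hst : s ≤ t) :
    rlKernel β t ≤ rlKernel β s :=
  div_le_div_of_nonneg_right (Real.rpow_le_rpow_of_nonpos hs hst (by linarith))
    (Real.Gamma_pos_of_pos hβ0).le

variable {E : Type*} [NormedAddCommGroup E] [NormedSpace ℝ E]

/-- Tonelli for the dominating kernel: integrating in s first leaves the kernel of order a + b at t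
- r times φ(r), and a + b ≥ 1 makes that kernel bounded. -/
theorem integral_triangle_swap {a b t : ℝ} (ha : 0 < a) (hb : 0 < b) (hab : 1 ≤ a + b)
    (ht : 0 < t) {φ : ℝ → ℝ} (hφ : IntegrableOn φ (Ioc 0 t)) (hφ0 : ∀ r, 0 ≤ φ r) {F : ℝ → ℝ → E}
    (hF : AEStronglyMeasurable (Function.uncurry F)
      ((volume.restrict (Ioc 0 t)).prod (volume.restrict (Ioc 0 t))))
    (hbound : ∀ s r, 0 < r → r < s → s ≤ t →
      ‖F s r‖ ≤ rlKernel b (t - s) * rlKernel a (s - r) * φ r) :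
    ∫ s in (0 : ℝ)..t, ∫ r in (0 : ℝ)..s, F s r = ∫ r in (0 : ℝ)..t, ∫ s in r..t, F s r := by
  set μ := (volume : Measure ℝ).restrict (Ioc 0 t) with hμ
  set D : Set (ℝ × ℝ) := {p | p.2 < p.1} with hD
  have hDm : MeasurableSet D := measurableSet_lt measurable_snd measurable_fst
  set Φ : ℝ × ℝ → ℝ := D.indicator fun p =>
    rlKernel b (t - p.1) * rlKernel a (p.1 - p.2) * φ p.2 with hΦ
  have hΦm : AEStronglyMeasurable Φ (μ.prod μ) := by
    refine AEStronglyMeasurable.indicator (AEStronglyMeasurable.mul ?_ ?_) hDm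
    · refine Measurable.aestronglyMeasurable ?_
      exact ((measurable_rlKernel b).comp (measurable_const.sub measurable_fst)).mul
        ((measurable_rlKernel a).comp (measurable_fst.sub measurable_snd))
    · exact hφ.aestronglyMeasurable.comp_snd
  have hsec : ∀ r ∈ Ioc 0 t, (fun s => Φ (s, r)) = (Ioi r).indicator fun s =>
      rlKernel b (t - s) * rlKernel a (s - r) * φ r := by
    intro r _
    funext s
    simp only [hΦ, hD, indicator_apply, mem_Ioi]
    rfl
  have hinter : ∀ r ∈ Ioc 0 t, Ioi r ∩ Ioc 0 t = Ioc r t := by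
    intro r hr
    ext s
    simp only [mem_inter_iff, mem_Ioi, mem_Ioc]
    exact ⟨fun h => ⟨h.1, h.2.2⟩, fun h => ⟨h.1, hr.1.trans h.1, h.2⟩⟩
  have hΦint : Integrable Φ (μ.prod μ) := by
    have hlt : ∀ᵐ r ∂μ, r ∈ Ioo 0 t := by
      rw [hμ, restrict_Ioo_eq_restrict_Ioc.symm]
      exact ae_restrict_mem measurableSet_Ioo
    rw [integrable_prod_iff' hΦm]
    constructor
    · filter_upwards [hlt] with r hr
      rw [hsec r ⟨hr.1, hr.2.le⟩, integrable_indicator_iff measurableSet_Ioi, IntegrableOn, hμ,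
        Measure.restrict_restrict measurableSet_Ioi, hinter r ⟨hr.1, hr.2.le⟩]
      exact ((intervalIntegrable_iff_integrableOn_Ioc_of_le hr.2.le).1
        (intervalIntegrable_rlKernel_mul_shift ha hb hr.2)).mul_const _
    · have hval : ∀ᵐ r ∂μ, ∫ s, ‖Φ (s, r)‖ ∂μ = rlKernel (a + b) (t - r) * φ r := by
        filter_upwards [hlt] with r hr
        have hs := hsec r ⟨hr.1, hr.2.le⟩
        have : (fun s => ‖Φ (s, r)‖) = (Ioi r).indicator fun s =>
            ‖rlKernel b (t - s) * rlKernel a (s - r) * φ r‖ := by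
          funext s
          rw [congrFun hs s, norm_indicator_eq_indicator_norm]
        rw [this, integral_indicator measurableSet_Ioi, hμ,
          Measure.restrict_restrict measurableSet_Ioi, hinter r ⟨hr.1, hr.2.le⟩,
          ← integral_rlKernel_mul_shift ha hb hr.2, intervalIntegral.integral_of_le hr.2.le,
          ← integral_mul_const]
        refine setIntegral_congr_fun measurableSet_Ioc fun s hs => ?_
        exact Real.norm_of_nonneg (mul_nonneg (mul_nonneg (rlKernel_nonneg hb (sub_nonneg.2 hs.2))
          (rlKernel_nonneg ha (sub_nonneg.2 hs.1.le))) (hφ0 r))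
      refine Integrable.congr ?_ (hval.mono fun r hr => hr.symm)
      refine (hφ.const_mul (rlKernel (a + b) t)).mono' (AEStronglyMeasurable.mul
        ((measurable_rlKernel _).comp (measurable_const.sub measurable_id)).aestronglyMeasurable
        hφ.aestronglyMeasurable) ?_
      filter_upwards [hlt] with r hr
      have h0 := rlKernel_nonneg (add_pos ha hb) (sub_nonneg.2 hr.2.le)
      rw [norm_mul, Real.norm_of_nonneg h0, Real.norm_of_nonneg (hφ0 r)]
      exact mul_le_mul_of_nonneg_right (rlKernel_mono hab (sub_nonneg.2 hr.2.le)
        (by linarith [hr.1])) (hφ0 r)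
  have hF' : Integrable (Function.uncurry fun s r => D.indicator (Function.uncurry F) (s, r))
      (μ.prod μ) := by
    refine hΦint.mono' (hF.indicator hDm) ?_
    have hmem : ∀ᵐ p ∂μ.prod μ, p.1 ∈ Ioc 0 t ∧ p.2 ∈ Ioc 0 t := by
      rw [hμ, Measure.prod_restrict]
      exact ae_restrict_mem (measurableSet_Ioc.prod measurableSet_Ioc)
    filter_upwards [hmem] with p hp
    simp only [Function.uncurry, hΦ, Prod.mk.eta]
    by_cases hpD : p ∈ D
    · rw [indicator_of_mem hpD, indicator_of_mem hpD]
      exact hbound p.1 p.2 hp.2.1 hpD hp.1.2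
    · rw [indicator_of_notMem hpD, indicator_of_notMem hpD, norm_zero]
  have hswap := integral_integral_swap hF'
  rw [intervalIntegral.integral_of_le ht.le, intervalIntegral.integral_of_le ht.le]
  have hl : ∫ s in Ioc 0 t, ∫ r in (0 : ℝ)..s, F s r =
      ∫ s, ∫ r, D.indicator (Function.uncurry F) (s, r) ∂μ ∂μ := by
    refine setIntegral_congr_fun measurableSet_Ioc fun s hs => ?_
    have h1 : (fun r => D.indicator (Function.uncurry F) (s, r)) = (Iio s).indicator (F s) := by
      funext r
      simp only [hD, indicator_apply, mem_Iio]
      rfl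
    have h2 : Iio s ∩ Ioc 0 t = Ioo 0 s := by
      ext r
      simp only [mem_inter_iff, mem_Iio, mem_Ioc, mem_Ioo]
      exact ⟨fun h => ⟨h.2.1, h.1⟩, fun h => ⟨h.2, h.1, (h.2.le.trans hs.2)⟩⟩
    rw [h1, integral_indicator measurableSet_Iio, hμ, Measure.restrict_restrict measurableSet_Iio,
      h2, intervalIntegral.integral_of_le hs.1.le, integral_Ioc_eq_integral_Ioo]
  have hr : ∫ r in Ioc 0 t, ∫ s in r..t, F s r =
      ∫ r, ∫ s, D.indicator (Function.uncurry F) (s, r) ∂μ ∂μ := by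
    refine setIntegral_congr_fun measurableSet_Ioc fun r hr => ?_
    have h1 : (fun s => D.indicator (Function.uncurry F) (s, r)) =
        (Ioi r).indicator fun s => F s r := by
      funext s
      simp only [hD, indicator_apply, mem_Ioi]
      rfl
    rw [h1, integral_indicator measurableSet_Ioi, hμ, Measure.restrict_restrict measurableSet_Ioi,
      hinter r hr, intervalIntegral.integral_of_le hr.2]
  rw [hl, hr]
  exact hswap

end Triangle

/-! ### Convolutions with solution operators under fractional integration -/

section Composition

set_option linter.unusedSectionVars false

variable {α ϱ : ℝ} {H : Type*} [NormedAddCommGroup H] [InnerProductSpace ℂ H] [CompleteSpace H]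

namespace PositiveResolvent

variable (R : PositiveResolvent H)

theorem integral_rlKernel_smul_solOp_shift {b : ℝ} (hα : α ∈ Ioo (0 : ℝ) 1) (hϱ : α ≤ ϱ)
    (hb : 0 < b) (q : ℝ) {r t : ℝ} (hrt : r < t) (v : H) :
    ∫ s in r..t, rlKernel b (t - s) • R.solOp α ϱ q (s - r) v = R.solOp α (ϱ + b) q (t - r) v := by
  have h := intervalIntegral.integral_comp_sub_right (a := r) (b := t)
    (fun s => rlKernel b (t - r - s) • R.solOp α ϱ q s v) r
  simp only [sub_self] at h
  rw [← (R.integral_rlKernel_smul_solOp hα hϱ hb q (sub_pos.2 hrt) v).2, ← h]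
  refine intervalIntegral.integral_congr fun s _ => ?_
  rw [show t - r - (s - r) = t - s by ring]

theorem integral_solOp_smul_rlKernel_shift {b : ℝ} (hα : α ∈ Ioo (0 : ℝ) 1) (hϱ : α ≤ ϱ)
    (hb : 0 < b) (q : ℝ) {r t : ℝ} (hrt : r < t) (v : H) :
    ∫ s in r..t, R.solOp α ϱ q (t - s) (rlKernel b (s - r) • v) =
      R.solOp α (ϱ + b) q (t - r) v := by
  rw [← (R.integral_rlKernel_smul_solOp hα hϱ hb q (sub_pos.2 hrt) v).2]
  have h := intervalIntegral.integral_comp_sub_left (a := r) (b := t)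
    (fun s => rlKernel b (t - r - s) • R.solOp α ϱ q s v) t
  simp only [sub_self] at h
  rw [← h]
  refine intervalIntegral.integral_congr fun s _ => ?_
  rw [show t - r - (t - s) = s - r by ring, (R.solOp α ϱ q (t - s)).map_smul_of_tower]

theorem aestronglyMeasurable_solOp_sub (ϱ q : ℝ) {t : ℝ} {v : ℝ → H}
    (hv : IntervalIntegrable v volume 0 t) (ht : 0 < t) :
    AEStronglyMeasurable (fun s => R.solOp α ϱ q (t - s) (v s)) (volume.restrict (Ioc 0 t)) :=
  R.aestronglyMeasurable_solOp aemeasurable_const (by fun_prop)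
    ((intervalIntegrable_iff_integrableOn_Ioc_of_le ht.le).1 hv).aestronglyMeasurable α ϱ

theorem intervalIntegrable_solOp_sub (hα : α ∈ Ioo (0 : ℝ) 1) (hϱ : 1 ≤ ϱ) (q : ℝ) {t : ℝ}
    {v : ℝ → H} (hv : IntervalIntegrable v volume 0 t) (ht : 0 < t) :
    IntervalIntegrable (fun s => R.solOp α ϱ q (t - s) (v s)) volume 0 t := by
  have hv' := (intervalIntegrable_iff_integrableOn_Ioc_of_le ht.le).1 hv
  rw [intervalIntegrable_iff_integrableOn_Ioc_of_le ht.le]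
  refine (hv'.norm.const_mul (rlKernel ϱ t)).mono' (R.aestronglyMeasurable_solOp_sub ϱ q hv ht) ?_
  filter_upwards [ae_restrict_mem measurableSet_Ioc] with s hs
  refine (R.norm_solOp_le hα (hα.2.le.trans hϱ) q (sub_nonneg.2 hs.2) (v s)).trans ?_
  exact mul_le_mul_of_nonneg_right (rlKernel_mono hϱ (sub_nonneg.2 hs.2) (by linarith [hs.1]))
    (norm_nonneg _)

/-- Fractional integration of a convolution with a solution operator. -/
theorem integral_rlKernel_smul_conv {b : ℝ} (hα : α ∈ Ioo (0 : ℝ) 1) (hϱ : α ≤ ϱ) (hb : 0 < b)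
    (hϱb : 1 ≤ ϱ + b) (q : ℝ) {t : ℝ} (ht : 0 < t) {v : ℝ → H}
    (hv : IntervalIntegrable v volume 0 t) :
    ∫ s in (0 : ℝ)..t, rlKernel b (t - s) • ∫ r in (0 : ℝ)..s, R.solOp α ϱ q (s - r) (v r) =
      ∫ r in (0 : ℝ)..t, R.solOp α (ϱ + b) q (t - r) (v r) := by
  have hv' := (intervalIntegrable_iff_integrableOn_Ioc_of_le ht.le).1 hv
  have h := integral_triangle_swap (hα.1.trans_le hϱ) hb hϱb ht hv'.norm (fun r => norm_nonneg _)
    (F := fun s r => rlKernel b (t - s) • R.solOp α ϱ q (s - r) (v r)) ?_ ?_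
  · simp only [intervalIntegral.integral_smul] at h
    rw [h]
    refine intervalIntegral.integral_congr_ae ?_
    have hne : ∀ᵐ r : ℝ, r ≠ t := (countable_singleton t).ae_notMem volume
    filter_upwards [hne] with r hr hr'
    rw [uIoc_of_le ht.le] at hr'
    exact R.integral_rlKernel_smul_solOp_shift hα hϱ hb q (lt_of_le_of_ne hr'.2 hr) (v r)
  · have hk : Measurable fun p : ℝ × ℝ => rlKernel b (t - p.1) :=
      (measurable_rlKernel b).comp (measurable_const.sub measurable_fst)
    refine AEStronglyMeasurable.smul (𝕜 := ℝ) hk.aestronglyMeasurable ?_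
    exact R.aestronglyMeasurable_solOp aemeasurable_const
      (measurable_fst.sub measurable_snd).aemeasurable hv'.aestronglyMeasurable.comp_snd α ϱ
  · intro s r _ hrs hst
    have hk := rlKernel_nonneg hb (sub_nonneg.2 hst)
    rw [norm_smul, Real.norm_of_nonneg hk, mul_assoc]
    exact mul_le_mul_of_nonneg_left (R.norm_solOp_le hα hϱ q (sub_nonneg.2 hrs.le) _) hk

/-- The convolution of a solution operator with a fractional integral. -/
theorem integral_solOp_rlKernel_smul {b : ℝ} (hα : α ∈ Ioo (0 : ℝ) 1) (hϱ : α ≤ ϱ) (hb : 0 < b)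
    (hϱb : 1 ≤ ϱ + b) (q : ℝ) {t : ℝ} (ht : 0 < t) {v : ℝ → H}
    (hv : IntervalIntegrable v volume 0 t)
    (hint : ∀ s ∈ Ioo 0 t, IntervalIntegrable (fun r => rlKernel b (s - r) • v r) volume 0 s) :
    ∫ s in (0 : ℝ)..t, R.solOp α ϱ q (t - s) (∫ r in (0 : ℝ)..s, rlKernel b (s - r) • v r) =
      ∫ r in (0 : ℝ)..t, R.solOp α (ϱ + b) q (t - r) (v r) := by
  have hv' := (intervalIntegrable_iff_integrableOn_Ioc_of_le ht.le).1 hv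
  have hne : ∀ᵐ r : ℝ, r ≠ t := (countable_singleton t).ae_notMem volume
  have h := integral_triangle_swap hb (hα.1.trans_le hϱ) (by linarith) ht hv'.norm
    (fun r => norm_nonneg _)
    (F := fun s r => R.solOp α ϱ q (t - s) (rlKernel b (s - r) • v r)) ?_ ?_
  · have hl : ∫ s in (0 : ℝ)..t, R.solOp α ϱ q (t - s)
        (∫ r in (0 : ℝ)..s, rlKernel b (s - r) • v r) =
        ∫ s in (0 : ℝ)..t, ∫ r in (0 : ℝ)..s,
          R.solOp α ϱ q (t - s) (rlKernel b (s - r) • v r) := by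
      refine intervalIntegral.integral_congr_ae ?_
      filter_upwards [hne] with s hs hs'
      rw [uIoc_of_le ht.le] at hs'
      exact ((R.solOp α ϱ q (t - s)).intervalIntegral_comp_comm
        (hint s ⟨hs'.1, lt_of_le_of_ne hs'.2 hs⟩)).symm
    rw [hl, h]
    refine intervalIntegral.integral_congr_ae ?_
    filter_upwards [hne] with r hr hr'
    rw [uIoc_of_le ht.le] at hr'
    exact R.integral_solOp_smul_rlKernel_shift hα hϱ hb q (lt_of_le_of_ne hr'.2 hr) (v r)
  · refine R.aestronglyMeasurable_solOp aemeasurable_const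
      (measurable_const.sub measurable_fst).aemeasurable ?_ α ϱ
    have hk : Measurable fun p : ℝ × ℝ => rlKernel b (p.1 - p.2) :=
      (measurable_rlKernel b).comp (measurable_fst.sub measurable_snd)
    exact AEStronglyMeasurable.smul (𝕜 := ℝ) hk.aestronglyMeasurable
      hv'.aestronglyMeasurable.comp_snd
  · intro s r _ hrs hst
    have hk := rlKernel_nonneg hb (sub_nonneg.2 hrs.le)
    refine (R.norm_solOp_le hα hϱ q (sub_nonneg.2 hst) _).trans_eq ?_
    rw [norm_smul, Real.norm_of_nonneg hk, mul_assoc]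

end PositiveResolvent

end Composition

end FracSchrodinger
end

noncomputable section

namespace FracSchrodinger

/-! ### Weak solutions in a Hilbert space -/

section WeakSolutions

set_option linter.unusedSectionVars false

theorem leftFracInt_eq {H : Type*} [NormedAddCommGroup H] [NormedSpace ℝ H] (β : ℝ) (g : ℝ → H)
    (t : ℝ) : leftFracInt β g t = ∫ s in (0 : ℝ)..t, rlKernel β (t - s) • g s := rfl

theorem rightFracInt_eq_leftFracInt {H : Type*} [NormedAddCommGroup H] [NormedSpace ℝ H]
    (β T : ℝ) (g : ℝ → H) (t : ℝ) :
    rightFracInt β T g t = leftFracInt β (fun s => g (T - s)) (T - t) := by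
  have h := intervalIntegral.integral_comp_sub_left (a := t) (b := T)
    (fun s => rlKernel β (T - t - s) • g (T - s)) T
  rw [sub_self] at h
  rw [leftFracInt_eq, ← h, rightFracInt]
  refine intervalIntegral.integral_congr fun s _ => ?_
  rw [rlKernel, show T - t - (T - s) = s - t by ring, sub_sub_cancel]

/-- Integrability of `(t-·)^{β-1} v` when `v` is integrable near `0` and continuous near `t`. -/
theorem intervalIntegrable_rlKernel_smul {H : Type*} [NormedAddCommGroup H] [NormedSpace ℝ H]
    {β t : ℝ} (hβ : 0 < β) (ht : 0 < t) {v : ℝ → H} (hv : IntervalIntegrable v volume 0 t)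
    (hc : ContinuousOn v (Ioc 0 t)) :
    IntervalIntegrable (fun s => rlKernel β (t - s) • v s) volume 0 t := by
  have h1 : IntervalIntegrable (fun s => rlKernel β (t - s) • v s) volume 0 (t / 2) := by
    refine IntervalIntegrable.continuousOn_smul (f := fun s => rlKernel β (t - s)) (hv.mono_set ?_) ?_
    · rw [uIcc_of_le (by linarith), uIcc_of_le ht.le]
      exact Icc_subset_Icc_right (by linarith)
    · rw [uIcc_of_le (by linarith)]
      intro s hs
      refine ContinuousAt.continuousWithinAt ?_
      exact (continuousAt_rlKernel β (by linarith [hs.2] : t - s ≠ 0)).comp (by fun_prop)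
  have h2 : IntervalIntegrable (fun s => rlKernel β (t - s) • v s) volume (t / 2) t := by
    refine IntervalIntegrable.smul_continuousOn (intervalIntegrable_rlKernel_sub hβ _ _ _) ?_
    rw [uIcc_of_le (by linarith)]
    exact hc.mono fun s hs => ⟨by linarith [hs.1], hs.2⟩
  exact h1.trans h2

variable {α : ℝ} {H : Type*} [NormedAddCommGroup H] [InnerProductSpace ℂ H] [CompleteSpace H]

namespace PositiveResolvent

variable (R : PositiveResolvent H)

theorem intervalIntegrable_op {t : ℝ} {f : ℝ → H} (h : IntervalIntegrable f volume 0 t) :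
    IntervalIntegrable (fun s => R.op (f s)) volume 0 t :=
  ⟨R.op.integrable_comp h.1, R.op.integrable_comp h.2⟩

/-- `op_solOp` with ϱ = 1 integrated against v; the free kernel is then the constant 1, leaving S∫v.
-/
theorem op_integral_solOp (hα : α ∈ Ioo (0 : ℝ) 1) (q : ℝ) {t : ℝ} (ht : 0 < t) {v : ℝ → H}
    (hv : IntervalIntegrable v volume 0 t) :
    R.op (∫ s in (0 : ℝ)..t, R.solOp α 1 q (t - s) (v s)) =
      R.op (∫ s in (0 : ℝ)..t, v s) + ((q : ℂ) * Complex.I) •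
        (R.op (∫ s in (0 : ℝ)..t, R.solOp α (1 + α) q (t - s) (v s)) -
          ∫ s in (0 : ℝ)..t, R.solOp α (1 + α) q (t - s) (v s)) := by
  have h1 := R.intervalIntegrable_solOp_sub hα le_rfl q hv ht
  have h2 := R.intervalIntegrable_solOp_sub hα (show 1 ≤ 1 + α by linarith [hα.1]) q hv ht
  rw [← R.op.intervalIntegral_comp_comm h1, ← R.op.intervalIntegral_comp_comm h2,
    ← R.op.intervalIntegral_comp_comm hv,
    ← intervalIntegral.integral_sub (R.intervalIntegrable_op h2) h2,
    ← intervalIntegral.integral_smul]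
  have h3 : IntervalIntegrable (fun s => ((q : ℂ) * Complex.I) •
      (R.op (R.solOp α (1 + α) q (t - s) (v s)) - R.solOp α (1 + α) q (t - s) (v s)))
      volume 0 t := ((R.intervalIntegrable_op h2).sub h2).smul _
  rw [← intervalIntegral.integral_add (R.intervalIntegrable_op hv) h3]
  refine intervalIntegral.integral_congr_ae ?_
  filter_upwards [(countable_singleton t).ae_notMem volume] with s hs hs'
  rw [uIoc_of_le ht.le] at hs'
  rw [R.op_solOp hα hα.2.le q (sub_pos.2 (lt_of_le_of_ne hs'.2 hs)), rlKernel_one, one_smul]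

/-- Uniqueness for the equation `D^α v = -i q A v`, in integrated form. -/
theorem eq_zero_of_integrated_equation (hα : α ∈ Ioo (0 : ℝ) 1) (q : ℝ) {T : ℝ} {v : ℝ → H}
    (hv : IntervalIntegrable v volume 0 T) (hc : ContinuousOn v (Ioo 0 T))
    (heq : ∀ t ∈ Ioo 0 T, R.op (leftFracInt (1 - α) v t) =
      ((q : ℂ) * Complex.I) • (R.op (∫ s in (0 : ℝ)..t, v s) - ∫ s in (0 : ℝ)..t, v s)) :
    ∀ t ∈ Ioo 0 T, v t = 0 := by
  have hα1 : 0 < 1 - α := by linarith [hα.2]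
  have hvt : ∀ t ∈ Ioo 0 T, IntervalIntegrable v volume 0 t := fun t ht => hv.mono_set (by
    rw [uIcc_of_le ht.1.le, uIcc_of_le (ht.1.le.trans ht.2.le)]
    exact Icc_subset_Icc_right ht.2.le)
  have hk : ∀ t ∈ Ioo 0 T, IntervalIntegrable (fun s => rlKernel (1 - α) (t - s) • v s) volume 0 t :=
    fun t ht => intervalIntegrable_rlKernel_smul hα1 ht.1 (hvt t ht)
      (hc.mono fun s hs => ⟨hs.1, hs.2.trans_lt ht.2⟩)
  -- Convolve the equation with the solution operator of index α. Raising the index by 1 - α on the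
  -- left and by 1 on the right gives S(P₁*v) = iq(S-1)(P_{1+α}*v), where P_ϱ denotes the solution
  -- operator of index ϱ. `op_integral_solOp` has the extra term S∫v, which therefore vanishes, and
  -- S is injective.
  have hV : ∀ t ∈ Ioo 0 T, ∫ s in (0 : ℝ)..t, v s = 0 := by
    intro t ht
    have hsub : ∀ s ∈ Ioo 0 t, s ∈ Ioo 0 T := fun s hs => ⟨hs.1, hs.2.trans ht.2⟩
    set v1 : ℝ → H := fun s => R.op (v s) with hv1
    set v2 : ℝ → H := fun s => ((q : ℂ) * Complex.I) • (R.op (v s) - v s) with hv2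
    have hv1i : ∀ s ∈ Ioo 0 T, IntervalIntegrable v1 volume 0 s := fun s hs =>
      R.intervalIntegrable_op (hvt s hs)
    have hv2i : ∀ s ∈ Ioo 0 T, IntervalIntegrable v2 volume 0 s := fun s hs =>
      ((hv1i s hs).sub (hvt s hs)).smul _
    have hA := R.integral_solOp_rlKernel_smul hα le_rfl hα1 (by linarith) q ht.1 (hv1i t ht)
      (fun s hs => by
        have := R.intervalIntegrable_op (hk s (hsub s hs))
        simpa only [R.op.map_smul_of_tower] using this)
    have hB := R.integral_solOp_rlKernel_smul hα le_rfl one_pos (by linarith [hα.1]) q ht.1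
      (hv2i t ht) (fun s hs => by simpa only [rlKernel_one, one_smul] using hv2i s (hsub s hs))
    have hAB : ∫ s in (0 : ℝ)..t, R.solOp α α q (t - s)
          (∫ r in (0 : ℝ)..s, rlKernel (1 - α) (s - r) • v1 r) =
        ∫ s in (0 : ℝ)..t, R.solOp α α q (t - s)
          (∫ r in (0 : ℝ)..s, rlKernel 1 (s - r) • v2 r) := by
      refine intervalIntegral.integral_congr_ae ?_
      filter_upwards [(countable_singleton t).ae_notMem volume] with s hs hs'
      rw [uIoc_of_le ht.1.le] at hs'
      have hsT := hsub s ⟨hs'.1, lt_of_le_of_ne hs'.2 hs⟩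
      congr 1
      have e := heq s hsT
      rw [leftFracInt_eq, ← ContinuousLinearMap.intervalIntegral_comp_comm R.op (hk s hsT),
        ← ContinuousLinearMap.intervalIntegral_comp_comm R.op (hvt s hsT),
        ← intervalIntegral.integral_sub (hv1i s hsT) (hvt s hsT),
        ← intervalIntegral.integral_smul] at e
      simp only [rlKernel_one, one_smul]
      rw [← e]
      refine intervalIntegral.integral_congr fun r _ => ?_
      exact (R.op.map_smul_of_tower _ _).symm
    rw [hA, hB, show α + (1 - α) = 1 by ring, add_comm α 1] at hAB
    have h1 := R.intervalIntegrable_solOp_sub hα le_rfl q (hvt t ht) ht.1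
    have h2 := R.intervalIntegrable_solOp_sub hα (show 1 ≤ 1 + α by linarith [hα.1]) q
      (hvt t ht) ht.1
    have hid := R.op_integral_solOp hα q ht.1 (hvt t ht)
    rw [← R.op.intervalIntegral_comp_comm h1, ← R.op.intervalIntegral_comp_comm h2,
      ← intervalIntegral.integral_sub (R.intervalIntegrable_op h2) h2,
      ← intervalIntegral.integral_smul] at hid
    simp only [hv1, hv2, ← op_solOp_comm, map_smul, map_sub] at hAB
    rw [hAB, right_eq_add] at hid
    exact R.op_injective (hid.trans (map_zero _).symm)
  intro t ht
  have h1 : HasDerivAt (fun t => ∫ s in (0 : ℝ)..t, v s) (v t) t := by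
    refine intervalIntegral.integral_hasDerivAt_right (hvt t ht) ?_
      (hc.continuousAt (isOpen_Ioo.mem_nhds ht))
    exact hc.stronglyMeasurableAtFilter isOpen_Ioo t ht
  have h2 : HasDerivAt (fun t => ∫ s in (0 : ℝ)..t, v s) 0 t := by
    refine (hasDerivAt_const t (0 : H)).congr_of_eventuallyEq ?_
    filter_upwards [isOpen_Ioo.mem_nhds ht] with s hs using hV s hs
  exact h1.unique h2

/-! #### The forward equation -/

/-- The mild solution of the forward equation. -/
def forwardSol (α q : ℝ) (y₀ : H) (U : ℝ → H) (t : ℝ) : H :=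
  R.solOp α 1 q t y₀ + ∫ s in (0 : ℝ)..t, R.solOp α α q (t - s) (U s)

variable {T M : ℝ} {U : ℝ → H}

theorem intervalIntegrable_of_bound (hU : AEStronglyMeasurable U (volume.restrict (Ioc 0 T)))
    (hM : ∀ s, ‖U s‖ ≤ M) {t : ℝ} (ht : t ∈ Icc 0 T) : IntervalIntegrable U volume 0 t := by
  rw [intervalIntegrable_iff_integrableOn_Ioc_of_le ht.1]
  exact Integrable.of_bound (hU.mono_measure (Measure.restrict_mono (Ioc_subset_Ioc_right ht.2)
    le_rfl)) M (Eventually.of_forall hM)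

theorem intervalIntegrable_solOp_conv (hα : α ∈ Ioo (0 : ℝ) 1) (q : ℝ)
    (hU : AEStronglyMeasurable U (volume.restrict (Ioc 0 T)))
    (hM : ∀ s, ‖U s‖ ≤ M) {t : ℝ} (ht : t ∈ Icc 0 T) :
    IntervalIntegrable (fun s => R.solOp α α q (t - s) (U s)) volume 0 t := by
  rw [intervalIntegrable_iff_integrableOn_Ioc_of_le ht.1]
  have hk := (intervalIntegrable_iff_integrableOn_Ioc_of_le ht.1).1
    (intervalIntegrable_rlKernel_sub hα.1 t 0 t)
  refine (hk.mul_const M).mono' (R.aestronglyMeasurable_solOp aemeasurable_const (by fun_prop)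
    (hU.mono_measure (Measure.restrict_mono (Ioc_subset_Ioc_right ht.2) le_rfl)) α α) ?_
  filter_upwards [ae_restrict_mem measurableSet_Ioc] with s hs
  have h0 := sub_nonneg.2 hs.2
  exact (R.norm_solOp_le hα le_rfl q h0 _).trans
    (mul_le_mul_of_nonneg_left (hM s) (rlKernel_nonneg hα.1 h0))

theorem continuousOn_solOp_conv (hα : α ∈ Ioo (0 : ℝ) 1) (q : ℝ)
    (hU : AEStronglyMeasurable U (volume.restrict (Ioc 0 T))) (hM : ∀ s, ‖U s‖ ≤ M) :
    ContinuousOn (fun t => ∫ s in (0 : ℝ)..t, R.solOp α α q (t - s) (U s)) (Icc 0 T) := by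
  have hM0 : 0 ≤ M := (norm_nonneg _).trans (hM 0)
  rcases le_or_gt T 0 with hT | hT
  · exact (Set.subsingleton_Icc_of_ge hT).continuousOn _
  -- A cut-off removing the singularity at s = t. The truncated integrand is bounded and lives on
  -- the fixed interval (0,T), so dominated convergence gives continuity in t.
  set c : ℝ → ℝ → ℝ := fun δ τ => max 0 (min 1 (τ / δ - 1)) with hc
  have hcc : ∀ δ, Continuous (c δ) := fun δ => by simp only [hc]; fun_prop
  have hc0 : ∀ δ τ, 0 ≤ c δ τ := fun δ τ => le_max_left _ _
  have hc1 : ∀ δ τ, c δ τ ≤ 1 := fun δ τ => max_le zero_le_one (min_le_left _ _)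
  have hcz : ∀ δ τ, 0 < δ → τ ≤ δ → c δ τ = 0 := fun δ τ hδ hτ => by
    refine max_eq_left ((min_le_right _ _).trans ?_)
    rw [sub_nonpos, div_le_one hδ]
    exact hτ
  have hco : ∀ δ τ, 0 < δ → 2 * δ ≤ τ → c δ τ = 1 := fun δ τ hδ hτ => by
    have : 1 ≤ τ / δ - 1 := by
      rw [le_sub_iff_add_le, le_div_iff₀ hδ]
      linarith
    simp only [hc, min_eq_left this]
    norm_num
  -- truncated convolutions
  set Y : ℝ → ℝ → H := fun δ t => ∫ s in (0 : ℝ)..T,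
    c δ (t - s) • R.solOp α α q (t - s) (U s) with hY
  have hbd : ∀ δ τ v, 0 < δ → ‖c δ τ • R.solOp α α q τ v‖ ≤ rlKernel α δ * ‖v‖ := by
    intro δ τ v hδ
    rcases le_or_gt τ δ with h | h
    · rw [hcz δ τ hδ h, zero_smul, norm_zero]
      exact mul_nonneg (rlKernel_nonneg hα.1 hδ.le) (norm_nonneg _)
    · rw [norm_smul, Real.norm_of_nonneg (hc0 _ _)]
      calc c δ τ * ‖R.solOp α α q τ v‖ ≤ 1 * (rlKernel α τ * ‖v‖) :=
            mul_le_mul (hc1 _ _) (R.norm_solOp_le hα le_rfl q (hδ.trans h).le v) (norm_nonneg _)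
              zero_le_one
        _ ≤ rlKernel α δ * ‖v‖ := by
            rw [one_mul]
            exact mul_le_mul_of_nonneg_right (rlKernel_anti hα.1 hα.2.le hδ h.le) (norm_nonneg _)
  have hYc : ∀ δ, 0 < δ → Continuous (Y δ) := by
    intro δ hδ
    refine intervalIntegral.continuous_of_dominated_interval (bound := fun _ => rlKernel α δ * M)
      (fun t => ?_) (fun t => ?_) intervalIntegrable_const ?_
    · rw [uIoc_of_le hT.le]
      refine AEStronglyMeasurable.smul (𝕜 := ℝ) ?_ ?_
      · exact ((hcc δ).comp (continuous_const.sub continuous_id)).aestronglyMeasurable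
      · exact R.aestronglyMeasurable_solOp aemeasurable_const (by fun_prop) hU α α
    · refine Eventually.of_forall fun s _ => (hbd δ _ _ hδ).trans ?_
      exact mul_le_mul_of_nonneg_left (hM s) (rlKernel_nonneg hα.1 hδ.le)
    · refine Eventually.of_forall fun s _ => ?_
      have h1 : Continuous fun τ => c δ τ • R.solOp α α q τ (U s) := by
        rw [continuous_iff_continuousAt]
        intro τ
        rcases lt_or_ge τ δ with h | h
        · refine (continuousAt_const (y := (0 : H))).congr ?_
          filter_upwards [gt_mem_nhds h] with σ hσ
          rw [hcz δ σ hδ hσ.le, zero_smul]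
        · exact (hcc δ).continuousAt.smul (R.continuousAt_solOp hα α q (hδ.trans_le h) _)
      exact h1.comp (continuous_id.sub continuous_const)
  -- Only s in (t-2δ, t] contributes, at a cost of at most M times the integral of the kernel over
  -- (0,2δ). The bound does not depend on t, so the limit is uniform.
  have hYerr : ∀ δ, 0 < δ → ∀ t ∈ Icc 0 T,
      ‖(∫ s in (0 : ℝ)..t, R.solOp α α q (t - s) (U s)) - Y δ t‖ ≤
        rlKernel (α + 1) (2 * δ) * M := by
    intro δ hδ t ht
    have hi : ∀ a b, IntervalIntegrable (fun s => rlKernel α (t - s)) volume a b :=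
      fun a b => intervalIntegrable_rlKernel_sub hα.1 t a b
    have hYi : IntervalIntegrable (fun s => c δ (t - s) • R.solOp α α q (t - s) (U s))
        volume 0 t :=
      IntervalIntegrable.continuousOn_smul (R.intervalIntegrable_solOp_conv hα q hU hM ht)
        ((hcc δ).comp (continuous_const.sub continuous_id)).continuousOn
    have hzero : ∀ s, t ≤ s → c δ (t - s) • R.solOp α α q (t - s) (U s) = 0 := fun s hs => by
      rw [hcz δ _ hδ (by linarith), zero_smul]
    have hYt : Y δ t = ∫ s in (0 : ℝ)..t, c δ (t - s) • R.solOp α α q (t - s) (U s) := by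
      have h2 : ∫ s in t..T, c δ (t - s) • R.solOp α α q (t - s) (U s) = ∫ s in t..T, (0 : H) := by
        refine intervalIntegral.integral_congr fun s hs => ?_
        rw [uIcc_of_le ht.2] at hs
        exact hzero s hs.1
      have h3 : IntervalIntegrable (fun s => c δ (t - s) • R.solOp α α q (t - s) (U s))
          volume t T := by
        refine (intervalIntegrable_const (c := (0 : H))).congr fun s hs => ?_
        rw [uIoc_of_le ht.2] at hs
        exact (hzero s hs.1.le).symm
      simp only [hY]
      rw [← intervalIntegral.integral_add_adjacent_intervals hYi h3, h2]
      simp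
    rw [hYt, ← intervalIntegral.integral_sub
      (R.intervalIntegrable_solOp_conv hα q hU hM ht) hYi]
    set a := max 0 (t - 2 * δ) with ha
    have ha0 : 0 ≤ a := le_max_left _ _
    have hat : a ≤ t := max_le ht.1 (by linarith)
    have hle : ∀ s ∈ Ioc 0 t, ‖R.solOp α α q (t - s) (U s) -
        c δ (t - s) • R.solOp α α q (t - s) (U s)‖ ≤
        (Ioi a).indicator (fun s => rlKernel α (t - s) * M) s := by
      intro s hs
      have e : R.solOp α α q (t - s) (U s) - c δ (t - s) • R.solOp α α q (t - s) (U s) =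
          (1 - c δ (t - s)) • R.solOp α α q (t - s) (U s) := by rw [sub_smul, one_smul]
      rw [e, norm_smul, Real.norm_of_nonneg (sub_nonneg.2 (hc1 _ _))]
      have h0 := sub_nonneg.2 hs.2
      by_cases hsa : s ∈ Ioi a
      · rw [indicator_of_mem hsa]
        calc _ ≤ 1 * (rlKernel α (t - s) * ‖U s‖) :=
              mul_le_mul (by linarith [hc0 δ (t - s)]) (R.norm_solOp_le hα le_rfl q h0 _)
                (norm_nonneg _) zero_le_one
          _ ≤ _ := by
              rw [one_mul]
              exact mul_le_mul_of_nonneg_left (hM s) (rlKernel_nonneg hα.1 h0)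
      · rw [indicator_of_notMem hsa]
        have hsa' : s ≤ t - 2 * δ := by
          rcases le_max_iff.1 (not_lt.1 (fun h => hsa h) : s ≤ a) with h | h
          · exact absurd hs.1 (not_lt.2 h)
          · exact h
        rw [hco δ _ hδ (by linarith), sub_self, zero_mul]
    have hind : IntegrableOn ((Ioi a).indicator fun s => rlKernel α (t - s) * M) (Ioc 0 t) :=
      ((intervalIntegrable_iff_integrableOn_Ioc_of_le ht.1).1
        ((hi 0 t).mul_const M)).indicator measurableSet_Ioi
    have h4 := intervalIntegral.norm_integral_le_of_norm_le (μ := volume) ht.1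
      (Eventually.of_forall fun s hs => hle s hs)
      ((intervalIntegrable_iff_integrableOn_Ioc_of_le ht.1).2 hind)
    refine h4.trans ?_
    rw [intervalIntegral.integral_of_le ht.1, integral_indicator measurableSet_Ioi,
      Measure.restrict_restrict measurableSet_Ioi]
    have h5 : Ioi a ∩ Ioc 0 t = Ioc a t := by
      ext s
      simp only [mem_inter_iff, mem_Ioi, mem_Ioc]
      exact ⟨fun h => ⟨h.1, h.2.2⟩, fun h => ⟨h.1, ha0.trans_lt h.1, h.2⟩⟩
    rw [h5, ← intervalIntegral.integral_of_le hat, intervalIntegral.integral_mul_const,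
      intervalIntegral.integral_comp_sub_left (fun x => rlKernel α x), sub_self,
      integral_rlKernel hα.1]
    refine mul_le_mul_of_nonneg_right (rlKernel_mono (by linarith [hα.1]) (by linarith) ?_) hM0
    linarith [le_max_right 0 (t - 2 * δ)]
  have hlim : Tendsto (fun δ => rlKernel (α + 1) (2 * δ) * M) (𝓝[>] 0) (𝓝 0) := by
    have h1 : Continuous fun δ : ℝ => rlKernel (α + 1) (2 * δ) * M := by
      simp only [rlKernel, add_sub_cancel_right]
      exact (((Real.continuous_rpow_const hα.1.le).comp (continuous_const.mul
        continuous_id)).div_const _).mul continuous_const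
    have h2 := (h1.tendsto 0).mono_left (nhdsWithin_le_nhds (s := Ioi 0))
    simpa [rlKernel, Real.zero_rpow hα.1.ne'] using h2
  refine continuousOn_of_uniform_approx_of_continuousOn fun u hu => ?_
  obtain ⟨ε, hε, hεu⟩ := Metric.mem_uniformity_dist.1 hu
  obtain ⟨δ, hδε, hδ⟩ := ((hlim.eventually (gt_mem_nhds hε)).and self_mem_nhdsWithin).exists
  refine ⟨Y δ, (hYc δ hδ).continuousOn, fun t ht => hεu ?_⟩
  rw [dist_eq_norm]
  exact (hYerr δ hδ t ht).trans_lt hδε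

theorem continuousOn_forwardSol (hα : α ∈ Ioo (0 : ℝ) 1) (q : ℝ) (y₀ : H)
    (hU : AEStronglyMeasurable U (volume.restrict (Ioc 0 T))) (hM : ∀ s, ‖U s‖ ≤ M) :
    ContinuousOn (R.forwardSol α q y₀ U) (Icc 0 T) :=
  (R.continuous_solOp hα le_rfl q y₀).continuousOn.add (R.continuousOn_solOp_conv hα q hU hM)

theorem forwardSol_zero (hα : α ∈ Ioo (0 : ℝ) 1) (q : ℝ) (y₀ : H) (U : ℝ → H) :
    R.forwardSol α q y₀ U 0 = y₀ := by
  rw [forwardSol, solOp_one_zero _ hα, intervalIntegral.integral_same, add_zero]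

/-- Index bookkeeping: I^{1-α} turns the two terms of the mild solution into solution operators of
indices 2 - α and 1, I¹ into indices 2 and 1 + α. Each pair differs by α, which is what `op_solOp`
relates. -/
theorem op_leftFracInt_forwardSol (hα : α ∈ Ioo (0 : ℝ) 1) (q : ℝ) (y₀ : H)
    (hU : AEStronglyMeasurable U (volume.restrict (Ioc 0 T))) (hM : ∀ s, ‖U s‖ ≤ M) {t : ℝ}
    (ht : t ∈ Ioc 0 T) :
    R.op (leftFracInt (1 - α) (fun s => R.forwardSol α q y₀ U s - y₀) t) =
      ((q : ℂ) * Complex.I) • (R.op (∫ s in (0 : ℝ)..t, R.forwardSol α q y₀ U s) -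
        ∫ s in (0 : ℝ)..t, R.forwardSol α q y₀ U s) + R.op (∫ s in (0 : ℝ)..t, U s) := by
  have hα1 : 0 < 1 - α := by linarith [hα.2]
  have ht' : t ∈ Icc 0 T := ⟨ht.1.le, ht.2⟩
  have hUt := intervalIntegrable_of_bound hU hM ht'
  have hcont : ContinuousOn (fun t => ∫ s in (0 : ℝ)..t, R.solOp α α q (t - s) (U s)) (uIcc 0 t) := by
    rw [uIcc_of_le ht.1.le]
    exact (R.continuousOn_solOp_conv hα q hU hM).mono (Icc_subset_Icc_right ht.2)
  have h1 := R.integral_rlKernel_smul_solOp hα hα.2.le hα1 q ht.1 y₀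
  have h2 := R.integral_rlKernel_smul_solOp hα hα.2.le one_pos q ht.1 y₀
  simp only [rlKernel_one, one_smul] at h2
  have h3 := R.integral_rlKernel_smul_conv hα le_rfl hα1 (by linarith) q ht.1 hUt
  have h4 := R.integral_rlKernel_smul_conv hα le_rfl one_pos (by linarith [hα.1]) q ht.1 hUt
  simp only [rlKernel_one, one_smul] at h4
  have hk : IntervalIntegrable (fun s => rlKernel (1 - α) (t - s) • y₀) volume 0 t :=
    IntervalIntegrable.smul_continuousOn (intervalIntegrable_rlKernel_sub hα1 t 0 t)
      continuousOn_const
  have hkv : ∫ s in (0 : ℝ)..t, rlKernel (1 - α) (t - s) • y₀ = rlKernel (1 + (1 - α)) t • y₀ := by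
    rw [intervalIntegral.integral_smul_const, intervalIntegral.integral_comp_sub_left
      (fun x => rlKernel (1 - α) x), sub_self, sub_zero, integral_rlKernel hα1, add_comm]
  have hL : leftFracInt (1 - α) (fun s => R.forwardSol α q y₀ U s - y₀) t =
      R.solOp α (1 + (1 - α)) q t y₀ - rlKernel (1 + (1 - α)) t • y₀ +
        ∫ s in (0 : ℝ)..t, R.solOp α 1 q (t - s) (U s) := by
    rw [show α + (1 - α) = 1 by ring] at h3
    rw [← h3, ← h1.2, ← hkv,
      ← intervalIntegral.integral_sub h1.1 hk, ← intervalIntegral.integral_add (h1.1.sub hk)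
        (IntervalIntegrable.smul_continuousOn (intervalIntegrable_rlKernel_sub hα1 t 0 t) hcont)]
    refine intervalIntegral.integral_congr fun s _ => ?_
    simp only [forwardSol]
    change rlKernel (1 - α) (t - s) • _ = _
    rw [smul_sub, smul_add]
    abel
  have hI : ∫ s in (0 : ℝ)..t, R.forwardSol α q y₀ U s =
      R.solOp α (1 + 1) q t y₀ + ∫ s in (0 : ℝ)..t, R.solOp α (1 + α) q (t - s) (U s) := by
    rw [add_comm 1 α, ← h4, ← h2.2, ← intervalIntegral.integral_add h2.1 hcont.intervalIntegrable]
    rfl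
  have h5 := R.op_solOp hα (show α ≤ 1 + (1 - α) by linarith [hα.2]) q ht.1 y₀
  rw [show 1 + (1 - α) + α = 1 + 1 by ring] at h5
  rw [hL, hI, map_add, map_sub, h5, R.op_integral_solOp hα q ht.1 hUt, map_add,
    R.op.map_smul_of_tower]
  simp only [smul_add, smul_sub]
  abel

end PositiveResolvent

end WeakSolutions

end FracSchrodinger
end

noncomputable section

namespace FracSchrodinger

/-! ### Well-posedness of the weak forward and adjoint equations -/

section WellPosedness

set_option linter.unusedSectionVars false

variable {α q T M : ℝ} {H : Type*} [NormedAddCommGroup H] [InnerProductSpace ℂ H] [CompleteSpace H]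

theorem leftFracInt_inner {β t : ℝ} (c : H) {g : ℝ → H}
    (h : IntervalIntegrable (fun s => rlKernel β (t - s) • g s) volume 0 t) :
    leftFracInt β (fun s => inner ℂ c (g s)) t = inner ℂ c (leftFracInt β g t) := by
  have h1 := (innerSL ℂ c).intervalIntegral_comp_comm h
  simp only [ContinuousLinearMap.map_smul_of_tower, innerSL_apply_apply] at h1
  exact h1

theorem intervalIntegral_inner {a b : ℝ} (c : H) {g : ℝ → H}
    (h : IntervalIntegrable g volume a b) :
    ∫ s in a..b, inner ℂ c (g s) = inner ℂ c (∫ s in a..b, g s) := by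
  have h1 := (innerSL ℂ c).intervalIntegral_comp_comm h
  simpa only [innerSL_apply_apply] using h1

theorem intervalIntegrable_inner {a b : ℝ} (c : H) {g : ℝ → H}
    (h : IntervalIntegrable g volume a b) :
    IntervalIntegrable (fun s => inner ℂ c (g s)) volume a b :=
  ⟨h.1.const_inner c, h.2.const_inner c⟩

namespace PositiveResolvent

variable (R : PositiveResolvent H)

/-- Weak solutions of `∂^α y = -i q A y + U`, `y(0) = y₀`, tested against the range of `S`. -/
structure IsForward (α T q : ℝ) (y₀ : H) (U y : ℝ → H) : Prop where
  continuousOn : ContinuousOn y (Icc 0 T)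
  initial : y 0 = y₀
  equation : ∀ η, ∀ t ∈ Icc 0 T,
    leftFracInt (1 - α) (fun s => inner ℂ (R.op η) (y s) - inner ℂ (R.op η) (y 0)) t =
      ∫ s in (0 : ℝ)..t, ((q : ℂ) * Complex.I * inner ℂ (R.op η - η) (y s) +
        inner ℂ (R.op η) (U s))

/-- Symmetry of S moves it from the test vector to the solution; since η is arbitrary, the scalar
equations amount to one vector identity, which contains no unbounded operator. -/
theorem forward_equation_iff (hα : α ∈ Ioo (0 : ℝ) 1) {y U : ℝ → H} (hy : ContinuousOn y (Icc 0 T))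
    (hU : AEStronglyMeasurable U (volume.restrict (Ioc 0 T))) (hM : ∀ s, ‖U s‖ ≤ M) {t : ℝ}
    (ht : t ∈ Icc 0 T) :
    (∀ η, leftFracInt (1 - α) (fun s => inner ℂ (R.op η) (y s) - inner ℂ (R.op η) (y 0)) t =
      ∫ s in (0 : ℝ)..t, ((q : ℂ) * Complex.I * inner ℂ (R.op η - η) (y s) +
        inner ℂ (R.op η) (U s))) ↔
    R.op (leftFracInt (1 - α) (fun s => y s - y 0) t) =
      ((q : ℂ) * Complex.I) • (R.op (∫ s in (0 : ℝ)..t, y s) - ∫ s in (0 : ℝ)..t, y s) +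
        R.op (∫ s in (0 : ℝ)..t, U s) := by
  have hα1 : 0 < 1 - α := by linarith [hα.2]
  have hyt : ContinuousOn y (uIcc 0 t) := by
    rw [uIcc_of_le ht.1]
    exact hy.mono (Icc_subset_Icc_right ht.2)
  have hUt := intervalIntegrable_of_bound hU hM ht
  have hk : IntervalIntegrable (fun s => rlKernel (1 - α) (t - s) • (y s - y 0)) volume 0 t :=
    IntervalIntegrable.smul_continuousOn (intervalIntegrable_rlKernel_sub hα1 t 0 t)
      (hyt.sub continuousOn_const)
  have hl : ∀ η, leftFracInt (1 - α)
      (fun s => inner ℂ (R.op η) (y s) - inner ℂ (R.op η) (y 0)) t =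
      inner ℂ η (R.op (leftFracInt (1 - α) (fun s => y s - y 0) t)) := fun η => by
    rw [← R.inner_op_left, ← leftFracInt_inner _ hk]
    simp only [inner_sub_right]
  have hr : ∀ η, ∫ s in (0 : ℝ)..t, ((q : ℂ) * Complex.I * inner ℂ (R.op η - η) (y s) +
        inner ℂ (R.op η) (U s)) =
      inner ℂ η (((q : ℂ) * Complex.I) • (R.op (∫ s in (0 : ℝ)..t, y s) - ∫ s in (0 : ℝ)..t, y s) +
        R.op (∫ s in (0 : ℝ)..t, U s)) := fun η => by
    rw [intervalIntegral.integral_add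
      ((intervalIntegrable_inner _ hyt.intervalIntegrable).const_mul _)
      (intervalIntegrable_inner _ hUt), intervalIntegral.integral_const_mul,
      intervalIntegral_inner _ hyt.intervalIntegrable, intervalIntegral_inner _ hUt,
      inner_add_right, inner_smul_right, inner_sub_right, inner_sub_left, R.inner_op_left,
      R.inner_op_left]
  simp only [hl, hr]
  exact ⟨fun h => ext_inner_left ℂ h, fun h η => by rw [h]⟩

theorem isForward_forwardSol (hα : α ∈ Ioo (0 : ℝ) 1) (q : ℝ) (y₀ : H) {U : ℝ → H}
    (hU : AEStronglyMeasurable U (volume.restrict (Ioc 0 T))) (hM : ∀ s, ‖U s‖ ≤ M) :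
    R.IsForward α T q y₀ U (R.forwardSol α q y₀ U) where
  continuousOn := R.continuousOn_forwardSol hα q y₀ hU hM
  initial := R.forwardSol_zero hα q y₀ U
  equation η t ht := by
    refine (R.forward_equation_iff hα (R.continuousOn_forwardSol hα q y₀ hU hM) hU hM ht).2 ?_ η
    rw [R.forwardSol_zero hα]
    rcases ht.1.eq_or_lt with h | h
    · simp [← h, leftFracInt]
    · exact R.op_leftFracInt_forwardSol hα q y₀ hU hM ⟨h, ht.2⟩

/-- The difference from the mild solution has neither data nor source, so the uniqueness theorem
applies inside (0,T); continuity adds the endpoints. -/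
theorem IsForward.eqOn {R : PositiveResolvent H} (hα : α ∈ Ioo (0 : ℝ) 1) (hT : 0 < T) {y₀ : H}
    {U y : ℝ → H} (hU : AEStronglyMeasurable U (volume.restrict (Ioc 0 T))) (hM : ∀ s, ‖U s‖ ≤ M)
    (h : R.IsForward α T q y₀ U y) : EqOn y (R.forwardSol α q y₀ U) (Icc 0 T) := by
  have hα1 : 0 < 1 - α := by linarith [hα.2]
  have hf := R.isForward_forwardSol hα q y₀ hU hM
  set w := R.forwardSol α q y₀ U with hw
  have hcont : ContinuousOn (fun t => y t - w t) (Icc 0 T) := h.continuousOn.sub hf.continuousOn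
  have hzero : ∀ t ∈ Ioo 0 T, y t - w t = 0 := by
    refine R.eq_zero_of_integrated_equation hα q (v := fun t => y t - w t) ?_
      (hcont.mono Ioo_subset_Icc_self) fun t ht => ?_
    · refine ContinuousOn.intervalIntegrable ?_
      rwa [uIcc_of_le hT.le]
    · have ht' : t ∈ Icc 0 T := ⟨ht.1.le, ht.2.le⟩
      have e1 := (R.forward_equation_iff hα h.continuousOn hU hM ht').1 fun η => h.equation η t ht'
      have e2 := (R.forward_equation_iff hα hf.continuousOn hU hM ht').1
        fun η => hf.equation η t ht'
      rw [h.initial] at e1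
      rw [hf.initial] at e2
      have hc : ∀ {g : ℝ → H}, ContinuousOn g (Icc 0 T) → ContinuousOn g (uIcc 0 t) := fun hg => by
        rw [uIcc_of_le ht.1.le]
        exact hg.mono (Icc_subset_Icc_right ht.2.le)
      have hk : ∀ {g : ℝ → H}, ContinuousOn g (Icc 0 T) →
          IntervalIntegrable (fun s => rlKernel (1 - α) (t - s) • (g s - y₀)) volume 0 t :=
        fun hg => IntervalIntegrable.smul_continuousOn (intervalIntegrable_rlKernel_sub hα1 t 0 t)
          ((hc hg).sub continuousOn_const)
      have e3 : leftFracInt (1 - α) (fun t => y t - w t) t =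
          leftFracInt (1 - α) (fun s => y s - y₀) t -
            leftFracInt (1 - α) (fun s => w s - y₀) t := by
        simp only [leftFracInt_eq]
        rw [← intervalIntegral.integral_sub (hk h.continuousOn) (hk hf.continuousOn)]
        refine intervalIntegral.integral_congr fun s _ => ?_
        simp only [smul_sub]
        abel
      rw [e3, map_sub, e1, e2, intervalIntegral.integral_sub
        (hc h.continuousOn).intervalIntegrable (hc hf.continuousOn).intervalIntegrable, map_sub]
      simp only [smul_sub]
      abel
  refine EqOn.of_subset_closure (s := Ioo 0 T) (fun t ht => sub_eq_zero.1 (hzero t ht))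
    h.continuousOn hf.continuousOn Ioo_subset_Icc_self ?_
  rw [closure_Ioo hT.ne]

/-! #### The adjoint equation -/

/-- Weak solutions of `D^α_{t,T} z = i q A z`, `I^{1-α}_{t,T} z = z_T` at `T`, tested against the
range of `S`. -/
structure IsAdjoint (α T q : ℝ) (zT : H) (z : ℝ → H) : Prop where
  continuousOn : ContinuousOn z (Ico 0 T)
  integrable : IntervalIntegrable z volume 0 T
  terminal : Tendsto (rightFracInt (1 - α) T z) (𝓝[<] T) (𝓝 zT)
  equation : ∀ η, ∀ t ∈ Ioo 0 T,
    HasDerivAt (rightFracInt (1 - α) T fun t => inner ℂ (R.op η) (z t))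
      ((q : ℂ) * Complex.I * inner ℂ (R.op η - η) (z t)) t

/-- The mild solution of the adjoint equation. -/
def adjointSol (α T q : ℝ) (zT : H) (t : ℝ) : H := R.solOp α α (-q) (T - t) zT

/-- Reversing time turns the right integral into a left one, which raises the index from α to 1. -/
theorem rightFracInt_adjointSol (hα : α ∈ Ioo (0 : ℝ) 1) (q : ℝ) (zT : H) {t : ℝ} (ht : t < T) :
    rightFracInt (1 - α) T (R.adjointSol α T q zT) t = R.solOp α 1 (-q) (T - t) zT := by
  have h := (R.integral_rlKernel_smul_solOp hα le_rfl (show 0 < 1 - α by linarith [hα.2]) (-q)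
    (sub_pos.2 ht) zT).2
  rw [show α + (1 - α) = 1 by ring] at h
  rw [rightFracInt_eq_leftFracInt, leftFracInt_eq, ← h]
  refine intervalIntegral.integral_congr fun s _ => ?_
  rw [adjointSol, sub_sub_cancel]

/-- Fractional integration of order 1 is ordinary integration, so the operator of index 1 + α is a
primitive of the one of index α. -/
theorem hasDerivAt_solOp (hα : α ∈ Ioo (0 : ℝ) 1) (q : ℝ) (v : H) {t : ℝ} (ht : 0 < t) :
    HasDerivAt (fun t => R.solOp α (1 + α) q t v) (R.solOp α α q t v) t := by
  have h : ∀ t, 0 < t → IntervalIntegrable (fun s => R.solOp α α q s v) volume 0 t ∧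
      ∫ s in (0 : ℝ)..t, R.solOp α α q s v = R.solOp α (1 + α) q t v := fun t ht => by
    have := R.integral_rlKernel_smul_solOp hα le_rfl one_pos q ht v
    simpa only [rlKernel_one, one_smul, add_comm α 1] using this
  have h1 : HasDerivAt (fun t => ∫ s in (0 : ℝ)..t, R.solOp α α q s v) (R.solOp α α q t v) t := by
    refine intervalIntegral.integral_hasDerivAt_right (h t ht).1 ?_
      (R.continuousAt_solOp hα α q ht v)
    exact ContinuousOn.stronglyMeasurableAtFilter (s := Ioi 0) isOpen_Ioi
      (fun s hs => (R.continuousAt_solOp hα α q hs v).continuousWithinAt) t ht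
  refine h1.congr_of_eventuallyEq ?_
  filter_upwards [lt_mem_nhds ht] with s hs using (h s hs).2.symm

theorem intervalIntegrable_reflect {z : ℝ → H} (hz : IntervalIntegrable z volume 0 T) {τ : ℝ}
    (hτ : τ ∈ Ioo 0 T) : IntervalIntegrable (fun s => z (T - s)) volume 0 τ := by
  have h := (hz.comp_sub_left T).symm
  simp only [sub_zero, sub_self] at h
  refine h.mono_set ?_
  rw [uIcc_of_le hτ.1.le, uIcc_of_le (hτ.1.le.trans hτ.2.le)]
  exact Icc_subset_Icc_right hτ.2.le

theorem continuousOn_reflect {z : ℝ → H} (hz : ContinuousOn z (Ico 0 T)) :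
    ContinuousOn (fun s => z (T - s)) (Ioo 0 T) :=
  hz.comp (by fun_prop) fun s hs => ⟨by linarith [hs.2], by linarith [hs.1]⟩

theorem intervalIntegrable_rlKernel_smul_reflect (hα : α ∈ Ioo (0 : ℝ) 1) {z : ℝ → H}
    (hz : IntervalIntegrable z volume 0 T) (hc : ContinuousOn z (Ico 0 T)) {τ : ℝ}
    (hτ : τ ∈ Ioo 0 T) :
    IntervalIntegrable (fun s => rlKernel (1 - α) (τ - s) • z (T - s)) volume 0 τ :=
  intervalIntegrable_rlKernel_smul (by linarith [hα.2]) hτ.1 (intervalIntegrable_reflect hz hτ)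
    ((continuousOn_reflect hc).mono fun s hs => ⟨hs.1, hs.2.trans_lt hτ.2⟩)

theorem rightFracInt_inner (hα : α ∈ Ioo (0 : ℝ) 1) {z : ℝ → H}
    (hz : IntervalIntegrable z volume 0 T) (hc : ContinuousOn z (Ico 0 T)) (c : H) {t : ℝ}
    (ht : t ∈ Ioo 0 T) :
    rightFracInt (1 - α) T (fun s => inner ℂ c (z s)) t =
      inner ℂ c (rightFracInt (1 - α) T z t) := by
  rw [rightFracInt_eq_leftFracInt, rightFracInt_eq_leftFracInt]
  exact leftFracInt_inner c (intervalIntegrable_rlKernel_smul_reflect hα hz hc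
    ⟨by linarith [ht.2], by linarith [ht.1]⟩)

theorem continuousOn_adjointSol (hα : α ∈ Ioo (0 : ℝ) 1) (q : ℝ) (zT : H) :
    ContinuousOn (R.adjointSol α T q zT) (Iio T) := fun t ht => by
  have h1 := R.continuousAt_solOp hα α (-q) (sub_pos.2 ht) zT
  exact ContinuousAt.continuousWithinAt
    (ContinuousAt.comp (f := fun t => T - t) h1 (by fun_prop))

theorem intervalIntegrable_adjointSol (hα : α ∈ Ioo (0 : ℝ) 1) (hT : 0 < T) (q : ℝ) (zT : H) :
    IntervalIntegrable (R.adjointSol α T q zT) volume 0 T := by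
  have h := (R.integral_rlKernel_smul_solOp hα le_rfl one_pos (-q) hT zT).1
  simp only [rlKernel_one, one_smul] at h
  have h1 := (h.comp_sub_left T).symm
  rw [sub_zero, sub_self] at h1
  exact h1

theorem isAdjoint_adjointSol (hα : α ∈ Ioo (0 : ℝ) 1) (hT : 0 < T) (q : ℝ) (zT : H) :
    R.IsAdjoint α T q zT (R.adjointSol α T q zT) where
  continuousOn := (R.continuousOn_adjointSol hα q zT).mono fun t ht => ht.2
  integrable := R.intervalIntegrable_adjointSol hα hT q zT
  terminal := by
    have h1 : Tendsto (fun t => R.solOp α 1 (-q) (T - t) zT) (𝓝[<] T) (𝓝 zT) := by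
      have h3 : Continuous fun t => R.solOp α 1 (-q) (T - t) zT :=
        (R.continuous_solOp hα le_rfl (-q) zT).comp (by fun_prop : Continuous fun t : ℝ => T - t)
      have h2 := h3.tendsto T
      rw [sub_self, R.solOp_one_zero hα] at h2
      exact h2.mono_left nhdsWithin_le_nhds
    refine h1.congr' ?_
    filter_upwards [self_mem_nhdsWithin] with t ht
    exact (R.rightFracInt_adjointSol hα q zT ht).symm
  equation η t ht := by
    have hτ : 0 < T - t := sub_pos.2 ht.2
    have h1 := (R.hasDerivAt_solOp hα (-q) zT hτ).comp_const_sub T t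
    -- By `op_solOp` at ϱ = 1, the tested fractional integral is a constant plus a multiple of the
    -- operator of index 1 + α, whose derivative is known.
    have h2 : HasDerivAt (fun t => inner ℂ (R.op η) zT + ((((-q : ℝ) : ℂ) * Complex.I) *
        inner ℂ (R.op η - η) (R.solOp α (1 + α) (-q) (T - t) zT)))
        ((q : ℂ) * Complex.I * inner ℂ (R.op η - η) (R.adjointSol α T q zT t)) t := by
      have h3 := (((innerSL ℂ (R.op η - η)).restrictScalars ℝ).hasFDerivAt.comp_hasDerivAt t
        h1).const_mul (((-q : ℝ) : ℂ) * Complex.I) |>.const_add (inner ℂ (R.op η) zT)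
      refine h3.congr_deriv ?_
      simp only [ContinuousLinearMap.coe_restrictScalars', innerSL_apply_apply, inner_neg_right,
        adjointSol]
      push_cast
      ring
    refine h2.congr_of_eventuallyEq ?_
    filter_upwards [isOpen_Ioo.mem_nhds ht] with s hs
    have hs' : 0 < T - s := sub_pos.2 hs.2
    rw [rightFracInt_inner hα (R.intervalIntegrable_adjointSol hα hT q zT)
      ((R.continuousOn_adjointSol hα q zT).mono fun t ht => ht.2) _ hs,
      R.rightFracInt_adjointSol hα q zT hs.2, R.inner_op_left,
      R.op_solOp hα hα.2.le (-q) hs', rlKernel_one, one_smul, inner_add_right, inner_smul_right,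
      inner_sub_right, inner_sub_left, R.inner_op_left, R.inner_op_left]

/-- Reverse time and apply the fundamental theorem of calculus to the tested equation; the terminal
condition supplies the one-sided limit at the reversed time 0. -/
theorem IsAdjoint.integrated {R : PositiveResolvent H} (hα : α ∈ Ioo (0 : ℝ) 1) {zT : H}
    {z : ℝ → H} (h : R.IsAdjoint α T q zT z) {τ : ℝ} (hτ : τ ∈ Ioo 0 T) :
    R.op (leftFracInt (1 - α) (fun s => z (T - s)) τ) = R.op zT + (((-q : ℝ) : ℂ) * Complex.I) •
      (R.op (∫ s in (0 : ℝ)..τ, z (T - s)) - ∫ s in (0 : ℝ)..τ, z (T - s)) := by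
  have hz := intervalIntegrable_reflect h.integrable hτ
  refine ext_inner_left ℂ fun η => ?_
  set j : ℝ → ℂ := fun τ => rightFracInt (1 - α) T (fun s => inner ℂ (R.op η) (z s)) (T - τ) with hj
  have hjeq : ∀ σ ∈ Ioo 0 T, j σ = inner ℂ (R.op η) (rightFracInt (1 - α) T z (T - σ)) :=
    fun σ hσ => rightFracInt_inner hα h.integrable h.continuousOn _
      ⟨by linarith [hσ.2], by linarith [hσ.1]⟩
  have hder : ∀ σ ∈ Ioo 0 T, HasDerivAt j
      (-((q : ℂ) * Complex.I * inner ℂ (R.op η - η) (z (T - σ)))) σ := fun σ hσ =>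
    (h.equation η (T - σ) ⟨by linarith [hσ.2], by linarith [hσ.1]⟩).comp_const_sub T σ
  have hlim0 : Tendsto j (𝓝[>] 0) (𝓝 (inner ℂ (R.op η) zT)) := by
    have h1 : Tendsto (fun σ : ℝ => T - σ) (𝓝[>] 0) (𝓝[<] T) := by
      refine tendsto_nhdsWithin_iff.2 ⟨?_, ?_⟩
      · have : Tendsto (fun σ : ℝ => T - σ) (𝓝 0) (𝓝 (T - 0)) :=
          (continuous_const.sub continuous_id).tendsto 0
        rw [sub_zero] at this
        exact this.mono_left nhdsWithin_le_nhds
      · filter_upwards [self_mem_nhdsWithin] with σ hσ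
        exact sub_lt_self T hσ
    have h2 : Tendsto (fun σ => inner ℂ (R.op η) (rightFracInt (1 - α) T z (T - σ))) (𝓝[>] 0)
        (𝓝 (inner ℂ (R.op η) zT)) :=
      ((innerSL ℂ (R.op η)).continuous.tendsto zT).comp (h.terminal.comp h1)
    refine h2.congr' ?_
    filter_upwards [Ioo_mem_nhdsGT (hτ.1.trans hτ.2)] with σ hσ using (hjeq σ hσ).symm
  have hftc := intervalIntegral.integral_eq_sub_of_hasDerivAt_of_tendsto hτ.1
    (fun σ hσ => hder σ ⟨hσ.1, hσ.2.trans hτ.2⟩)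
    (((intervalIntegrable_inner _ hz).const_mul _).neg) hlim0
    ((hder τ hτ).continuousAt.tendsto.mono_left nhdsWithin_le_nhds)
  rw [intervalIntegral.integral_neg, intervalIntegral.integral_const_mul,
    intervalIntegral_inner _ hz, hjeq τ hτ, rightFracInt_eq_leftFracInt, sub_sub_cancel] at hftc
  rw [← R.inner_op_left, inner_add_right, inner_smul_right, inner_sub_right, ← R.inner_op_left,
    ← R.inner_op_left, ← inner_sub_left]
  push_cast
  linear_combination -hftc

/-- In reversed time the terms with z_T cancel in the difference of two solutions, leaving the
homogeneous integrated equation with parameter -q. -/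
theorem IsAdjoint.eqOn {R : PositiveResolvent H} (hα : α ∈ Ioo (0 : ℝ) 1) (hT : 0 < T) {zT : H}
    {z : ℝ → H} (h : R.IsAdjoint α T q zT z) : EqOn z (R.adjointSol α T q zT) (Ico 0 T) := by
  have hf := R.isAdjoint_adjointSol hα hT q zT
  set w := R.adjointSol α T q zT with hw
  have hzero : ∀ τ ∈ Ioo 0 T, z (T - τ) - w (T - τ) = 0 := by
    have hi : ∀ {f : ℝ → H}, IntervalIntegrable f volume 0 T →
        IntervalIntegrable (fun s => f (T - s)) volume 0 T := fun hg => by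
      simpa only [sub_zero, sub_self] using (hg.comp_sub_left T).symm
    refine R.eq_zero_of_integrated_equation hα (-q) (v := fun τ => z (T - τ) - w (T - τ))
      ((hi h.integrable).sub (hi hf.integrable))
      ((continuousOn_reflect h.continuousOn).sub (continuousOn_reflect hf.continuousOn))
      fun τ hτ => ?_
    have e3 : leftFracInt (1 - α) (fun τ => z (T - τ) - w (T - τ)) τ =
        leftFracInt (1 - α) (fun s => z (T - s)) τ -
          leftFracInt (1 - α) (fun s => w (T - s)) τ := by
      simp only [leftFracInt_eq]
      rw [← intervalIntegral.integral_sub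
        (intervalIntegrable_rlKernel_smul_reflect hα h.integrable h.continuousOn hτ)
        (intervalIntegrable_rlKernel_smul_reflect hα hf.integrable hf.continuousOn hτ)]
      refine intervalIntegral.integral_congr fun s _ => ?_
      rw [smul_sub]
    rw [e3, map_sub, h.integrated hα hτ, hf.integrated hα hτ, intervalIntegral.integral_sub
      (intervalIntegrable_reflect h.integrable hτ) (intervalIntegrable_reflect hf.integrable hτ),
      map_sub]
    simp only [smul_sub]
    abel
  refine EqOn.of_subset_closure (s := Ioo 0 T) (fun t ht => ?_)
    h.continuousOn hf.continuousOn Ioo_subset_Ico_self ?_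
  · have := hzero (T - t) ⟨by linarith [ht.2], by linarith [ht.1]⟩
    rw [sub_sub_cancel] at this
    exact sub_eq_zero.1 this
  · rw [closure_Ioo hT.ne]
    exact Ico_subset_Icc_self

end PositiveResolvent

end WellPosedness

end FracSchrodinger
end

noncomputable section

namespace FracSchrodinger

/-! ### The resolvent of the Dirichlet Laplacian -/

section Dirichlet

variable {d : ℕ} (G : TopologicalSpace.Opens (EuclideanSpace ℝ (Fin d)))

/-- The function itself (`none`) and its partial derivatives (`some i`). -/
def jetComponent (ψ : EuclideanSpace ℝ (Fin d) → ℂ) :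
    Option (Fin d) → EuclideanSpace ℝ (Fin d) → ℂ
  | none => ψ
  | some i => partialDeriv i ψ

variable {G}

theorem memLp_jetComponent (ψ : TestFunction G ℂ ⊤) (c : Option (Fin d)) :
    MemLp (jetComponent ψ c) 2 (volume.restrict (G : Set (EuclideanSpace ℝ (Fin d)))) := by
  refine MemLp.restrict _ ?_
  cases c with
  | none => exact ψ.continuous.memLp_of_hasCompactSupport ψ.hasCompactSupport
  | some i =>
    refine Continuous.memLp_of_hasCompactSupport ?_ ?_
    · have h := ψ.contDiff.continuous_fderiv (by simp)
      exact h.clm_apply continuous_const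
    · exact ψ.hasCompactSupport.fderiv_apply (𝕜 := ℝ) _

theorem differentiable_testFunction (ψ : TestFunction G ℂ ⊤) : Differentiable ℝ ψ :=
  ψ.contDiff.differentiable (by simp)

theorem jetComponent_add (ψ χ : TestFunction G ℂ ⊤) (c : Option (Fin d)) :
    jetComponent (ψ + χ : TestFunction G ℂ ⊤) c = jetComponent ψ c + jetComponent χ c := by
  cases c with
  | none => rfl
  | some i =>
    ext x
    have h : ((ψ + χ : TestFunction G ℂ ⊤) : EuclideanSpace ℝ (Fin d) → ℂ) =
      fun y => ψ y + χ y := rfl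
    simp only [jetComponent, partialDeriv, h, Pi.add_apply]
    rw [fderiv_fun_add (differentiable_testFunction ψ x) (differentiable_testFunction χ x)]
    rfl

theorem jetComponent_smul (a : ℂ) (ψ : TestFunction G ℂ ⊤) (c : Option (Fin d)) :
    jetComponent (a • ψ : TestFunction G ℂ ⊤) c = a • jetComponent ψ c := by
  cases c with
  | none => rfl
  | some i =>
    ext x
    have h : ((a • ψ : TestFunction G ℂ ⊤) : EuclideanSpace ℝ (Fin d) → ℂ) =
      fun y => a • ψ y := rfl
    simp only [jetComponent, partialDeriv, h, Pi.smul_apply]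
    rw [fderiv_fun_const_smul (differentiable_testFunction ψ x)]
    rfl

/-- The space `L²(G) × L²(G)^d`. -/
abbrev Jet (G : TopologicalSpace.Opens (EuclideanSpace ℝ (Fin d))) : Type :=
  PiLp 2 fun _ : Option (Fin d) => L2 G

variable (G) in
/-- The embedding `ψ ↦ (ψ, ∇ψ)`. -/
def jet : TestFunction G ℂ ⊤ →ₗ[ℂ] Jet G where
  toFun ψ := WithLp.toLp 2 fun c => (memLp_jetComponent ψ c).toLp _
  map_add' ψ χ := by
    ext1 c
    simp only [PiLp.add_apply, jetComponent_add]
    exact MemLp.toLp_add _ _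
  map_smul' a ψ := by
    ext1 c
    simp only [PiLp.smul_apply, jetComponent_smul, RingHom.id_apply]
    exact MemLp.toLp_const_smul _ _

theorem jet_apply (ψ : TestFunction G ℂ ⊤) (c : Option (Fin d)) :
    jet G ψ c = (memLp_jetComponent ψ c).toLp _ := rfl

variable (G) in
/-- The graph of the gradient on `H¹₀(G)`, which is a Hilbert space isomorphic to `H¹₀(G)`. -/
def gradGraph : Submodule ℂ (Jet G) := (LinearMap.range (jet G)).topologicalClosure

instance : CompleteSpace (gradGraph G) :=
  (Submodule.isClosed_topologicalClosure _).completeSpace_coe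

theorem jet_mem_gradGraph (ψ : TestFunction G ℂ ⊤) : jet G ψ ∈ gradGraph G :=
  Submodule.le_topologicalClosure _ ⟨ψ, rfl⟩

/-- L² convergence of a test function and its partial derivatives is convergence in the product
space, where closure points are limits of sequences. -/
theorem hasGradH10_iff (m : Jet G) :
    HasGradH10 G (m none) (fun i => m (some i)) ↔ m ∈ gradGraph G := by
  have key : ∀ φ : ℕ → TestFunction G ℂ ⊤, Tendsto (fun k => jet G (φ k)) atTop (𝓝 m) ↔
      ∀ c, Tendsto (fun k => eLpNorm (fun x => jetComponent (φ k) c x - m c x) 2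
        (volume.restrict (G : Set (EuclideanSpace ℝ (Fin d))))) atTop (𝓝 0) := by
    intro φ
    have h1 : Tendsto (fun k => jet G (φ k)) atTop (𝓝 m) ↔
        ∀ c, Tendsto (fun k => jet G (φ k) c) atTop (𝓝 (m c)) := by
      rw [(PiLp.homeomorph 2 fun _ : Option (Fin d) => L2 G).isInducing.tendsto_nhds_iff]
      exact tendsto_pi_nhds
    rw [h1]
    refine forall_congr' fun c => ?_
    rw [Lp.tendsto_Lp_iff_tendsto_eLpNorm']
    refine iff_of_eq ?_
    congr 1
    ext k
    refine eLpNorm_congr_ae ?_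
    filter_upwards [(memLp_jetComponent (φ k) c).coeFn_toLp] with x hx
    rw [Pi.sub_apply, jet_apply, hx]
  have h2 : m ∈ gradGraph G ↔ ∃ φ : ℕ → TestFunction G ℂ ⊤,
      Tendsto (fun k => jet G (φ k)) atTop (𝓝 m) := by
    rw [gradGraph, ← SetLike.mem_coe, Submodule.topologicalClosure_coe, mem_closure_iff_seq_limit]
    constructor
    · rintro ⟨x, hx, hlim⟩
      choose φ hφ using hx
      exact ⟨φ, by simpa only [hφ] using hlim⟩
    · rintro ⟨φ, hφ⟩
      exact ⟨fun k => jet G (φ k), fun k => ⟨φ k, rfl⟩, hφ⟩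
  rw [h2]
  refine exists_congr fun φ => ?_
  rw [key, Option.forall]
  rfl

variable (G) in
/-- The embedding of `H¹₀(G)` into `L²(G)`. -/
def gradGraphFst : gradGraph G →L[ℂ] L2 G :=
  (PiLp.proj 2 (fun _ : Option (Fin d) => L2 G) none : Jet G →L[ℂ] L2 G) ∘L (gradGraph G).subtypeL

/-- The fundamental lemma of the calculus of variations; real-valued test functions already suffice.
-/
theorem eq_zero_of_orthogonal_testFunction (v : L2 G)
    (h : ∀ ψ : TestFunction G ℂ ⊤, inner ℂ (jet G ψ none) v = 0) : v = 0 := by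
  rw [Lp.eq_zero_iff_ae_eq_zero]
  have hloc : LocallyIntegrableOn v (G : Set (EuclideanSpace ℝ (Fin d))) volume := by
    refine locallyIntegrableOn_of_locallyIntegrable_restrict ?_
    exact (Lp.memLp v).locallyIntegrable (by norm_num)
  rw [Filter.EventuallyEq, ae_restrict_iff' G.isOpen.measurableSet]
  refine IsOpen.ae_eq_zero_of_integral_contDiff_smul_eq_zero G.isOpen hloc fun g hg hgc hgs => ?_
  have hof : ContDiff ℝ (⊤ : ℕ∞) fun x => (g x : ℂ) := Complex.ofRealCLM.contDiff.comp hg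
  have hsupp : tsupport (fun x => (g x : ℂ)) ⊆ tsupport g :=
    closure_mono fun x hx => by simpa using hx
  let ψ : TestFunction G ℂ ⊤ := ⟨fun x => (g x : ℂ), hof,
    hgc.of_isClosed_subset (isClosed_tsupport _) hsupp, hsupp.trans hgs⟩
  have h1 := h ψ
  rw [L2.inner_def] at h1
  have h2 : ∫ x, g x • v x = ∫ x in (G : Set (EuclideanSpace ℝ (Fin d))), g x • v x := by
    rw [setIntegral_eq_integral_of_forall_compl_eq_zero]
    intro x hx
    have : g x = 0 := by
      by_contra hne
      exact hx (hgs (subset_tsupport _ hne))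
    rw [this, zero_smul]
  rw [h2, ← h1]
  refine integral_congr_ae ?_
  filter_upwards [(memLp_jetComponent ψ none).coeFn_toLp] with x hx
  rw [jet_apply, hx]
  have h3 : jetComponent ψ none x = (g x : ℂ) := rfl
  rw [h3]
  simp [mul_comm]

variable (G) in
/-- The operator `(1 - Δ)⁻¹` for the Dirichlet Laplacian `Δ`. -/
def dirichletResolvent : PositiveResolvent (L2 G) where
  op := gradGraphFst G ∘L (gradGraphFst G).adjoint
  isPositive := ContinuousLinearMap.isPositive_self_comp_adjoint _
  denseRange := by
    set S := gradGraphFst G ∘L (gradGraphFst G).adjoint with hS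
    have hsa : S.adjoint = S :=
      (ContinuousLinearMap.isPositive_self_comp_adjoint (gradGraphFst G)).isSelfAdjoint.adjoint_eq
    -- S = JJ* with J the embedding of H¹₀ into L². If Sv = 0 then J*v = 0, so v is orthogonal to
    -- all test functions and vanishes. For self-adjoint S, injectivity gives dense range.
    have hker : S.ker = ⊥ := by
      rw [LinearMap.ker_eq_bot']
      intro v hv
      have h1 : (gradGraphFst G).adjoint v = 0 := by
        rw [← inner_self_eq_zero (𝕜 := ℂ), ContinuousLinearMap.adjoint_inner_right]
        change inner ℂ (S v) v = 0
        have hv' : S v = 0 := hv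
        rw [hv', inner_zero_left]
      refine eq_zero_of_orthogonal_testFunction v fun ψ => ?_
      have h2 := ContinuousLinearMap.adjoint_inner_right (gradGraphFst G)
        ⟨jet G ψ, jet_mem_gradGraph ψ⟩ v
      rw [h1, inner_zero_right] at h2
      exact h2.symm
    have h := ContinuousLinearMap.orthogonal_range S
    rw [hsa, hker, ← Submodule.topologicalClosure_eq_top_iff,
      ← Submodule.dense_iff_topologicalClosure_eq_top] at h
    exact h

theorem inner_jet (ψ : TestFunction G ℂ ⊤) (m : Jet G) : inner ℂ (jet G ψ) m =
    inner ℂ (jet G ψ none) (m none) + ∑ i, inner ℂ (jet G ψ (some i)) (m (some i)) := by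
  rw [PiLp.inner_apply, Fintype.sum_option]

theorem inner_jet_component (ψ : TestFunction G ℂ ⊤) (c : Option (Fin d)) (v : L2 G) :
    inner ℂ (jet G ψ c) v =
      ∫ x in (G : Set (EuclideanSpace ℝ (Fin d))), v x * conj (jetComponent ψ c x) := by
  rw [L2.inner_def]
  refine integral_congr_ae ?_
  filter_upwards [(memLp_jetComponent ψ c).coeFn_toLp] with x hx
  rw [jet_apply, hx]
  simp

/-- The complex conjugate of a test function. -/
def conjTestFunction (ψ : TestFunction G ℂ ⊤) : TestFunction G ℂ ⊤ where
  toFun x := conj (ψ x)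
  contDiff' := Complex.conjCLE.contDiff.comp ψ.contDiff
  hasCompactSupport' := ψ.hasCompactSupport.comp_left (map_zero _)
  tsupport_subset' := (tsupport_comp_subset (map_zero _) _).trans ψ.tsupport_subset

theorem jetComponent_conj (ψ : TestFunction G ℂ ⊤) (c : Option (Fin d))
    (x : EuclideanSpace ℝ (Fin d)) :
    jetComponent (conjTestFunction ψ) c x = conj (jetComponent ψ c x) := by
  cases c with
  | none => rfl
  | some i =>
    have h : (conjTestFunction ψ : EuclideanSpace ℝ (Fin d) → ℂ) = Complex.conjCLE ∘ ψ := rfl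
    simp only [jetComponent, partialDeriv, h]
    rw [Complex.conjCLE.comp_fderiv]
    rfl

/-- The test functions are dense in the graph space, so the variational equation holds against all
of it, and this characterizes J*η with J the embedding `gradGraphFst`. -/
theorem mem_gradGraph_weak (m : Jet G) (η : L2 G) (hm : m ∈ gradGraph G) :
    (∀ ψ : TestFunction G ℂ ⊤, inner ℂ (jet G ψ) m = inner ℂ (jet G ψ none) η) ↔
      m = (gradGraphFst G).adjoint η := by
  constructor
  · intro h
    have h1 : ∀ w ∈ gradGraph G, inner ℂ w m = inner ℂ (w none) η := by
      intro w hw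
      have hc : IsClosed {w : Jet G | inner ℂ w m = inner ℂ (w none) η} :=
        isClosed_eq (by fun_prop) (by fun_prop)
      refine closure_minimal (s := (LinearMap.range (jet G) : Set (Jet G))) ?_ hc ?_
      · rintro _ ⟨ψ, rfl⟩
        exact h ψ
      · rwa [← Submodule.topologicalClosure_coe]
    have h2 : (⟨m, hm⟩ : gradGraph G) = (gradGraphFst G).adjoint η := by
      refine ext_inner_left ℂ fun w => ?_
      rw [ContinuousLinearMap.adjoint_inner_right]
      exact h1 w w.2
    exact congrArg Subtype.val h2
  · intro h ψ
    rw [h]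
    exact ContinuousLinearMap.adjoint_inner_right (gradGraphFst G)
      ⟨jet G ψ, jet_mem_gradGraph ψ⟩ η

/-- The weak equation is bilinear and the inner product sesquilinear; conjugation maps test
functions onto themselves and reconciles the two. Adding the zeroth-order term to both sides
produces 1 - Δ. -/
theorem weak_laplacian_iff (m : Jet G) (f : L2 G) :
    (∀ ψ : TestFunction G ℂ ⊤,
      ∑ i, ∫ x in (G : Set (EuclideanSpace ℝ (Fin d))), m (some i) x * partialDeriv i ψ x =
        -∫ x in (G : Set (EuclideanSpace ℝ (Fin d))), f x * ψ x) ↔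
    ∀ ψ : TestFunction G ℂ ⊤, inner ℂ (jet G ψ) m = inner ℂ (jet G ψ none) (m none - f) := by
  have key : ∀ ψ : TestFunction G ℂ ⊤,
      (∑ i, ∫ x in (G : Set (EuclideanSpace ℝ (Fin d))),
        m (some i) x * partialDeriv i (conjTestFunction ψ) x =
        -∫ x in (G : Set (EuclideanSpace ℝ (Fin d))), f x * conjTestFunction ψ x) ↔
      inner ℂ (jet G ψ) m = inner ℂ (jet G ψ none) (m none - f) := by
    intro ψ
    have h1 : ∀ i x, partialDeriv i (conjTestFunction ψ) x = conj (jetComponent ψ (some i) x) :=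
      fun i x => jetComponent_conj ψ (some i) x
    have h2 : ∀ x, conjTestFunction ψ x = conj (jetComponent ψ none x) := fun x => rfl
    simp only [h1, h2]
    rw [inner_jet, inner_sub_right, inner_jet_component ψ none f]
    simp only [inner_jet_component ψ (some _)]
    constructor
    · intro h
      rw [h]; ring
    · intro h
      linear_combination h
  refine ⟨fun h ψ => (key ψ).1 (h _), fun h ψ => ?_⟩
  have h1 : conjTestFunction (conjTestFunction ψ) = ψ :=
    TestFunction.ext fun x => Complex.conj_conj _
  rw [← h1]
  exact (key _).2 (h _)

/-- φ is the Riesz solution of (1 - Δ)φ = φ - f in H¹₀(G), that is, JJ* applied to φ - f. -/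
theorem isDirichletLaplacian_iff (φ f : L2 G) :
    IsDirichletLaplacian G φ f ↔ φ = (dirichletResolvent G).op (φ - f) := by
  constructor
  · rintro ⟨g, hg, h⟩
    let m : Jet G := WithLp.toLp 2 fun c => c.elim φ g
    have hm : m ∈ gradGraph G := (hasGradH10_iff m).1 hg
    have h1 := (mem_gradGraph_weak m (φ - f) hm).1 ((weak_laplacian_iff m f).1 h)
    exact congrArg (fun m : Jet G => m none) h1
  · intro h
    let m : Jet G := (gradGraphFst G).adjoint (φ - f)
    have hm : m ∈ gradGraph G := Subtype.property _
    have h1 : m none = φ := h.symm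
    refine ⟨fun i => m (some i), h1 ▸ (hasGradH10_iff m).2 hm, ?_⟩
    refine (weak_laplacian_iff m f).2 ?_
    rw [h1]
    exact (mem_gradGraph_weak m (φ - f) hm).2 rfl

theorem isDirichletLaplacian_op (η : L2 G) :
    IsDirichletLaplacian G ((dirichletResolvent G).op η) ((dirichletResolvent G).op η - η) := by
  rw [isDirichletLaplacian_iff, sub_sub_cancel]

end Dirichlet

end FracSchrodinger

end

noncomputable section

namespace FracSchrodinger

/-! ### The dual of `L¹` and the Hahn–Banach theorem -/

section Dual

/-- The estimate makes f factor through L as a functional of norm at most C on the range of L, which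
Hahn–Banach extends. -/
theorem exists_dual_of_le {V X : Type*} [AddCommGroup V] [Module ℂ V] [NormedAddCommGroup X]
    [NormedSpace ℂ X] (f : V →ₗ[ℂ] ℂ) (L : V →ₗ[ℂ] X) {C : ℝ} (hC : 0 ≤ C)
    (h : ∀ v, ‖f v‖ ≤ C * ‖L v‖) : ∃ g : StrongDual ℂ X, ‖g‖ ≤ C ∧ ∀ v, g (L v) = f v := by
  have hker : L.ker ≤ f.ker := fun v hv => by
    have h1 := h v
    rw [LinearMap.mem_ker.1 hv, norm_zero, mul_zero] at h1
    exact norm_le_zero_iff.1 h1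
  let e := L.quotKerEquivRange
  let f₁ : L.range →ₗ[ℂ] ℂ := (L.ker.liftQ f hker) ∘ₗ e.symm.toLinearMap
  have hf₁ : ∀ v, f₁ ⟨L v, LinearMap.mem_range_self L v⟩ = f v := fun v => by
    have h2 : e.symm ⟨L v, LinearMap.mem_range_self L v⟩ = L.ker.mkQ v := by
      rw [LinearEquiv.symm_apply_eq]
      rfl
    change L.ker.liftQ f hker (e.symm _) = f v
    rw [h2]
    exact Submodule.liftQ_apply _ _ _
  have hb : ∀ x : L.range, ‖f₁ x‖ ≤ C * ‖x‖ := by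
    rintro ⟨_, v, rfl⟩
    rw [hf₁ v]
    exact h v
  obtain ⟨g, hg, hn⟩ := exists_extension_norm_eq (𝕜 := ℂ) L.range (f₁.mkContinuous C hb)
  refine ⟨g, hn.trans_le (LinearMap.mkContinuous_norm_le _ hC _), fun v => ?_⟩
  rw [← hf₁ v]
  exact hg ⟨L v, LinearMap.mem_range_self L v⟩

variable {X : Type*} [MeasurableSpace X] {π : Measure X} [IsFiniteMeasure π]

/-- The phase `|w| / w`. -/
def phase (w : ℂ) : ℂ := conj w * (‖w‖⁻¹ : ℝ)

theorem measurable_phase : Measurable phase := by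
  unfold phase; fun_prop

theorem norm_phase_le (w : ℂ) : ‖phase w‖ ≤ 1 := by
  rw [phase, norm_mul, RCLike.norm_conj, Complex.norm_real, norm_inv, norm_norm]
  exact mul_inv_le_one

theorem mul_phase (w : ℂ) : w * phase w = (‖w‖ : ℂ) := by
  rcases eq_or_ne w 0 with rfl | hw
  · simp
  · rw [phase, ← mul_assoc, Complex.mul_conj, Complex.normSq_eq_norm_sq]
    push_cast
    have : (‖w‖ : ℂ) ≠ 0 := by exact_mod_cast norm_ne_zero_iff.2 hw
    field_simp

/-- Testing with the phase of g on a set s gives ∫_s |g| ≤ ‖ψ‖π(s) for every measurable s. -/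
theorem ae_norm_le_of_dual (ψ : StrongDual ℂ (Lp ℂ 1 π)) {g : X → ℂ} (hg : MemLp g 2 π)
    (h : ∀ (F : X → ℂ) (hF : MemLp F 2 π),
      ψ ((hF.mono_exponent (by norm_num)).toLp F) = ∫ x, F x * g x ∂π) :
    ∀ᵐ x ∂π, ‖g x‖ ≤ ‖ψ‖ := by
  have hgi : Integrable g π := hg.integrable (by norm_num)
  refine ae_le_of_forall_setIntegral_le hgi.norm (integrable_const _) fun s hs _ => ?_
  have hbd : ∀ x, ‖s.indicator (fun x => phase (g x)) x‖ ≤ 1 := fun x =>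
    (norm_indicator_le_norm_self _ x).trans (norm_phase_le _)
  have hF : MemLp (s.indicator fun x => phase (g x)) 2 π :=
    MemLp.of_bound ((measurable_phase.comp_aemeasurable
      hg.aestronglyMeasurable.aemeasurable).aestronglyMeasurable.indicator hs) 1 (ae_of_all _ hbd)
  have h1 := h _ hF
  have h2 : ∫ x, s.indicator (fun x => phase (g x)) x * g x ∂π = (∫ x in s, ‖g x‖ ∂π : ℝ) := by
    rw [← integral_indicator hs, ← integral_complex_ofReal]
    refine integral_congr_ae (ae_of_all _ fun x => ?_)
    by_cases hx : x ∈ s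
    · simp [hx, ← mul_phase, mul_comm]
    · simp [hx]
  have h3 : ‖(hF.mono_exponent (by norm_num) : MemLp _ 1 π).toLp _‖ ≤ ∫ x in s, (1 : ℝ) ∂π := by
    rw [L1.norm_eq_integral_norm, ← integral_indicator hs]
    refine integral_mono_ae (L1.integrable_coeFn _).norm ((integrable_const _).indicator hs) ?_
    filter_upwards [(hF.mono_exponent (by norm_num) : MemLp _ 1 π).coeFn_toLp] with x hx
    rw [hx]
    by_cases hxs : x ∈ s
    · simpa [hxs] using norm_phase_le (g x)
    · simp [hxs]
  calc ∫ x in s, ‖g x‖ ∂π ≤ ‖((∫ x in s, ‖g x‖ ∂π : ℝ) : ℂ)‖ := by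
        rw [Complex.norm_real]; exact le_abs_self _
    _ = ‖ψ ((hF.mono_exponent (by norm_num)).toLp _)‖ := by rw [h1, h2]
    _ ≤ ‖ψ‖ * ∫ x in s, (1 : ℝ) ∂π :=
        (ψ.le_opNorm _).trans (mul_le_mul_of_nonneg_left h3 (norm_nonneg _))
    _ = ∫ x in s, ‖ψ‖ ∂π := by
        rw [← integral_const_mul, mul_one]

/-- On a finite measure space L² embeds continuously in L¹, so the Riesz theorem in L² represents
the restricted functional. The conjugate turns the inner product into a bilinear pairing. -/
theorem exists_riesz_of_dual (ψ : StrongDual ℂ (Lp ℂ 1 π)) :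
    ∃ g : X → ℂ, MemLp g 2 π ∧ ∀ (F : X → ℂ) (hF : MemLp F 2 π),
      ψ ((hF.mono_exponent (by norm_num)).toLp F) = ∫ x, F x * g x ∂π := by
  have hle : ∀ F : Lp ℂ 2 π, MemLp F 1 π := fun F => (Lp.memLp F).mono_exponent (by norm_num)
  let ι : Lp ℂ 2 π →ₗ[ℂ] Lp ℂ 1 π :=
    { toFun := fun F => (hle F).toLp F
      map_add' := fun F K => by
        rw [← MemLp.toLp_add]
        exact MemLp.toLp_congr _ _ (Lp.coeFn_add F K)
      map_smul' := fun c F => by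
        rw [RingHom.id_apply, ← MemLp.toLp_const_smul]
        exact MemLp.toLp_congr _ _ (Lp.coeFn_smul c F) }
  have hbd : ∀ F, ‖ψ (ι F)‖ ≤ (‖ψ‖ * (π univ ^ (1 / (1 : ℝ≥0∞).toReal -
      1 / (2 : ℝ≥0∞).toReal)).toReal) * ‖F‖ := fun F => by
    refine (ψ.le_opNorm _).trans ?_
    rw [mul_assoc]
    refine mul_le_mul_of_nonneg_left ?_ (norm_nonneg _)
    change ‖(hle F).toLp F‖ ≤ _
    rw [Lp.norm_toLp, Lp.norm_def, ← ENNReal.toReal_mul, mul_comm]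
    refine ENNReal.toReal_mono ?_
      (eLpNorm_le_eLpNorm_mul_rpow_measure_univ (by norm_num) (Lp.aestronglyMeasurable F))
    refine ENNReal.mul_ne_top (Lp.eLpNorm_ne_top F) ?_
    exact ENNReal.rpow_ne_top_of_nonneg (by norm_num) (measure_ne_top _ _)
  let φ : StrongDual ℂ (Lp ℂ 2 π) := (ψ.toLinearMap ∘ₗ ι).mkContinuous _ hbd
  let g := (InnerProductSpace.toDual ℂ (Lp ℂ 2 π)).symm φ
  refine ⟨fun x => conj (g x), (Lp.memLp g).star, fun F hF => ?_⟩
  have h1 : inner ℂ g (hF.toLp F) = φ (hF.toLp F) :=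
    InnerProductSpace.toDual_symm_apply
  have h2 : φ (hF.toLp F) = ψ ((hF.mono_exponent (by norm_num)).toLp F) := by
    change ψ ((hle (hF.toLp F)).toLp _) = _
    congr 1
    exact MemLp.toLp_congr _ _ hF.coeFn_toLp
  rw [← h2, ← h1, L2.inner_def]
  refine integral_congr_ae ?_
  filter_upwards [hF.coeFn_toLp] with x hx
  rw [hx]
  simp

/-- On a finite measure space every continuous functional on `L¹` is given by a function in
`L^∞`. -/
theorem exists_Linfty_of_dual (ψ : StrongDual ℂ (Lp ℂ 1 π)) :
    ∃ u : Lp ℂ ∞ π, ‖u‖ ≤ ‖ψ‖ ∧ ∀ F : Lp ℂ 1 π, ψ F = ∫ x, u x * F x ∂π := by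
  obtain ⟨g, hg, hψ⟩ := exists_riesz_of_dual ψ
  have hbd := ae_norm_le_of_dual ψ hg hψ
  have hgt : MemLp g ∞ π := memLp_top_of_bound hg.aestronglyMeasurable _ hbd
  have hu : (hgt.toLp g : X → ℂ) =ᵐ[π] g := hgt.coeFn_toLp
  refine ⟨hgt.toLp g, ?_, ?_⟩
  · refine Lp.norm_le_of_ae_bound (norm_nonneg ψ) ?_ |>.trans ?_
    · filter_upwards [hu, hbd] with x hx hx'
      rwa [hx]
    · simp
  · let Φ : StrongDual ℂ (Lp ℂ 1 π) :=
      (ContinuousLinearMap.mul ℂ ℂ).lpPairing π ∞ 1 (hgt.toLp g)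
    have hΦ : ∀ F : Lp ℂ 1 π, Φ F = ∫ x, (hgt.toLp g : X → ℂ) x * F x ∂π := fun F =>
      ContinuousLinearMap.lpPairing_eq_integral _ _ _
    intro F
    rw [← hΦ]
    -- Both functionals are continuous on L¹ and agree on indicators of sets of finite measure,
    -- because these lie in L².
    refine Lp.induction (by norm_num) (motive := fun F => ψ F = Φ F) ?_ ?_ ?_ F
    · intro c s hs hμs
      have h1 : MemLp (s.indicator fun _ => c) 2 π := memLp_indicator_const _ hs _ (Or.inr hμs.ne)
      have h2 : (Lp.simpleFunc.indicatorConst 1 hs hμs.ne c : Lp ℂ 1 π) =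
          (h1.mono_exponent (by norm_num) : MemLp _ 1 π).toLp _ := by
        rw [Lp.simpleFunc.coe_indicatorConst]
        rfl
      rw [h2, hψ _ h1, hΦ]
      refine integral_congr_ae ?_
      filter_upwards [hu, (h1.mono_exponent (by norm_num) : MemLp _ 1 π).coeFn_toLp] with x hx hx'
      rw [hx, hx', mul_comm]
    · intro f k hf hk _ h1 h2
      rw [map_add, map_add, h1, h2]
    · exact isClosed_eq ψ.continuous Φ.continuous

end Dual

end FracSchrodinger

end

noncomputable section

namespace FracSchrodinger

/-! ### Functions of two variables and functions with values in `L²` -/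

section Curry

variable {X : Type*} [MeasurableSpace X]

/-- Taking the first member of a dense sequence within ε gives a countably valued measurable
approximation, using only measurability of distances. -/
theorem exists_measurable_index {H : Type*} [PseudoMetricSpace H] [TopologicalSpace.SeparableSpace H]
    [Nonempty H] {U : X → H} (hU : ∀ c, Measurable fun t => dist c (U t)) {ε : ℝ} (hε : 0 < ε) :
    ∃ k : X → ℕ, Measurable k ∧ ∀ t, dist (TopologicalSpace.denseSeq H (k t)) (U t) < ε := by
  classical
  have hex : ∀ t, ∃ n, dist (TopologicalSpace.denseSeq H n) (U t) < ε := fun t => by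
    obtain ⟨_, hx, n, rfl⟩ := Metric.dense_iff.1 (TopologicalSpace.denseRange_denseSeq H) (U t) ε hε
    exact ⟨n, hx⟩
  exact ⟨fun t => Nat.find (hex t), measurable_find hex fun n =>
    measurableSet_lt (hU _) measurable_const, fun t => Nat.find_spec (hex t)⟩

theorem stronglyMeasurable_of_measurable_dist {H : Type*} [MetricSpace H]
    [TopologicalSpace.SeparableSpace H] [Nonempty H] {U : X → H}
    (hU : ∀ c, Measurable fun t => dist c (U t)) : StronglyMeasurable U := by
  choose k hk hkU using fun n : ℕ => exists_measurable_index hU (ε := (1 / 2 : ℝ) ^ n) (by positivity)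
  refine stronglyMeasurable_of_tendsto (f := fun n t => TopologicalSpace.denseSeq H (k n t)) atTop
    (fun n => (StronglyMeasurable.of_discrete).comp_measurable (hk n)) ?_
  rw [tendsto_pi_nhds]
  intro t
  rw [tendsto_iff_dist_tendsto_zero]
  exact squeeze_zero (fun _ => dist_nonneg) (fun n => (hkU n t).le)
    (tendsto_pow_atTop_nhds_zero_of_lt_one (by norm_num) (by norm_num))

/-- A geometric rate makes the whole sequence converge almost everywhere; convergence in measure
identifies the limit along a subsequence. -/
theorem ae_tendsto_of_dist_lt {E : Type*} [MeasurableSpace E] {μ : Measure E}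
    {f : ℕ → Lp ℂ 2 μ} {g : Lp ℂ 2 μ}
    (h : ∀ n, dist (f n) g < (1 / 2 : ℝ) ^ n) :
    ∀ᵐ x ∂μ, Tendsto (fun n => f n x) atTop (𝓝 (g x)) := by
  have hB : ∑' n : ℕ, ENNReal.ofReal (2 * (1 / 2 : ℝ) ^ n) ≠ ∞ :=
    ((summable_geometric_of_lt_one (by norm_num) (by norm_num)).mul_left 2).tsum_ofReal_ne_top
  have hlim : Tendsto f atTop (𝓝 g) := by
    rw [tendsto_iff_dist_tendsto_zero]
    exact squeeze_zero (fun _ => dist_nonneg) (fun n => (h n).le)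
      (tendsto_pow_atTop_nhds_zero_of_lt_one (by norm_num) (by norm_num))
  have h1 := Lp.ae_tendsto_of_cauchy_eLpNorm (fun n => Lp.aestronglyMeasurable (f n)) (p := 2)
    (by norm_num) hB fun N n m hn hm => by
      have h2 : dist (f n) (f m) < 2 * (1 / 2 : ℝ) ^ N := by
        have hmono : ∀ {j}, N ≤ j → dist (f j) g < (1 / 2 : ℝ) ^ N := fun {j} hj =>
          (h j).trans_le (pow_le_pow_of_le_one (by norm_num) (by norm_num) hj)
        linarith [dist_triangle_right (f n) (f m) g, hmono hn, hmono hm]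
      rw [Lp.dist_def] at h2
      rwa [← ENNReal.ofReal_toReal
        (((Lp.memLp (f n)).sub (Lp.memLp (f m))).eLpNorm_ne_top),
        ENNReal.ofReal_lt_ofReal_iff (by positivity)]
  obtain ⟨ns, hns, h3⟩ := ((tendstoInMeasure_of_tendsto_Lp hlim)).exists_seq_tendsto_ae
  filter_upwards [h1, h3] with x ⟨l, hl⟩ hx
  rwa [← tendsto_nhds_unique (hl.comp hns.tendsto_atTop) hx]

variable {E : Type*} [MeasurableSpace E] {μ : Measure E}
  [TopologicalSpace.SeparableSpace (Lp ℂ 2 μ)]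

/-- The distance to a fixed element is a parameter integral, measurable in t by Tonelli, and
separability does the rest. -/
theorem stronglyMeasurable_toLp_curry [SFinite μ] {u : X × E → ℂ} (hu : StronglyMeasurable u)
    (h : ∀ t, MemLp (fun x => u (t, x)) 2 μ) : StronglyMeasurable fun t => (h t).toLp _ := by
  refine stronglyMeasurable_of_measurable_dist fun c => ?_
  have h1 : ∀ t, dist c ((h t).toLp _) =
      ((∫⁻ x, ‖c x - u (t, x)‖ₑ ^ (2 : ℝ) ∂μ) ^ (1 / (2 : ℝ))).toReal := fun t => by
    rw [Lp.dist_def, eLpNorm_congr_ae (g := fun x => c x - u (t, x)),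
      eLpNorm_eq_lintegral_rpow_enorm_toReal (by norm_num) (by norm_num)]
    · simp
    · filter_upwards [(h t).coeFn_toLp] with x hx
      rw [Pi.sub_apply, hx]
  simp only [h1]
  have h2 : Measurable fun p : X × E => ‖c p.2 - u p‖ₑ ^ (2 : ℝ) := by
    have := ((Lp.stronglyMeasurable c).measurable.comp measurable_snd).sub hu.measurable
    exact this.enorm.pow_const _
  exact (h2.lintegral_prod_right'.pow_const _).ennreal_toReal

/-- A measurable function with values in `L²` has a jointly measurable representative. -/
theorem exists_stronglyMeasurable_uncurry {Z : X → Lp ℂ 2 μ} (hZ : StronglyMeasurable Z) :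
    ∃ F : X × E → ℂ, StronglyMeasurable F ∧ ∀ t, (fun x => F (t, x)) =ᵐ[μ] Z t := by
  choose k hk hkU using fun n : ℕ => exists_measurable_index (U := Z)
    (fun c => (stronglyMeasurable_const.dist hZ).measurable) (ε := (1 / 2 : ℝ) ^ n) (by positivity)
  let f : ℕ → X × E → ℂ := fun n p => TopologicalSpace.denseSeq (Lp ℂ 2 μ) (k n p.1) p.2
  have hf : ∀ n, StronglyMeasurable (f n) := fun n => by
    have h1 : Measurable fun p : ℕ × E => TopologicalSpace.denseSeq (Lp ℂ 2 μ) p.1 p.2 :=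
      measurable_from_prod_countable_right fun j =>
        (Lp.stronglyMeasurable (TopologicalSpace.denseSeq (Lp ℂ 2 μ) j)).measurable
    exact (h1.comp (((hk n).comp measurable_fst).prodMk measurable_snd)).stronglyMeasurable
  refine ⟨fun p => limUnder atTop fun n => f n p, StronglyMeasurable.limUnder hf, fun t => ?_⟩
  filter_upwards [ae_tendsto_of_dist_lt fun n => hkU n t] with x hx
  exact hx.limUnder_eq

end Curry

end FracSchrodinger

end

noncomputable section

namespace FracSchrodinger

/-! ### Controls as functions with values in `L²`, and adjoint states in `L¹` -/

section Control

variable {d : ℕ} {T : ℝ} {G : TopologicalSpace.Opens (EuclideanSpace ℝ (Fin d))}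
  {G₀ : Set (EuclideanSpace ℝ (Fin d))}

instance : TopologicalSpace.SeparableSpace (L2 G) :=
  have : Fact ((2 : ℝ≥0∞) ≠ ∞) := ⟨by norm_num⟩
  inferInstance

theorem isFiniteMeasure_restrict_of_isBounded
    (hG : Bornology.IsBounded (G : Set (EuclideanSpace ℝ (Fin d)))) :
    IsFiniteMeasure (volume.restrict (G : Set (EuclideanSpace ℝ (Fin d)))) :=
  isFiniteMeasure_restrict.2 hG.measure_lt_top.ne

/-- The function `t ↦ 1_{G₀} u(t,·)` with values in `L²(G)` given by a control `u`. -/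
theorem exists_controlInput (hG : Bornology.IsBounded (G : Set (EuclideanSpace ℝ (Fin d))))
    (hG₀ : NullMeasurableSet G₀ volume) (hG₀G : G₀ ⊆ (G : Set (EuclideanSpace ℝ (Fin d))))
    (u : Control T G₀) : ∃ (U : ℝ → L2 G) (M : ℝ), StronglyMeasurable U ∧ (∀ t, ‖U t‖ ≤ M) ∧
      ∀ᵐ t ∂volume.restrict (Ioo 0 T), ∀ φ : L2 G,
        inner ℂ φ (U t) = ∫ x in G₀, u (t, x) * conj (φ x) := by
  have := isFiniteMeasure_restrict_of_isBounded hG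
  obtain ⟨G₁, hG₁, hG₁m, hae⟩ := hG₀.exists_measurable_subset_ae_eq
  have hum := Lp.stronglyMeasurable u
  -- Truncation makes every section bounded, not just almost every one, and G₁ is a measurable
  -- version of the merely null-measurable G₀. Neither changes u almost everywhere.
  set A : Set (ℝ × EuclideanSpace ℝ (Fin d)) := {p | p.2 ∈ G₁ ∧ ‖u p‖ ≤ ‖u‖} with hA
  have hAm : MeasurableSet A :=
    (measurable_snd hG₁m).inter (measurableSet_le hum.norm.measurable measurable_const)
  have hbd : ∀ p, ‖A.indicator u p‖ ≤ ‖u‖ := fun p => by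
    by_cases hp : p ∈ A
    · rw [indicator_of_mem hp]; exact hp.2
    · rw [indicator_of_notMem hp, norm_zero]; exact norm_nonneg u
  have hm : StronglyMeasurable (A.indicator u) := hum.indicator hAm
  have hL : ∀ t, MemLp (fun x => A.indicator u (t, x)) 2
      (volume.restrict (G : Set (EuclideanSpace ℝ (Fin d)))) := fun t =>
    MemLp.of_bound (hm.comp_measurable measurable_prodMk_left).aestronglyMeasurable ‖u‖
      (ae_of_all _ fun x => hbd (t, x))
  refine ⟨fun t => (hL t).toLp _, _, stronglyMeasurable_toLp_curry hm hL, fun t =>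
    Lp.norm_le_of_ae_bound (norm_nonneg u) ?_, ?_⟩
  · filter_upwards [(hL t).coeFn_toLp] with x hx
    rw [hx]
    exact hbd (t, x)
  · have h1 : ∀ᵐ p ∂((volume : Measure ℝ).restrict (Ioo 0 T)).prod
        ((volume : Measure (EuclideanSpace ℝ (Fin d))).restrict G₀), ‖u p‖ ≤ ‖u‖ := by
      have h2 := enorm_ae_le_eLpNormEssSup u (((volume : Measure ℝ).restrict (Ioo 0 T)).prod
        ((volume : Measure (EuclideanSpace ℝ (Fin d))).restrict G₀))
      filter_upwards [h2] with p hp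
      rw [← eLpNorm_exponent_top] at hp
      rw [Lp.norm_def, ← toReal_enorm]
      exact ENNReal.toReal_mono (Lp.eLpNorm_ne_top u) hp
    filter_upwards [Measure.ae_ae_of_ae_prod h1] with t ht φ
    rw [L2.inner_def]
    have h3 : ∫ x in (G : Set (EuclideanSpace ℝ (Fin d))), inner ℂ (φ x) ((hL t).toLp _ x) =
        ∫ x in (G : Set (EuclideanSpace ℝ (Fin d))),
          G₁.indicator (fun x => A.indicator u (t, x) * conj (φ x)) x := by
      refine integral_congr_ae ?_
      filter_upwards [(hL t).coeFn_toLp] with x hx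
      rw [hx]
      by_cases hx1 : x ∈ G₁
      · simp [hx1]
      · have : (t, x) ∉ A := fun h => hx1 h.1
        simp [hx1, this]
    rw [h3, setIntegral_indicator hG₁m, inter_eq_self_of_subset_right (hG₁.trans hG₀G),
      setIntegral_congr_set hae]
    have h4 : ∀ᵐ x ∂volume.restrict G₀, x ∈ G₁ := by
      rw [← Measure.restrict_congr_set hae]
      exact ae_restrict_mem hG₁m
    refine integral_congr_ae ?_
    filter_upwards [ht, h4] with x hx hx1
    rw [indicator_of_mem (show (t, x) ∈ A from ⟨hx1, hx⟩)]

/-- The element of `L¹((0,T) × G₀)` given by an integrable function with values in `L²(G)`. -/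
theorem exists_uncurryL1 (hG : Bornology.IsBounded (G : Set (EuclideanSpace ℝ (Fin d))))
    (hG₀G : G₀ ⊆ (G : Set (EuclideanSpace ℝ (Fin d)))) {Z : ℝ → L2 G}
    (hZ : IntegrableOn Z (Ioo 0 T)) :
    ∃ F : Lp ℂ 1 (((volume : Measure ℝ).restrict (Ioo 0 T)).prod
      ((volume : Measure (EuclideanSpace ℝ (Fin d))).restrict G₀)),
      ∀ᵐ t ∂volume.restrict (Ioo 0 T), ∀ᵐ x ∂volume.restrict G₀, F (t, x) = Z t x := by
  have := isFiniteMeasure_restrict_of_isBounded hG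
  have hle : (volume : Measure (EuclideanSpace ℝ (Fin d))).restrict G₀ ≤
    volume.restrict (G : Set (EuclideanSpace ℝ (Fin d))) := Measure.restrict_mono hG₀G le_rfl
  obtain ⟨F, hF, hFZ⟩ := exists_stronglyMeasurable_uncurry hZ.1.stronglyMeasurable_mk
  set π := ((volume : Measure ℝ).restrict (Ioo 0 T)).prod
      ((volume : Measure (EuclideanSpace ℝ (Fin d))).restrict G₀) with hπ
  have hFae : ∀ᵐ t ∂volume.restrict (Ioo 0 T), ∀ᵐ x ∂volume.restrict G₀, F (t, x) = Z t x := by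
    filter_upwards [hZ.1.ae_eq_mk] with t ht
    rw [ht]
    exact ae_mono hle (hFZ t)
  have hFL : MemLp F 1 π := by
    refine ⟨hF.aestronglyMeasurable, ?_⟩
    rw [eLpNorm_one_eq_lintegral_enorm, lintegral_prod _ hF.enorm.aemeasurable]
    -- The constant of the embedding of L²(G) into L¹(G); boundedness of G makes it finite.
    set c := volume.restrict (G : Set (EuclideanSpace ℝ (Fin d))) univ ^
      (1 / (1 : ℝ≥0∞).toReal - 1 / (2 : ℝ≥0∞).toReal) with hc
    have hc1 : c ≠ ∞ := ENNReal.rpow_ne_top_of_nonneg (by norm_num) (measure_ne_top _ _)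
    have h1 : ∀ᵐ t ∂volume.restrict (Ioo 0 T), ∫⁻ x in G₀, ‖F (t, x)‖ₑ ≤ c * ‖Z t‖ₑ := by
      filter_upwards [hFae] with t ht
      rw [lintegral_congr_ae (g := fun x => ‖Z t x‖ₑ) (ht.mono fun x hx => by rw [hx]),
        ← eLpNorm_one_eq_lintegral_enorm, Lp.enorm_def, mul_comm]
      exact (eLpNorm_mono_measure _ hle).trans
        (eLpNorm_le_eLpNorm_mul_rpow_measure_univ (by norm_num) (Lp.aestronglyMeasurable _))
    refine (lintegral_mono_ae h1).trans_lt ?_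
    rw [lintegral_const_mul' _ _ hc1]
    exact ENNReal.mul_lt_top hc1.lt_top hZ.2
  refine ⟨hFL.toLp F, ?_⟩
  filter_upwards [hFae, Measure.ae_ae_of_ae_prod hFL.coeFn_toLp] with t h1 h2
  filter_upwards [h1, h2] with x hx hx'
  rw [hx', hx]

theorem Lp_prod_ext {p : ℝ≥0∞} {F K : Lp ℂ p (((volume : Measure ℝ).restrict (Ioo 0 T)).prod
      ((volume : Measure (EuclideanSpace ℝ (Fin d))).restrict G₀))}
    (h : ∀ᵐ t ∂volume.restrict (Ioo 0 T), ∀ᵐ x ∂volume.restrict G₀, F (t, x) = K (t, x)) :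
    F = K := by
  refine Lp.ext ?_
  refine (Measure.ae_prod_iff_ae_ae ?_).2 h
  exact measurableSet_eq_fun (Lp.stronglyMeasurable F).measurable
    (Lp.stronglyMeasurable K).measurable

theorem enorm_eq_L1Norm {F : Lp ℂ 1 (((volume : Measure ℝ).restrict (Ioo 0 T)).prod
      ((volume : Measure (EuclideanSpace ℝ (Fin d))).restrict G₀))} {Z : ℝ → L2 G}
    (h : ∀ᵐ t ∂volume.restrict (Ioo 0 T), ∀ᵐ x ∂volume.restrict G₀, F (t, x) = Z t x) :
    ‖F‖ₑ = L1Norm T G₀ Z := by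
  rw [Lp.enorm_def, eLpNorm_one_eq_lintegral_enorm,
    lintegral_prod _ (Lp.aestronglyMeasurable F).enorm, L1Norm]
  refine lintegral_congr_ae ?_
  filter_upwards [h] with t ht
  exact lintegral_congr_ae (ht.mono fun x hx => congrArg enorm hx)

end Control

end FracSchrodinger

end

noncomputable section

namespace FracSchrodinger

/-! ### Averaged solution operators -/

section Averages

variable {α ϱ T M : ℝ} {H : Type*} [NormedAddCommGroup H] [InnerProductSpace ℂ H] [CompleteSpace H]
  {Ω : Type*} [MeasurableSpace Ω] {P : Measure Ω} {r : Ω → ℝ}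

namespace PositiveResolvent

variable (R : PositiveResolvent H)

variable (P r) in
/-- The average over `ω` of the solution operators with parameter `r ω`. -/
def avgSolOp (α ϱ t : ℝ) (v : H) : H := ∫ ω, R.solOp α ϱ (r ω) t v ∂P

theorem avgSolOp_smul (α ϱ t : ℝ) (c : ℂ) (v : H) :
    R.avgSolOp P r α ϱ t (c • v) = c • R.avgSolOp P r α ϱ t v := by
  simp only [avgSolOp, map_smul]
  exact integral_smul c _

variable [IsProbabilityMeasure P]

theorem integrable_solOp (hα : α ∈ Ioo (0 : ℝ) 1) (hϱ : α ≤ ϱ) (hr : Measurable r) {t : ℝ}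
    (ht : 0 ≤ t) (v : H) : Integrable (fun ω => R.solOp α ϱ (r ω) t v) P :=
  Integrable.of_bound (R.aestronglyMeasurable_solOp hr.aemeasurable aemeasurable_const
    aestronglyMeasurable_const α ϱ) (rlKernel ϱ t * ‖v‖)
    (ae_of_all _ fun ω => R.norm_solOp_le hα hϱ (r ω) ht v)

theorem norm_avgSolOp_le (hα : α ∈ Ioo (0 : ℝ) 1) (hϱ : α ≤ ϱ) {t : ℝ} (ht : 0 ≤ t) (v : H) :
    ‖R.avgSolOp P r α ϱ t v‖ ≤ rlKernel ϱ t * ‖v‖ := by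
  have h := norm_integral_le_of_norm_le_const (μ := P)
    (ae_of_all _ fun ω => R.norm_solOp_le hα hϱ (r ω) ht v)
  simpa [avgSolOp] using h

theorem avgSolOp_add (hα : α ∈ Ioo (0 : ℝ) 1) (hϱ : α ≤ ϱ) (hr : Measurable r) {t : ℝ}
    (ht : 0 ≤ t) (u v : H) :
    R.avgSolOp P r α ϱ t (u + v) = R.avgSolOp P r α ϱ t u + R.avgSolOp P r α ϱ t v := by
  simp only [avgSolOp, map_add]
  exact integral_add (R.integrable_solOp hα hϱ hr ht u) (R.integrable_solOp hα hϱ hr ht v)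

/-- The pointwise adjoint relation averaged over ω: the adjoint of the average is the average for
-r. -/
theorem inner_avgSolOp_left (hα : α ∈ Ioo (0 : ℝ) 1) (hϱ : α ≤ ϱ) (hr : Measurable r) {t : ℝ}
    (ht : 0 ≤ t) (u v : H) :
    inner ℂ (R.avgSolOp P (-r) α ϱ t u) v = inner ℂ u (R.avgSolOp P r α ϱ t v) := by
  rw [avgSolOp, avgSolOp, ← integral_inner (R.integrable_solOp hα hϱ hr ht v), ← inner_conj_symm,
    ← integral_inner (R.integrable_solOp hα hϱ hr.neg ht u), ← integral_conj]
  refine integral_congr_ae (ae_of_all _ fun ω => ?_)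
  change conj (inner ℂ v (R.solOp α ϱ (-r ω) t u)) = _
  rw [inner_conj_symm, R.inner_solOp_left hα hϱ, neg_neg]

theorem integrableOn_avgSolOp (hα : α ∈ Ioo (0 : ℝ) 1) (hT : 0 < T) (hr : Measurable r) (v : H) :
    IntegrableOn (fun t => R.avgSolOp P r α α (T - t) v) (Ioo 0 T) := by
  have hk := ((intervalIntegrable_iff_integrableOn_Ioo_of_le hT.le).1
    (intervalIntegrable_rlKernel_sub hα.1 T 0 T)).mul_const ‖v‖
  refine hk.mono' ?_ ?_
  · have h1 : AEStronglyMeasurable (fun p : ℝ × Ω => R.solOp α α (r p.2) (T - p.1) v)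
        ((volume.restrict (Ioo 0 T)).prod P) :=
      R.aestronglyMeasurable_solOp (hr.comp measurable_snd).aemeasurable
        (measurable_const.sub measurable_fst).aemeasurable aestronglyMeasurable_const α α
    exact h1.integral_prod_right'
  · filter_upwards [ae_restrict_mem measurableSet_Ioo] with t ht
    exact R.norm_avgSolOp_le hα le_rfl (sub_nonneg.2 ht.2.le) v

variable {U : ℝ → H}

theorem integrable_solOp_prod (hα : α ∈ Ioo (0 : ℝ) 1) (hT : 0 < T) (hr : Measurable r)
    (hU : AEStronglyMeasurable U (volume.restrict (Ioc 0 T))) (hM : ∀ s, ‖U s‖ ≤ M) :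
    Integrable (fun p : Ω × ℝ => R.solOp α α (r p.1) (T - p.2) (U p.2))
      (P.prod (volume.restrict (Ioc 0 T))) := by
  have hk := ((intervalIntegrable_iff_integrableOn_Ioc_of_le hT.le).1
    (intervalIntegrable_rlKernel_sub hα.1 T 0 T)).mul_const M
  have hk2 : Integrable (fun p : Ω × ℝ => rlKernel α (T - p.2) * M)
      (P.prod (volume.restrict (Ioc 0 T))) := Integrable.comp_snd hk P
  refine hk2.mono' (R.aestronglyMeasurable_solOp (hr.comp measurable_fst).aemeasurable
    (measurable_const.sub measurable_snd).aemeasurable hU.comp_snd α α) ?_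
  have h1 : ∀ᵐ p ∂P.prod (volume.restrict (Ioc 0 T)), p.2 ∈ Ioc 0 T :=
    Measure.quasiMeasurePreserving_snd.ae (ae_restrict_mem measurableSet_Ioc)
  filter_upwards [h1] with p hp
  have hp' : 0 ≤ T - p.2 := sub_nonneg.2 hp.2
  exact (R.norm_solOp_le hα le_rfl (r p.1) hp' _).trans
    (mul_le_mul_of_nonneg_left (hM _) (rlKernel_nonneg hα.1 hp'))

theorem integrable_forwardSol (hα : α ∈ Ioo (0 : ℝ) 1) (hT : 0 < T) (hr : Measurable r) (y₀ : H)
    (hU : AEStronglyMeasurable U (volume.restrict (Ioc 0 T))) (hM : ∀ s, ‖U s‖ ≤ M) :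
    Integrable (fun ω => R.forwardSol α (r ω) y₀ U T) P := by
  have h := (R.integrable_solOp_prod hα hT hr hU hM (P := P)).integral_prod_left
  refine (R.integrable_solOp hα hα.2.le hr hT.le y₀).add (h.congr (ae_of_all _ fun ω => ?_))
  exact (intervalIntegral.integral_of_le hT.le).symm

/-- The duality between the averaged forward and adjoint systems. -/
theorem inner_integral_forwardSol (hα : α ∈ Ioo (0 : ℝ) 1) (hT : 0 < T) (hr : Measurable r)
    (y₀ zT : H) (hU : AEStronglyMeasurable U (volume.restrict (Ioc 0 T)))
    (hM : ∀ s, ‖U s‖ ≤ M) :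
    inner ℂ zT (∫ ω, R.forwardSol α (r ω) y₀ U T ∂P) =
      inner ℂ (R.avgSolOp P (-r) α 1 T zT) y₀ +
        ∫ s in Ioo 0 T, inner ℂ (R.avgSolOp P (-r) α α (T - s) zT) (U s) := by
  have hi := R.integrable_solOp_prod hα hT hr hU hM (P := P)
  have h1 : ∫ ω, R.forwardSol α (r ω) y₀ U T ∂P = R.avgSolOp P r α 1 T y₀ +
      ∫ s in Ioc 0 T, R.avgSolOp P r α α (T - s) (U s) := by
    -- Fubini exchanges the expectation with the time integral; the dominating function is the
    -- integrable scalar kernel times the bound on U.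
    have h2 : ∫ s in Ioc 0 T, R.avgSolOp P r α α (T - s) (U s) =
        ∫ ω, (∫ s in (0 : ℝ)..T, R.solOp α α (r ω) (T - s) (U s)) ∂P := by
      simp only [intervalIntegral.integral_of_le hT.le]
      exact (integral_integral_swap
        (f := fun ω s => R.solOp α α (r ω) (T - s) (U s)) hi).symm
    rw [h2]
    refine integral_add (R.integrable_solOp hα hα.2.le hr hT.le y₀)
      (hi.integral_prod_left.congr (ae_of_all _ fun ω => ?_))
    exact (intervalIntegral.integral_of_le hT.le).symm
  have h3 : Integrable (fun s => R.avgSolOp P r α α (T - s) (U s))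
      (volume.restrict (Ioc 0 T)) := hi.integral_prod_right
  rw [h1, inner_add_right, ← R.inner_avgSolOp_left hα hα.2.le hr hT.le, ← integral_inner h3,
    integral_Ioc_eq_integral_Ioo]
  congr 1
  refine setIntegral_congr_fun measurableSet_Ioo fun s hs => ?_
  exact (R.inner_avgSolOp_left hα le_rfl hr (sub_nonneg.2 hs.2.le) _ _).symm

end PositiveResolvent

end Averages

end FracSchrodinger

end

noncomputable section

namespace FracSchrodinger

/-! ### Averaged solutions of the forward and the adjoint system -/

section Bridge

variable {d : ℕ} {α T q M : ℝ} {G : TopologicalSpace.Opens (EuclideanSpace ℝ (Fin d))}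
  {G₀ : Set (EuclideanSpace ℝ (Fin d))} {y₀ zT : L2 G} {u : Control T G₀} {U : ℝ → L2 G}

/-- Every pair (φ, Δφ) comes from exactly one η, namely φ - Δφ, so testing over the domain is
testing over the range of S. -/
theorem forall_isDirichletLaplacian_iff {p : L2 G → L2 G → Prop} :
    (∀ φ f, IsDirichletLaplacian G φ f → p φ f) ↔
      ∀ η, p ((dirichletResolvent G).op η) ((dirichletResolvent G).op η - η) := by
  refine ⟨fun h η => h _ _ (isDirichletLaplacian_op η), fun h φ f hφ => ?_⟩
  have h1 := (isDirichletLaplacian_iff φ f).1 hφ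
  have h2 := h (φ - f)
  rwa [← h1, sub_sub_cancel] at h2

theorem isForwardSolution_iff (hT : 0 < T)
    (hU : AEStronglyMeasurable U (volume.restrict (Ioc 0 T))) (hM : ∀ s, ‖U s‖ ≤ M)
    (hu : ∀ᵐ t ∂volume.restrict (Ioo 0 T), ∀ φ : L2 G,
      inner ℂ φ (U t) = ∫ x in G₀, u (t, x) * conj (φ x)) {y : ℝ → L2 G} :
    IsForwardSolution α T G G₀ q y₀ u y ↔
      (dirichletResolvent G).IsForward α T q y₀ U y := by
  replace hu := ae_mono (restrict_Ioo_eq_restrict_Ioc (μ := volume) (a := (0 : ℝ)) (b := T)).ge hu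
  have key : ContinuousOn y (Icc 0 T) → ∀ φ f : L2 G,
      HasCaputoDeriv α T (fun t => inner ℂ φ (y t))
        (fun t => (q : ℂ) * Complex.I * inner ℂ f (y t) + ∫ x in G₀, u (t, x) * conj (φ x)) ↔
      ∀ t ∈ Icc 0 T, leftFracInt (1 - α) (fun s => inner ℂ φ (y s) - inner ℂ φ (y 0)) t =
        ∫ s in (0 : ℝ)..t, ((q : ℂ) * Complex.I * inner ℂ f (y s) + inner ℂ φ (U s)) := by
    intro hy φ f
    have hae : (fun t => (q : ℂ) * Complex.I * inner ℂ f (y t) +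
        ∫ x in G₀, u (t, x) * conj (φ x)) =ᵐ[volume.restrict (Ioc 0 T)]
        fun t => (q : ℂ) * Complex.I * inner ℂ f (y t) + inner ℂ φ (U t) := by
      filter_upwards [hu] with t ht
      rw [ht φ]
    have hint : IntervalIntegrable (fun t => (q : ℂ) * Complex.I * inner ℂ f (y t) +
        ∫ x in G₀, u (t, x) * conj (φ x)) volume 0 T := by
      have h1 : IntervalIntegrable (fun t => (q : ℂ) * Complex.I * inner ℂ f (y t) +
          inner ℂ φ (U t)) volume 0 T := by
        refine ((intervalIntegrable_inner f (ContinuousOn.intervalIntegrable ?_)).const_mul _).add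
          (intervalIntegrable_inner φ (PositiveResolvent.intervalIntegrable_of_bound hU hM ⟨hT.le, le_rfl⟩))
        rwa [uIcc_of_le hT.le]
      rw [intervalIntegrable_iff_integrableOn_Ioc_of_le hT.le] at h1 ⊢
      exact h1.congr hae.symm
    rw [HasCaputoDeriv, and_iff_right hint]
    refine forall₂_congr fun t ht => ?_
    rw [intervalIntegral.integral_congr_ae_restrict (g := fun s =>
      (q : ℂ) * Complex.I * inner ℂ f (y s) + inner ℂ φ (U s))]
    rw [uIoc_of_le ht.1]
    exact ae_mono (Measure.restrict_mono (Ioc_subset_Ioc_right ht.2) le_rfl) hae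
  constructor
  · rintro ⟨h1, h2, h3⟩
    exact ⟨h1, h2, forall_isDirichletLaplacian_iff.1 fun φ f h => (key h1 φ f).1 (h3 φ f h)⟩
  · rintro ⟨h1, h2, h3⟩
    refine ⟨h1, h2, forall_isDirichletLaplacian_iff.2 fun η => (key h1 _ _).2 (h3 η)⟩

theorem isAdjointSolution_iff {z : ℝ → L2 G} :
    IsAdjointSolution α T G q zT z ↔ (dirichletResolvent G).IsAdjoint α T q zT z := by
  have key : ∀ φ f : L2 G, HasRightRLDeriv α T (fun t => inner ℂ φ (z t))
      (fun t => -((q : ℂ) * Complex.I * inner ℂ f (z t))) ↔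
      ∀ t ∈ Ioo 0 T, HasDerivAt (rightFracInt (1 - α) T fun t => inner ℂ φ (z t))
        ((q : ℂ) * Complex.I * inner ℂ f (z t)) t := fun φ f => by
    simp only [HasRightRLDeriv, neg_neg]
  constructor
  · rintro ⟨h1, h2, h3, h4⟩
    exact ⟨h1, h2, h3, forall_isDirichletLaplacian_iff.1 fun φ f h => (key φ f).1 (h4 φ f h)⟩
  · rintro ⟨h1, h2, h3, h4⟩
    exact ⟨h1, h2, h3, forall_isDirichletLaplacian_iff.2 fun η => (key _ _).2 (h4 η)⟩

variable {Ω : Type*} [MeasurableSpace Ω] {P : Measure Ω} [IsProbabilityMeasure P] {ξ : Ω → ℝ}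

/-- The existentially chosen family y is irrelevant: by uniqueness its values at T agree almost
surely with the mild solution, and the mild family is itself admissible and integrable. -/
theorem isAveragedFinalState_iff (hα : α ∈ Ioo (0 : ℝ) 1) (hT : 0 < T) (hξ : Measurable ξ)
    (hU : AEStronglyMeasurable U (volume.restrict (Ioc 0 T))) (hM : ∀ s, ‖U s‖ ≤ M)
    (hu : ∀ᵐ t ∂volume.restrict (Ioo 0 T), ∀ φ : L2 G,
      inner ℂ φ (U t) = ∫ x in G₀, u (t, x) * conj (φ x)) {m : L2 G} :
    IsAveragedFinalState α T G G₀ P ξ y₀ u m ↔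
      ∫ ω, (dirichletResolvent G).forwardSol α (ξ ω) y₀ U T ∂P = m := by
  constructor
  · rintro ⟨y, hy, -, rfl⟩
    refine integral_congr_ae ?_
    filter_upwards [hy] with ω hω
    exact (((isForwardSolution_iff hT hU hM hu).1 hω).eqOn hα hT hU hM ⟨hT.le, le_rfl⟩).symm
  · intro h
    exact ⟨fun ω => (dirichletResolvent G).forwardSol α (ξ ω) y₀ U, ae_of_all _ fun ω =>
      (isForwardSolution_iff hT hU hM hu).2
        ((dirichletResolvent G).isForward_forwardSol hα (ξ ω) y₀ hU hM),
      (dirichletResolvent G).integrable_forwardSol hα hT hξ y₀ hU hM, h⟩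

theorem rightFracInt_congr_Ioo {H : Type*} [NormedAddCommGroup H] [NormedSpace ℝ H] {β t : ℝ}
    (ht : t ≤ T) {f g : ℝ → H} (h : EqOn f g (Ioo t T)) :
    rightFracInt β T f t = rightFracInt β T g t := by
  rw [rightFracInt, rightFracInt, intervalIntegral.integral_of_le ht,
    intervalIntegral.integral_of_le ht, integral_Ioc_eq_integral_Ioo, integral_Ioc_eq_integral_Ioo]
  exact setIntegral_congr_fun measurableSet_Ioo fun s hs => by simp only [h hs]

/-- Again uniqueness removes the choice of solutions. The fractional integral at 0 sees z only on
(0,T), so agreement on [0,T) suffices. -/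
theorem isAveragedAdjoint_iff (hα : α ∈ Ioo (0 : ℝ) 1) (hT : 0 < T) (hξ : Measurable ξ)
    {Z : ℝ → L2 G} {W : L2 G} :
    IsAveragedAdjoint α T G P ξ zT Z W ↔
      (∀ t ∈ Ico 0 T, (dirichletResolvent G).avgSolOp P (-ξ) α α (T - t) zT = Z t) ∧
        (dirichletResolvent G).avgSolOp P (-ξ) α 1 T zT = W := by
  set R := dirichletResolvent G with hR
  have h0 : ∀ q, rightFracInt (1 - α) T (R.adjointSol α T q zT) 0 = R.solOp α 1 (-q) T zT :=
    fun q => by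
      have h := R.rightFracInt_adjointSol hα q zT hT
      rw [sub_zero] at h
      exact h
  constructor
  · rintro ⟨z, hz, hZ, -, rfl⟩
    have hz' : ∀ᵐ ω ∂P, EqOn (z ω) (R.adjointSol α T (ξ ω) zT) (Ico 0 T) := by
      filter_upwards [hz] with ω hω
      exact (isAdjointSolution_iff.1 hω).eqOn hα hT
    refine ⟨fun t ht => ?_, ?_⟩
    · rw [← (hZ t ht).2]
      refine integral_congr_ae ?_
      filter_upwards [hz'] with ω hω
      exact (hω ht).symm
    · refine integral_congr_ae ?_
      filter_upwards [hz'] with ω hω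
      rw [rightFracInt_congr_Ioo hT.le (hω.mono Ioo_subset_Ico_self), h0]
      rfl
  · rintro ⟨hZ, hW⟩
    refine ⟨fun ω => R.adjointSol α T (ξ ω) zT, ae_of_all _ fun ω =>
      isAdjointSolution_iff.2 (R.isAdjoint_adjointSol hα hT (ξ ω) zT), fun t ht =>
      ⟨R.integrable_solOp hα le_rfl hξ.neg (sub_nonneg.2 ht.2.le) zT, hZ t ht⟩, ?_, ?_⟩
    · simp only [h0]
      exact R.integrable_solOp hα hα.2.le hξ.neg hT.le zT
    · simp only [h0]
      exact hW

end Bridge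

end FracSchrodinger

end

noncomputable section

namespace FracSchrodinger

/-! ### Controllability and observability -/

section Equivalence

variable {d : ℕ} {α T C : ℝ} {G : TopologicalSpace.Opens (EuclideanSpace ℝ (Fin d))}
  {G₀ : Set (EuclideanSpace ℝ (Fin d))}
  {Ω : Type*} [MeasurableSpace Ω] {P : Measure Ω} [IsProbabilityMeasure P] {ξ : Ω → ℝ}

variable (T G₀) in
/-- Lebesgue measure on `(0,T) × G₀`. -/
abbrev cylinderMeasure : Measure (ℝ × EuclideanSpace ℝ (Fin d)) :=
  ((volume : Measure ℝ).restrict (Ioo 0 T)).prod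
    ((volume : Measure (EuclideanSpace ℝ (Fin d))).restrict G₀)

variable (α T P ξ) in
/-- `zT ↦ 𝔼(I^{1-α}_{t,T} z(0))`. -/
def avgInitial (zT : L2 G) : L2 G := (dirichletResolvent G).avgSolOp P (-ξ) α 1 T zT

variable (α T P ξ) in
/-- `zT ↦ 𝔼(z(t))`. -/
def avgAdjoint (t : ℝ) (zT : L2 G) : L2 G := (dirichletResolvent G).avgSolOp P (-ξ) α α (T - t) zT

theorem isFiniteMeasure_cylinder (hG : Bornology.IsBounded (G : Set (EuclideanSpace ℝ (Fin d))))
    (hG₀G : G₀ ⊆ (G : Set (EuclideanSpace ℝ (Fin d)))) : IsFiniteMeasure (cylinderMeasure T G₀) := by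
  have h1 : IsFiniteMeasure ((volume : Measure (EuclideanSpace ℝ (Fin d))).restrict G₀) :=
    isFiniteMeasure_restrict.2 (hG.subset hG₀G).measure_lt_top.ne
  infer_instance

/-- The L¹ classes can be chosen separately for each z_T: linearity is automatic, since a class is
determined by almost all its time sections. -/
theorem exists_adjointMap (hα : α ∈ Ioo (0 : ℝ) 1) (hT : 0 < T)
    (hG : Bornology.IsBounded (G : Set (EuclideanSpace ℝ (Fin d))))
    (hG₀G : G₀ ⊆ (G : Set (EuclideanSpace ℝ (Fin d)))) (hξ : Measurable ξ) :
    ∃ L : L2 G →ₗ[ℂ] Lp ℂ 1 (cylinderMeasure T G₀), ∀ zT,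
      ∀ᵐ t ∂volume.restrict (Ioo 0 T), ∀ᵐ x ∂volume.restrict G₀,
        L zT (t, x) = avgAdjoint α T P ξ t zT x := by
  have hle : (volume : Measure (EuclideanSpace ℝ (Fin d))).restrict G₀ ≤
    volume.restrict (G : Set (EuclideanSpace ℝ (Fin d))) := Measure.restrict_mono hG₀G le_rfl
  have hex : ∀ zT : L2 G, ∃ F : Lp ℂ 1 (cylinderMeasure T G₀),
      ∀ᵐ t ∂volume.restrict (Ioo 0 T), ∀ᵐ x ∂volume.restrict G₀,
        F (t, x) = avgAdjoint α T P ξ t zT x := fun zT =>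
    exists_uncurryL1 hG hG₀G
      ((dirichletResolvent G).integrableOn_avgSolOp hα hT hξ.neg zT)
  choose L hL using hex
  refine ⟨{ toFun := L, map_add' := fun a b => ?_, map_smul' := fun c a => ?_ }, hL⟩
  · refine Lp_prod_ext ?_
    filter_upwards [hL (a + b), hL a, hL b, Measure.ae_ae_of_ae_prod (Lp.coeFn_add (L a) (L b)),
      ae_restrict_mem measurableSet_Ioo] with t h1 h2 h3 h4 ht
    have h5 : avgAdjoint α T P ξ t (a + b) = avgAdjoint α T P ξ t a + avgAdjoint α T P ξ t b :=
      (dirichletResolvent G).avgSolOp_add hα le_rfl hξ.neg (sub_nonneg.2 ht.2.le) a b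
    filter_upwards [h1, h2, h3, h4, ae_mono hle (Lp.coeFn_add (avgAdjoint α T P ξ t a)
      (avgAdjoint α T P ξ t b))] with x k1 k2 k3 k4 k5
    rw [k1, k4, h5, k5, Pi.add_apply, Pi.add_apply, k2, k3]
  · refine Lp_prod_ext ?_
    filter_upwards [hL (c • a), hL a, Measure.ae_ae_of_ae_prod (Lp.coeFn_smul c (L a))]
      with t h1 h2 h4
    have h5 : avgAdjoint α T P ξ t (c • a) = c • avgAdjoint α T P ξ t a :=
      (dirichletResolvent G).avgSolOp_smul α α (T - t) c a
    filter_upwards [h1, h2, h4, ae_mono hle (Lp.coeFn_smul c (avgAdjoint α T P ξ t a))]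
      with x k1 k2 k4 k5
    rw [k1, RingHom.id_apply, k4, h5, k5, Pi.smul_apply, Pi.smul_apply, k2]

variable {L : L2 G →ₗ[ℂ] Lp ℂ 1 (cylinderMeasure T G₀)}

theorem integrable_mul_conj {X : Type*} [MeasurableSpace X] {π : Measure X} (u : Lp ℂ ∞ π)
    (F : Lp ℂ 1 π) : Integrable (fun p => u p * conj (F p)) π :=
  memLp_one_iff_integrable.1 ((Lp.memLp F).star.mul (Lp.memLp u))

theorem norm_integral_mul_conj_le {X : Type*} [MeasurableSpace X] {π : Measure X} (u : Lp ℂ ∞ π)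
    (F : Lp ℂ 1 π) : ‖∫ p, u p * conj (F p) ∂π‖ ≤ ‖u‖ * ‖F‖ := by
  rw [L1.norm_eq_integral_norm, ← integral_const_mul]
  refine norm_integral_le_of_norm_le ((L1.integrable_coeFn F).norm.const_mul _) ?_
  filter_upwards [enorm_ae_le_eLpNormEssSup u π] with p hp
  rw [norm_mul, RCLike.norm_conj]
  refine mul_le_mul_of_nonneg_right ?_ (norm_nonneg _)
  rw [← eLpNorm_exponent_top] at hp
  rw [Lp.norm_def, ← toReal_enorm]
  exact ENNReal.toReal_mono (Lp.eLpNorm_ne_top u) hp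

/-- The duality identity gives the inner product of the actual average with each z_T, and these
inner products determine it. -/
theorem isAveragedFinalState_iff_duality (hα : α ∈ Ioo (0 : ℝ) 1) (hT : 0 < T)
    (hG : Bornology.IsBounded (G : Set (EuclideanSpace ℝ (Fin d))))
    (hG₀ : NullMeasurableSet G₀ volume) (hG₀G : G₀ ⊆ (G : Set (EuclideanSpace ℝ (Fin d))))
    (hξ : Measurable ξ)
    (hL : ∀ zT, ∀ᵐ t ∂volume.restrict (Ioo 0 T), ∀ᵐ x ∂volume.restrict G₀,
      L zT (t, x) = avgAdjoint α T P ξ t zT x) (y₀ m : L2 G) (u : Control T G₀) :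
    IsAveragedFinalState α T G G₀ P ξ y₀ u m ↔ ∀ zT : L2 G,
      inner ℂ zT m = inner ℂ (avgInitial α T P ξ zT) y₀ +
        ∫ p, u p * conj (L zT p) ∂cylinderMeasure T G₀ := by
  obtain ⟨U, M, hU, hM, hu⟩ := exists_controlInput hG hG₀ hG₀G u
  rw [isAveragedFinalState_iff hα hT hξ hU.aestronglyMeasurable hM hu]
  have hpair : ∀ zT : L2 G, ∫ s in Ioo 0 T, inner ℂ (avgAdjoint α T P ξ s zT) (U s) =
      ∫ p, u p * conj (L zT p) ∂cylinderMeasure T G₀ := fun zT => by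
    rw [integral_prod _ (integrable_mul_conj u (L zT))]
    refine integral_congr_ae ?_
    filter_upwards [hu, hL zT] with t h1 h2
    rw [h1]
    exact integral_congr_ae (h2.mono fun x hx => by simp only [hx])
  have hdual : ∀ zT : L2 G,
      inner ℂ zT (∫ ω, (dirichletResolvent G).forwardSol α (ξ ω) y₀ U T ∂P) =
        inner ℂ (avgInitial α T P ξ zT) y₀ +
          ∫ p, u p * conj (L zT p) ∂cylinderMeasure T G₀ := fun zT => by
    rw [← hpair]
    exact (dirichletResolvent G).inner_integral_forwardSol hα hT hξ y₀ zT
      hU.aestronglyMeasurable hM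
  constructor
  · rintro rfl zT
    exact hdual zT
  · intro h
    exact ext_inner_left ℂ fun zT => (hdual zT).trans (h zT).symm

theorem L1Norm_eq_of_isAveragedAdjoint (hα : α ∈ Ioo (0 : ℝ) 1) (hT : 0 < T) (hξ : Measurable ξ)
    (hL : ∀ zT, ∀ᵐ t ∂volume.restrict (Ioo 0 T), ∀ᵐ x ∂volume.restrict G₀,
      L zT (t, x) = avgAdjoint α T P ξ t zT x) {zT : L2 G} {Z : ℝ → L2 G} {W : L2 G}
    (h : IsAveragedAdjoint α T G P ξ zT Z W) : L1Norm T G₀ Z = ‖L zT‖ₑ := by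
  refine (enorm_eq_L1Norm ?_).symm
  filter_upwards [hL zT, ae_restrict_mem measurableSet_Ioo] with t h1 ht
  rw [← ((isAveragedAdjoint_iff hα hT hξ).1 h).1 t ⟨ht.1.le, ht.2⟩]
  exact h1

theorem isAveragedAdjoint_avg (hα : α ∈ Ioo (0 : ℝ) 1) (hT : 0 < T) (hξ : Measurable ξ)
    (zT : L2 G) : IsAveragedAdjoint α T G P ξ zT (fun t => avgAdjoint α T P ξ t zT)
      (avgInitial α T P ξ zT) :=
  (isAveragedAdjoint_iff hα hT hξ).2 ⟨fun _ _ => rfl, rfl⟩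

theorem enorm_le_ofReal_mul_iff {E F : Type*} [NormedAddCommGroup E] [NormedAddCommGroup F]
    (hC : 0 ≤ C) (a : E) (b : F) : ‖a‖ₑ ≤ ENNReal.ofReal C * ‖b‖ₑ ↔ ‖a‖ ≤ C * ‖b‖ := by
  rw [← ofReal_norm, ← ofReal_norm, ← ENNReal.ofReal_mul hC,
    ENNReal.ofReal_le_ofReal_iff (by positivity)]

theorem nullObservableWithCost_iff (hα : α ∈ Ioo (0 : ℝ) 1) (hT : 0 < T) (hξ : Measurable ξ)
    (hL : ∀ zT, ∀ᵐ t ∂volume.restrict (Ioo 0 T), ∀ᵐ x ∂volume.restrict G₀,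
      L zT (t, x) = avgAdjoint α T P ξ t zT x) (hC : 0 ≤ C) :
    NullObservableWithCost α T G G₀ P ξ C ↔
      ∀ zT, ‖avgInitial α T P ξ zT‖ ≤ C * ‖L zT‖ := by
  refine forall_congr' fun zT => ?_
  rw [← enorm_le_ofReal_mul_iff hC]
  constructor
  · rintro ⟨Z, W, h, hle⟩
    rw [L1Norm_eq_of_isAveragedAdjoint hα hT hξ hL h,
      ← ((isAveragedAdjoint_iff hα hT hξ).1 h).2] at hle
    exact hle
  · intro h
    have h1 := isAveragedAdjoint_avg hα hT hξ zT (P := P)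
    exact ⟨_, _, h1, by rwa [L1Norm_eq_of_isAveragedAdjoint hα hT hξ hL h1]⟩

theorem exactObservableWithCost_iff (hα : α ∈ Ioo (0 : ℝ) 1) (hT : 0 < T) (hξ : Measurable ξ)
    (hL : ∀ zT, ∀ᵐ t ∂volume.restrict (Ioo 0 T), ∀ᵐ x ∂volume.restrict G₀,
      L zT (t, x) = avgAdjoint α T P ξ t zT x) (hC : 0 ≤ C) :
    ExactObservableWithCost α T G G₀ P ξ C ↔ ∀ zT, ‖zT‖ ≤ C * ‖L zT‖ := by
  refine forall_congr' fun zT => ?_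
  rw [← enorm_le_ofReal_mul_iff hC]
  constructor
  · rintro ⟨Z, W, h, hle⟩
    rwa [L1Norm_eq_of_isAveragedAdjoint hα hT hξ hL h] at hle
  · intro h
    have h1 := isAveragedAdjoint_avg hα hT hξ zT (P := P)
    exact ⟨_, _, h1, by rwa [L1Norm_eq_of_isAveragedAdjoint hα hT hξ hL h1]⟩

/-- Hahn–Banach on the range of L, followed by the representation of functionals on L¹ by L^∞
functions, both without loss in the norm. -/
theorem exists_control_of_le (hG : Bornology.IsBounded (G : Set (EuclideanSpace ℝ (Fin d))))
    (hG₀G : G₀ ⊆ (G : Set (EuclideanSpace ℝ (Fin d)))) (f : L2 G →ₗ[ℂ] ℂ) (hC : 0 ≤ C)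
    (h : ∀ zT, ‖f zT‖ ≤ C * ‖L zT‖) : ∃ u : Control T G₀, ‖u‖ ≤ C ∧
      ∀ zT, ∫ p, u p * conj (L zT p) ∂cylinderMeasure T G₀ = conj (f zT) := by
  have := isFiniteMeasure_cylinder (T := T) hG hG₀G
  obtain ⟨g, hg, hgL⟩ := exists_dual_of_le f L hC h
  obtain ⟨v, hv, hvF⟩ := exists_Linfty_of_dual g
  -- The control is paired with the conjugate of L z_T, whereas f must be linear for Hahn–Banach;
  -- conjugating v reconciles the two.
  refine ⟨star v, ?_, fun zT => ?_⟩
  · refine (Lp.norm_le_norm_of_ae_le ?_).trans (hv.trans hg)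
    filter_upwards [Lp.coeFn_star v] with p hp
    rw [hp, Pi.star_apply, norm_star]
  · rw [← hgL, hvF, ← integral_conj]
    refine integral_congr_ae ?_
    filter_upwards [Lp.coeFn_star v] with p hp
    rw [hp, map_mul]
    rfl

variable (α T P ξ G) in
/-- `zT ↦ 𝔼(I^{1-α}_{t,T} z(0))` as a linear map. -/
def avgInitialₗ (hα : α ∈ Ioo (0 : ℝ) 1) (hT : 0 < T) (hξ : Measurable ξ) : L2 G →ₗ[ℂ] L2 G where
  toFun := avgInitial α T P ξ
  map_add' := (dirichletResolvent G).avgSolOp_add hα hα.2.le hξ.neg hT.le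
  map_smul' := (dirichletResolvent G).avgSolOp_smul α 1 T

/-- The constant 1 = 1/Γ(1) comes from the Mittag-Leffler bound and does not depend on T or on the
law of ξ. -/
theorem norm_avgInitial_le (hα : α ∈ Ioo (0 : ℝ) 1) (hT : 0 < T) (zT : L2 G) :
    ‖avgInitial α T P ξ zT‖ ≤ ‖zT‖ := by
  have h := (dirichletResolvent G).norm_avgSolOp_le (P := P) (r := -ξ) hα hα.2.le hT.le zT
  rwa [rlKernel_one, one_mul] at h

/-- Cancel one factor ‖w‖ in ‖w‖² = ‖a‖ ≤ C‖w‖B. The case w = 0 stands apart because no sign of C is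
assumed. -/
theorem norm_le_mul_of_inner {H : Type*} [NormedAddCommGroup H] [InnerProductSpace ℂ H] {w : H}
    {a : ℂ} {b B : ℝ} (h : inner ℂ w w = a) (ha : ‖a‖ ≤ b * B) (hb : b ≤ C * ‖w‖) (hB : 0 ≤ B) :
    ‖w‖ ≤ C * B ∨ w = 0 := by
  rcases eq_or_ne w 0 with hw | hw
  · exact Or.inr hw
  left
  have hw' : 0 < ‖w‖ := norm_pos_iff.2 hw
  have h1 : ‖w‖ * ‖w‖ = ‖a‖ := by
    rw [← h, inner_self_eq_norm_sq_to_K, norm_pow, ← sq]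
    simp
  have h2 : ‖w‖ * ‖w‖ ≤ C * B * ‖w‖ := by
    rw [h1]
    exact ha.trans ((mul_le_mul_of_nonneg_right hb hB).trans_eq (by ring))
  exact le_of_mul_le_mul_right h2 hw'

theorem nullControllableWithCost_iff (hα : α ∈ Ioo (0 : ℝ) 1) (hT : 0 < T)
    (hG : Bornology.IsBounded (G : Set (EuclideanSpace ℝ (Fin d))))
    (hG₀ : NullMeasurableSet G₀ volume) (hG₀G : G₀ ⊆ (G : Set (EuclideanSpace ℝ (Fin d))))
    (hξ : Measurable ξ) (hC : 0 < C) :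
    NullControllableWithCost α T G G₀ P ξ C ↔ NullObservableWithCost α T G G₀ P ξ C := by
  obtain ⟨L, hL⟩ := exists_adjointMap (P := P) hα hT hG hG₀G hξ
  rw [nullObservableWithCost_iff hα hT hξ hL hC.le]
  constructor
  · intro h zT
    -- With y₀ = 𝔼I^{1-α}z(0), the duality identity at target 0 expresses ‖y₀‖² as minus the pairing
    -- of u with L z_T.
    obtain ⟨u, hu, hy⟩ := h (avgInitial α T P ξ zT)
    have h1 := (isAveragedFinalState_iff_duality hα hT hG hG₀ hG₀G hξ hL _ _ _).1 hy zT
    rw [inner_zero_right, eq_comm, add_eq_zero_iff_eq_neg] at h1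
    rcases norm_le_mul_of_inner h1 ((norm_neg _).trans_le (norm_integral_mul_conj_le u (L zT))) hu
      (norm_nonneg _) with h2 | h2
    · exact h2
    · rw [h2, norm_zero]
      positivity
  · intro h y₀
    -- The conjugate of the value that the pairing must take to cancel the contribution of y₀;
    -- observability bounds it by C‖y₀‖‖L z_T‖.
    let f : L2 G →ₗ[ℂ] ℂ :=
      -((innerSL ℂ y₀).toLinearMap ∘ₗ avgInitialₗ α T G P ξ hα hT hξ)
    have hf : ∀ zT, f zT = -inner ℂ y₀ (avgInitial α T P ξ zT) := fun _ => rfl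
    obtain ⟨u, hu, huf⟩ := exists_control_of_le (L := L) hG hG₀G f
      (C := C * ‖y₀‖) (by positivity) fun zT => by
        rw [hf, norm_neg]
        refine (norm_inner_le_norm _ _).trans ?_
        exact (mul_le_mul_of_nonneg_left (h zT) (norm_nonneg _)).trans_eq (by ring)
    refine ⟨u, hu, (isAveragedFinalState_iff_duality hα hT hG hG₀ hG₀G hξ hL _ _ _).2
      fun zT => ?_⟩
    rw [huf, hf, map_neg, inner_conj_symm, inner_zero_right, add_neg_cancel]

theorem exactControllableWithCost_iff (hα : α ∈ Ioo (0 : ℝ) 1) (hT : 0 < T)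
    (hG : Bornology.IsBounded (G : Set (EuclideanSpace ℝ (Fin d))))
    (hG₀ : NullMeasurableSet G₀ volume) (hG₀G : G₀ ⊆ (G : Set (EuclideanSpace ℝ (Fin d))))
    (hξ : Measurable ξ) (hC : 0 < C) :
    ExactControllableWithCost α T G G₀ P ξ C ↔ ExactObservableWithCost α T G G₀ P ξ C := by
  obtain ⟨L, hL⟩ := exists_adjointMap (P := P) hα hT hG hG₀G hξ
  rw [exactObservableWithCost_iff hα hT hξ hL hC.le]
  constructor
  · intro h zT
    -- From rest to the target z_T, the duality identity tested with z_T itself gives ‖z_T‖² as a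
    -- pairing of u with L z_T.
    obtain ⟨u, hu, hy⟩ := h 0 zT
    have h1 := (isAveragedFinalState_iff_duality hα hT hG hG₀ hG₀G hξ hL _ _ _).1 hy zT
    rw [inner_zero_right, zero_add] at h1
    rw [norm_zero, zero_add] at hu
    rcases norm_le_mul_of_inner h1 (norm_integral_mul_conj_le u (L zT)) hu
      (norm_nonneg _) with h2 | h2
    · exact h2
    · rw [h2, norm_zero]
      positivity
  · intro h y₀ y₁
    let f : L2 G →ₗ[ℂ] ℂ := (innerSL ℂ y₁).toLinearMap -
      (innerSL ℂ y₀).toLinearMap ∘ₗ avgInitialₗ α T G P ξ hα hT hξ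
    have hf : ∀ zT, f zT = inner ℂ y₁ zT - inner ℂ y₀ (avgInitial α T P ξ zT) := fun _ => rfl
    obtain ⟨u, hu, huf⟩ := exists_control_of_le (L := L) hG hG₀G f
      (C := C * (‖y₀‖ + ‖y₁‖)) (by positivity) fun zT => by
        rw [hf]
        have h1 : ‖inner ℂ y₁ zT‖ ≤ ‖y₁‖ * ‖zT‖ := norm_inner_le_norm _ _
        have h2 : ‖inner ℂ y₀ (avgInitial α T P ξ zT)‖ ≤ ‖y₀‖ * ‖zT‖ :=
          (norm_inner_le_norm _ _).trans
            (mul_le_mul_of_nonneg_left (norm_avgInitial_le hα hT zT) (norm_nonneg _))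
        -- Contractivity of z_T ↦ 𝔼I^{1-α}z(0) gives y₀ and y₁ the same weight, so the cost C is
        -- reproduced exactly.
        calc ‖inner ℂ y₁ zT - inner ℂ y₀ (avgInitial α T P ξ zT)‖
            ≤ (‖y₀‖ + ‖y₁‖) * ‖zT‖ := by
              refine (norm_sub_le _ _).trans ((add_le_add h1 h2).trans_eq ?_)
              ring
          _ ≤ (‖y₀‖ + ‖y₁‖) * (C * ‖L zT‖) := mul_le_mul_of_nonneg_left (h zT) (by positivity)
          _ = _ := by ring
    refine ⟨u, hu, (isAveragedFinalState_iff_duality hα hT hG hG₀ hG₀G hξ hL _ _ _).2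
      fun zT => ?_⟩
    rw [huf, hf, map_sub, inner_conj_symm, inner_conj_symm, add_sub_cancel]

/-- The infimum runs over positive constants only, so equivalence for each C > 0 is enough. -/
theorem optimalCost_congr {p q : ℝ → Prop} (h : ∀ C, 0 < C → (p C ↔ q C)) :
    optimalCost p = optimalCost q :=
  iInf_congr fun C => iInf_congr_Prop (and_congr_right fun hC => h C hC) fun _ => rfl

end Equivalence

end FracSchrodinger

end

theorem mainTheorem7 {d : ℕ} (hd : 1 ≤ d) {α : ℝ} (hα : α ∈ Ioo (0 : ℝ) 1) {T : ℝ} (hT : 0 < T)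
    (G : TopologicalSpace.Opens (EuclideanSpace ℝ (Fin d)))
    (hG : Bornology.IsBounded (G : Set (EuclideanSpace ℝ (Fin d))))
    (G₀ : Set (EuclideanSpace ℝ (Fin d))) (hG₀ : NullMeasurableSet G₀ volume)
    (hG₀G : G₀ ⊆ (G : Set (EuclideanSpace ℝ (Fin d)))) (hG₀pos : 0 < volume G₀)
    {Ω : Type*} [MeasurableSpace Ω] (P : Measure Ω) [IsProbabilityMeasure P]
    (ξ : Ω → ℝ) (hξ : Measurable ξ) :
    ((∃ C : ℝ, 0 < C ∧ NullControllableWithCost α T G G₀ P ξ C) ↔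
        (∃ C : ℝ, 0 < C ∧ NullObservableWithCost α T G G₀ P ξ C)) ∧
      optimalCost (NullControllableWithCost α T G G₀ P ξ) =
        optimalCost (NullObservableWithCost α T G G₀ P ξ) ∧
      ((∃ C : ℝ, 0 < C ∧ ExactControllableWithCost α T G G₀ P ξ C) ↔
        (∃ C : ℝ, 0 < C ∧ ExactObservableWithCost α T G G₀ P ξ C)) ∧
      optimalCost (ExactControllableWithCost α T G G₀ P ξ) =
        optimalCost (ExactObservableWithCost α T G G₀ P ξ) := by
  have hnull : ∀ C, 0 < C → (NullControllableWithCost α T G G₀ P ξ C ↔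
      NullObservableWithCost α T G G₀ P ξ C) := fun C hC =>
    nullControllableWithCost_iff hα hT hG hG₀ hG₀G hξ hC
  have hexact : ∀ C, 0 < C → (ExactControllableWithCost α T G G₀ P ξ C ↔
      ExactObservableWithCost α T G G₀ P ξ C) := fun C hC =>
    exactControllableWithCost_iff hα hT hG hG₀ hG₀G hξ hC
  exact ⟨exists_congr fun C => and_congr_right fun hC => hnull C hC, optimalCost_congr hnull,
    exists_congr fun C => and_congr_right fun hC => hexact C hC, optimalCost_congr hexact⟩
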